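/- **The Rauzy tiling.** Let $e_1,e_2,e_3$ be the standard basis of $\mathbb R^3$ and let $p:\mathbb R^3\to\mathbb R^2$ be the linear map with $p(e_1)=(-\frac{\sqrt3}{2},-\frac12)$, $p(e_2)=(\frac{\sqrt3}{2},-\frac12)$, $p(e_3)=(0,1)$. For $k\in\{1,2,3\}$ let $R_k$ be the rhombus spanned at the origin by the two vectors $p(e_a)$, $a\ne k$. Let $$M=\begin{pmatrix}0&1&0\\0&0&1\\1&-1&-1\end{pmatrix}$$ with columns $c_1,c_2,c_3$. For $z\in\mathbb Z^3$ a represented rhombus $(z,k)$ stands for $p(z)+R_k$; put $\mathcal R(z,1)=\{(Mz,3),(Mz+c_2,1),(Mz+c_3,2)\}$, $\mathcal R(z,2)=\{(Mz,1)\}$, $\mathcal R(z,3)=\{(Mz,2)\}$. Let $\mathcal P_0=\{(0,1),(0,2),(0,3)\}$ and $\mathcal P_{i+1}=\bigcup_{f\in\mathcal P_i}\mathcal R(f)$. The Rauzy tiling is $\bigcup_i\mathcal P_i$, and $V_i$ is the set of vertices of the rhombi of $\mathcal P_i$. **The algebras.** Let $k$ be a field, and let $Q$ be the quiver whose vertices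 are the vertices of the Rauzy tiling and in which every edge of the tiling is replaced by two arrows in opposite directions. Paths are composed from left to right in the path algebra $kQ$. For a vertex $z$ and $a\in\{1,2,3\}$ (indices modulo 3) let $$h_a(z)=b\bar b-b'\bar b',$$ where $b$, $b'$ are the arrows from $z$ to $z+p(e_a)$ and to $z-p(e_a)$, with $\bar b$, $\bar b'$ the opposite arrows, and a term is replaced by $0$ if its arrow does not exist. Choose signs $\varepsilon_1,\varepsilon_2,\varepsilon_3\in\{1,-1\}$ at the origin with $\varepsilon_1\varepsilon_2\varepsilon_3=1$, and extend them to signs $\varepsilon_d(z)$ at all vertices by the rule that $\varepsilon_d$ is unchanged along edges parallel to $p(e_d)$ and changes along all other edges. Let $I$ be the two-sided ideal of $kQ$ generated by the following relations. 1. Every path of length two that is not contained in the boundary of a single rhombus of the tiling is zero. 2. The two paths of length two along the boundary of a rhombus from a corner to the opposite corner are equal. 3. $h_{d+1}(z)=\varepsilon_d(z)\,h_{d+2}(z)$ for every vertex $z$ and every $d\in\{1,2,3\}$. The infinite-dimensional Rauzy algebra is $A=kQ/I$, and the finite-dimensional Rauzy algebras are $A_i=e_iAe_i$ with $e_i=\sum_{v\in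 V_i}e_v$, where $e_v$ is the trivial path at $v$. **Periodic modules.** For a finitely generated right $A_i$-module $N$ let $\Omega(N)$ be the kernel of a projective cover of $N$. A module $N$ is periodic if it is nonzero and finitely generated and $\Omega^n(N)\cong N$ for some $n\ge1$. **Theorem.** For every field $k$, every choice of signs as above and every $i\ge 6$, the algebra $A_i$ has a periodic module. -/

import Mathlib

open Quiver

universe u v

noncomputable section

/-! ## Path algebras of quivers -/

/-- A path of a quiver together with its start `p.1` and its end `p.2.1`. -/
abbrev QPath (V : Type v) [Quiver.{0} V] : Type v := Σ x y : V, Path x y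

/-- The path algebra `kQ`: the vector space with basis the paths of `Q`. If `Q` has infinitely many
vertices, this is an algebra without unit. -/
def PathAlgebra (k : Type u) (V : Type v) [Field k] [Quiver.{0} V] : Type (max u v) :=
  QPath V →₀ k

namespace PathAlgebra

variable (k : Type u) {V : Type v} [Field k] [Quiver.{0} V]

instance : AddCommGroup (PathAlgebra k V) := inferInstanceAs (AddCommGroup (QPath V →₀ k))

instance : Module k (PathAlgebra k V) := inferInstanceAs (Module k (QPath V →₀ k))

/-- The basis of `kQ` that consists of the paths. -/
def pathBasis : Module.Basis (QPath V) k (PathAlgebra k V) :=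
  Module.Basis.ofRepr (LinearEquiv.refl k (QPath V →₀ k))

/-- The basis element of `kQ` given by a path. -/
def ofPath (p : QPath V) : PathAlgebra k V := pathBasis k p

open Classical in
/-- Product of two paths: first `p`, then `q`, if `q` starts where `p` ends; zero otherwise. -/
def pathMul (p q : QPath V) : PathAlgebra k V :=
  if h : p.2.1 = q.1 then ofPath k ⟨p.1, q.2.1, p.2.2.comp (q.2.2.cast h.symm rfl)⟩ else 0

/-- The bilinear extension of the product of paths. -/
def mulBilin : PathAlgebra k V →ₗ[k] PathAlgebra k V →ₗ[k] PathAlgebra k V :=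
  (pathBasis k).constr k fun p => (pathBasis k).constr k fun q => pathMul k p q

instance : Mul (PathAlgebra k V) := ⟨fun a b => mulBilin k a b⟩

variable {k}

theorem mul_def (a b : PathAlgebra k V) : a * b = mulBilin k a b := rfl

theorem ofPath_mul_ofPath (p q : QPath V) : ofPath k p * ofPath k q = pathMul k p q := by
  simp only [mul_def, mulBilin, ofPath, Module.Basis.constr_basis]

theorem ofPath_mul_ofPath_of_comp {x y z : V} (p : Path x y) (q : Path y z) :
    ofPath k (⟨x, y, p⟩ : QPath V) * ofPath k ⟨y, z, q⟩ = ofPath k ⟨x, z, p.comp q⟩ := by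
  rw [ofPath_mul_ofPath]
  simp [pathMul]

theorem ofPath_mul_ofPath_of_ne {p q : QPath V} (h : p.2.1 ≠ q.1) :
    ofPath k p * ofPath k q = 0 := by
  rw [ofPath_mul_ofPath, pathMul, dif_neg h]

/-- The multiplication of paths is associative. -/
theorem mul_assoc_ofPath (p q r : QPath V) :
    ofPath k p * ofPath k q * ofPath k r = ofPath k p * (ofPath k q * ofPath k r) := by
  obtain ⟨x, y, p⟩ := p
  obtain ⟨y', z, q⟩ := q
  obtain ⟨z', w, r⟩ := r
  have zl : ∀ a : PathAlgebra k V, 0 * a = 0 := fun a => by rw [mul_def]; simp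
  have zr : ∀ a : PathAlgebra k V, a * 0 = 0 := fun a => by rw [mul_def]; simp
  by_cases h1 : y = y'
  · subst h1
    by_cases h2 : z = z'
    · subst h2
      simp only [ofPath_mul_ofPath_of_comp, Path.comp_assoc]
    · rw [ofPath_mul_ofPath_of_comp, ofPath_mul_ofPath_of_ne (by simpa using h2),
        ofPath_mul_ofPath_of_ne (by simpa using h2), zr]
  · rw [ofPath_mul_ofPath_of_ne (by simpa using h1), zl]
    by_cases h2 : z = z'
    · subst h2
      rw [ofPath_mul_ofPath_of_comp, ofPath_mul_ofPath_of_ne (by simpa using h1)]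
    · rw [ofPath_mul_ofPath_of_ne (p := ⟨y', z, q⟩) (by simpa using h2), zr]

theorem induction_linear {motive : PathAlgebra k V → Prop} (a : PathAlgebra k V)
    (zero : motive 0) (add : ∀ a b, motive a → motive b → motive (a + b))
    (smul : ∀ (c : k) (p : QPath V), motive (c • ofPath k p)) : motive a := by
  have h := (pathBasis k).mem_span a
  induction h using Submodule.closure_induction with
  | zero => exact zero
  | add x y _ _ hx hy => exact add x y hx hy
  | smul_mem c x hx =>
    obtain ⟨p, rfl⟩ := hx
    exact smul c p

instance : NonUnitalRing (PathAlgebra k V) :=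
  { (inferInstance : AddCommGroup (PathAlgebra k V)),
    (inferInstance : Mul (PathAlgebra k V)) with
    left_distrib := fun a b c => by simp only [mul_def, map_add]
    right_distrib := fun a b c => by simp only [mul_def, map_add, LinearMap.add_apply]
    zero_mul := fun a => by simp only [mul_def, map_zero, LinearMap.zero_apply]
    mul_zero := fun a => by simp only [mul_def, map_zero]
    mul_assoc := fun a b c => by
      simp only [mul_def]
      induction a using induction_linear with
      | zero => simp
      | add a a' h h' => simp [h, h']
      | smul ca p =>
      induction b using induction_linear with
      | zero => simp
      | add b b' h h' => simp only [map_add, LinearMap.add_apply, h, h']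
      | smul cb q =>
      induction c using induction_linear with
      | zero => simp
      | add c c' h h' => simp only [map_add, h, h']
      | smul cc r =>
      have h := mul_assoc_ofPath (k := k) p q r
      simp only [mul_def] at h
      simp [h] }

variable (k)

/-- The trivial path `e_x` at a vertex, as an element of the path algebra. -/
def vertexIdem (x : V) : PathAlgebra k V := ofPath k ⟨x, x, Path.nil⟩

variable {k}

theorem isIdempotentElem_sum_vertexIdem (s : Finset V) :
    IsIdempotentElem (∑ x ∈ s, vertexIdem k x) := by
  unfold IsIdempotentElem
  rw [Finset.sum_mul]
  refine Finset.sum_congr rfl fun x hx => ?_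
  rw [Finset.mul_sum, Finset.sum_eq_single x]
  · unfold vertexIdem
    rw [ofPath_mul_ofPath_of_comp, Path.comp_nil]
  · intro y _ hyx
    exact ofPath_mul_ofPath_of_ne (by simpa using hyx.symm)
  · exact fun h => absurd hx h

end PathAlgebra

/-! ## The Rauzy tiling

The types `1, 2, 3` of rhombi and the basis vectors `e₁, e₂, e₃` are indexed by `0, 1, 2 : Fin 3`. -/

namespace Rauzy

/-- The images `p(e₁), p(e₂), p(e₃)` in the Euclidean plane. -/
def planeBasis : Fin 3 → EuclideanSpace ℝ (Fin 2) :=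
  ![!₂[-(√3 / 2), -(1 / 2)], !₂[√3 / 2, -(1 / 2)], !₂[0, 1]]

/-- Points of the planar lattice `L = {m p(e₂) + n p(e₃)}`, given by their coordinates `(m, n)`. -/
abbrev Pt : Type := ℤ × ℤ

/-- The projection `p : ℤ³ → L` in the coordinates `(m, n)`; see `proj_spec`. -/
def proj (z : Fin 3 → ℤ) : Pt := (z 1 - z 0, z 2 - z 0)

/-- The point of the Euclidean plane with lattice coordinates `q`. -/
def Pt.toPlane (q : Pt) : EuclideanSpace ℝ (Fin 2) :=
  (q.1 : ℝ) • planeBasis 1 + (q.2 : ℝ) • planeBasis 2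

theorem proj_spec (z : Fin 3 → ℤ) :
    (proj z).toPlane = ∑ a, (z a : ℝ) • planeBasis a := by
  ext j
  fin_cases j <;> simp [Pt.toPlane, proj, planeBasis, Fin.sum_univ_three] <;> ring

theorem toPlane_injective : Function.Injective Pt.toPlane := by
  intro q r h
  have h0 := congrArg (fun w : EuclideanSpace ℝ (Fin 2) => w 0) h
  have h1 := congrArg (fun w : EuclideanSpace ℝ (Fin 2) => w 1) h
  simp [Pt.toPlane, planeBasis] at h0 h1
  rw [h0] at h1
  exact Prod.ext h0 (by exact_mod_cast add_left_cancel h1)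

/-- The direction `p(e_a)`. -/
def dir (a : Fin 3) : Pt := proj (Pi.single a 1)

/-- The matrix `M` of the substitution. -/
def substMatrix : Matrix (Fin 3) (Fin 3) ℤ := !![0, 1, 0; 0, 0, 1; 1, -1, -1]

/-- A represented rhombus `p(z) + R_k`, as the pair `(z, k)`. -/
abbrev Face : Type := (Fin 3 → ℤ) × Fin 3

/-- The map `𝓡` from rhombi to sets of rhombi. -/
def inflate (f : Face) : Finset Face :=
  let w := substMatrix.mulVec f.1
  match f.2 with
  | 0 => {(w, 2), (w + substMatrix.col 1, 0), (w + substMatrix.col 2, 1)}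
  | 1 => {(w, 0)}
  | 2 => {(w, 1)}

/-- The patches `P_i`, starting from `P_0 = {R₁, R₂, R₃}`. -/
def patch : ℕ → Finset Face
  | 0 => {(0, 0), (0, 1), (0, 2)}
  | i + 1 => (patch i).biUnion inflate

/-- A rhombus of the plane: `(q, k)` is the translate by `q` of `R_k`. -/
abbrev Tile : Type := Pt × Fin 3

/-- The corners of a rhombus in cyclic order. The rhombus `R_k` is spanned at the origin by the two
vectors `p(e_a)` with `a ≠ k`. -/
def corner (t : Tile) : Fin 4 → Pt :=
  ![t.1, t.1 + dir (t.2 + 1), t.1 + dir (t.2 + 1) + dir (t.2 + 2), t.1 + dir (t.2 + 2)]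

/-- The rhombi of the patch `P_i`. -/
def patchTiles (i : ℕ) : Finset Tile := (patch i).image fun f => (proj f.1, f.2)

/-- The Rauzy tiling `⋃ P_i`. -/
def tiling : Set Tile := {t | ∃ i, t ∈ patchTiles i}

/-- `x` and `y` are the two ends of a side of the rhombus `t`. -/
def IsSide (t : Tile) (x y : Pt) : Prop :=
  ∃ j : Fin 4, (x = corner t j ∧ y = corner t (j + 1)) ∨ (y = corner t j ∧ x = corner t (j + 1))

/-- `x` is a vertex of the Rauzy tiling. -/
def IsVertex (x : Pt) : Prop := ∃ t ∈ tiling, ∃ j, corner t j = x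

/-- `x` and `y` are joined by an edge of the Rauzy tiling. -/
def Adj (x y : Pt) : Prop := ∃ t ∈ tiling, IsSide t x y

theorem Adj.isVertex_left {x y : Pt} (h : Adj x y) : IsVertex x := by
  obtain ⟨t, ht, j, ⟨hx, _⟩ | ⟨_, hx⟩⟩ := h
  exacts [⟨t, ht, j, hx.symm⟩, ⟨t, ht, j + 1, hx.symm⟩]

theorem Adj.isVertex_right {x y : Pt} (h : Adj x y) : IsVertex y := by
  obtain ⟨t, ht, j, ⟨_, hy⟩ | ⟨hy, _⟩⟩ := h
  exacts [⟨t, ht, j + 1, hy.symm⟩, ⟨t, ht, j, hy.symm⟩]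

/-- The vertices of the quiver `Q`. -/
def Vertex : Type := {x : Pt // IsVertex x}

/-- The quiver `Q`: every edge of the tiling is replaced by two arrows in opposite directions. -/
instance : Quiver.{0} Vertex := ⟨fun x y => PLift (Adj x.1 y.1)⟩

/-- The vertices of the rhombi of `P_i`. -/
def patchPts (i : ℕ) : Finset Pt := (patchTiles i).biUnion fun t => Finset.univ.image (corner t)

theorem isVertex_of_mem_patchPts {i : ℕ} {x : Pt} (h : x ∈ patchPts i) : IsVertex x := by
  simp only [patchPts, Finset.mem_biUnion, Finset.mem_image, Finset.mem_univ, true_and] at h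
  obtain ⟨t, ht, j, hj⟩ := h
  exact ⟨t, ⟨i, ht⟩, j, hj⟩

/-- The vertex set `V_i` of the quiver `Q_i` of the patch `P_i`, inside the vertex set of `Q`. -/
def patchVertices (i : ℕ) : Finset Vertex :=
  (patchPts i).attach.map
    ⟨fun x => ⟨x.1, isVertex_of_mem_patchPts x.2⟩, fun _ _ h => Subtype.ext (Subtype.mk.inj h)⟩

/-! ## The infinite-dimensional Rauzy algebra -/

section Algebra

variable (k : Type u) [Field k]

open Classical in
/-- The path `x → y → z` of length two in `kQ`, replaced by zero if one of the edges is missing. -/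
def path2 (x y z : Pt) : PathAlgebra k Vertex :=
  if h : Adj x y ∧ Adj y z then
    let x' : Vertex := ⟨x, h.1.isVertex_left⟩
    let y' : Vertex := ⟨y, h.1.isVertex_right⟩
    let z' : Vertex := ⟨z, h.2.isVertex_right⟩
    let a : x' ⟶ y' := PLift.up h.1
    let b : y' ⟶ z' := PLift.up h.2
    PathAlgebra.ofPath k ⟨x', z', (Path.nil.cons a).cons b⟩
  else 0

/-- The difference `b b̄ - b' b̄'` of the two closed paths of length two at `z` along the
edges of direction `p(e_a)`, where `b` ends at `z + p(e_a)` and `b'` at `z - p(e_a)`. -/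
def loopDiff (a : Fin 3) (z : Pt) : PathAlgebra k Vertex :=
  path2 k z (z + dir a) z - path2 k z (z - dir a) z

/-- The signs at the vertex `z`, from a choice `ε₀` of signs at the origin. The sign with index `d`
relates the two directions other than `p(e_d)`. It is constant along edges of direction `p(e_d)`
and changes along all other edges; see `sign_zero` and `sign_add_dir`. -/
def sign (ε₀ : Fin 3 → ℤˣ) (d : Fin 3) (z : Pt) : ℤˣ :=
  ε₀ d * (-1) ^ (![z.1 + z.2, z.2, z.1] d)

theorem sign_zero (ε₀ : Fin 3 → ℤˣ) (d : Fin 3) : sign ε₀ d 0 = ε₀ d := by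
  fin_cases d <;> simp [sign]

theorem sign_add_dir (ε₀ : Fin 3 → ℤˣ) (d a : Fin 3) (z : Pt) :
    sign ε₀ d (z + dir a) = if a = d then sign ε₀ d z else -sign ε₀ d z := by
  obtain ⟨m, n⟩ := z
  fin_cases d <;> fin_cases a <;>
    simp [sign, dir, proj, zpow_add]

/-- The relations of the Rauzy algebra. -/
inductive Relation (ε₀ : Fin 3 → ℤˣ) : PathAlgebra k Vertex → Prop
  /-- A path of length two that is not contained in the boundary of a single rhombus is zero. -/
  | two_rhombus (x y z : Pt) (hxy : Adj x y) (hyz : Adj y z)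
      (h : ¬ ∃ t ∈ tiling, IsSide t x y ∧ IsSide t y z) : Relation ε₀ (path2 k x y z)
  /-- The two paths of length two between opposite corners of a rhombus are equal. -/
  | mirror (t : Tile) (ht : t ∈ tiling) (j : Fin 4) :
      Relation ε₀ (path2 k (corner t j) (corner t (j + 1)) (corner t (j + 2)) -
        path2 k (corner t j) (corner t (j + 3)) (corner t (j + 2)))
  /-- The three star relations at a vertex. -/
  | star (z : Pt) (hz : IsVertex z) (d : Fin 3) :
      Relation ε₀ (loopDiff k (d + 1) z - ((sign ε₀ d z : ℤ) : k) • loopDiff k (d + 2) z)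

/-- The two-sided ideal `I` of `kQ` generated by the relations. -/
def relIdeal (ε₀ : Fin 3 → ℤˣ) : TwoSidedIdeal (PathAlgebra k Vertex) :=
  TwoSidedIdeal.span {r | Relation k ε₀ r}

/-- The infinite-dimensional Rauzy algebra `A = kQ / I`. -/
abbrev InfAlgebra (ε₀ : Fin 3 → ℤˣ) : Type u := (relIdeal k ε₀).ringCon.Quotient

/-! ## The finite-dimensional Rauzy algebras -/

/-- The element `e_i = ∑_{v ∈ V_i} e_v` of `A`. -/
def patchIdem (ε₀ : Fin 3 → ℤˣ) (i : ℕ) : InfAlgebra k ε₀ :=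
  ((∑ x ∈ patchVertices i, PathAlgebra.vertexIdem k x : PathAlgebra k Vertex) : InfAlgebra k ε₀)

theorem isIdempotentElem_patchIdem (ε₀ : Fin 3 → ℤˣ) (i : ℕ) :
    IsIdempotentElem (patchIdem k ε₀ i) := by
  unfold IsIdempotentElem patchIdem
  rw [← RingCon.coe_mul, PathAlgebra.isIdempotentElem_sum_vertexIdem]

/-- The finite-dimensional Rauzy algebra `A_i = e_i A e_i`, a ring with unit `e_i`. -/
abbrev FinAlgebra (ε₀ : Fin 3 → ℤˣ) (i : ℕ) : Type u := (isIdempotentElem_patchIdem k ε₀ i).Corner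

end Algebra

end Rauzy

/-! ## Syzygies and periodic modules -/

section Periodic

variable {Λ : Type u} [Ring Λ]

/-- `π : P → M` is a projective cover: `P` is projective, and `π` is surjective with superfluous
kernel. -/
structure IsProjectiveCover {P M : ModuleCat.{v} Λ} (π : P →ₗ[Λ] M) : Prop where
  projective : Module.Projective Λ P
  surjective : Function.Surjective π
  superfluous : ∀ N : Submodule Λ P, N ⊔ LinearMap.ker π = ⊤ → N = ⊤

/-- `N` is isomorphic to `Ω(M)`, the kernel of a projective cover of `M`. -/
def IsOmega (M N : ModuleCat.{v} Λ) : Prop :=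
  ∃ (P : ModuleCat.{v} Λ) (π : P →ₗ[Λ] M),
    IsProjectiveCover π ∧ Nonempty (N ≃ₗ[Λ] LinearMap.ker π)

/-- `N` is isomorphic to `Ωⁿ(M)`. -/
def IsOmegaPow : ℕ → ModuleCat.{v} Λ → ModuleCat.{v} Λ → Prop
  | 0, M, N => Nonempty (M ≃ₗ[Λ] N)
  | n + 1, M, N => ∃ L : ModuleCat.{v} Λ, IsOmega M L ∧ IsOmegaPow n L N

/-- `M` is `Ω`-periodic: a nonzero finitely generated module with `Ωⁿ(M) ≅ M` for some `n ≥ 1`. -/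
def IsPeriodicModule (M : ModuleCat.{v} Λ) : Prop :=
  Module.Finite Λ M ∧ Nontrivial M ∧ ∃ n : ℕ, 1 ≤ n ∧ IsOmegaPow n M M

end Periodic

end

/-!
# Periodic modules over the finite-dimensional Rauzy algebras

The periodic module is the image of a differential in a cyclic complex of projective
`A_i`-modules. If such a complex is exact and its differentials have entries in the radical, then
each differential, as a map onto its image, is a projective cover, so each image is the syzygy of
the preceding one, and after one turn around the cycle the first one returns
(`MinimalComplex.isPeriodicModule_image`).

The complex lives on a *chord* of `P_i`, a horizontal zigzag of edges and rhombi between two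
boundary vertices (`Chord`). Its vertices fall into twelve columns, each a single vertex `y` or
a pair of opposite corners of a rhombus whose other corners are the neighbouring columns; the
projective at a column is `e_y A_i` or the sum of two such modules. The differentials are left
multiplications by the arrows between neighbouring columns, with a sign at each rhombus. The
complex runs along the chord, turns by a loop `b b̄` at the end, where the arrow `b` of
`A` leaves `P_i`, runs back along the opposite arrows and turns by another loop at the
start: the period is 24 (`chordComplex`).

Exactness is a statement about the right ideals `e_y A` near the chord, and rests on two facts.

* *Normal forms.* The vertices of the tiling lift to the points of `ℤ³` between two parallel
  planes, described by the height `ht`, a left eigenvector of `M`. At a vertex all of whose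
  rhombi are known, the existence of a rhombus is therefore a linear inequality (`Good`, `Cot`,
  `good_of_surrounds`). Three steps along different axes give the zero path, because the eight
  corners of a cube do not fit between the planes (`cube_eq_zero`). Together with the commutation
  and star relations this reduces every path to a few short ones; in particular, paths of length
  five vanish (`Deep.word_mem`, `Deep.word_five_eq_zero`).
* *Independence.* The linear form `tr` on paths of length four from a vertex is `±1` on the closed
  paths around or across a rhombus. The condition that the product of the three signs is `1`, and
  the linear relations between the numbers of rhombi on the two sides of an edge, make it vanish
  on the ideal (`trPath_eq_zero`). Continuing a word to a path with nonzero trace isolates its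
  coefficient in a linear relation (`coeff_eq_zero`).

This gives exactness at a single vertex (`exact_arrow`, `exact_arrows`), at a pair of vertices
(`exact_pair`) and at the turns (`exact_end_before`, `exact_end_after`). The patch `P_i` enters
only at the turns, where the endpoint of `b` and its neighbours are not in `V_i`.

It remains to find a chord in `P_i` for every `i ≥ 6` (`exists_chord`). Every rhombus has only one
parent under the substitution (`inflate_inj`), so a configuration of rhombi inside and outside
`P_i` is carried to such a configuration for `P_{i+1}` (`Pattern.step`). A small configuration at
the boundary reproduces itself after three substitutions (`CornerPattern₁.step`), together with a
variant that grows into a chord after nine more (`CornerPattern₂.exists_chord`); the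
patches `P_6`, …, `P_9` are treated directly.
-/

noncomputable section

namespace Rauzy

/-! ### Heights -/

theorem exists_lam : ∃ x : ℝ, 0 < x ∧ x < 1 ∧ x ^ 3 + x ^ 2 + x = 1 := by
  have h : ContinuousOn (fun x : ℝ => x ^ 3 + x ^ 2 + x) (Set.Icc 0 1) := by fun_prop
  have := intermediate_value_Ioo (zero_le_one' ℝ) h
  obtain ⟨x, hx, hx'⟩ := this (show (1 : ℝ) ∈ _ by norm_num)
  exact ⟨x, hx.1, hx.2, hx'⟩

/-- The real root `λ` of `x³ + x² + x = 1`, the inverse of the tribonacci constant. It is the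
eigenvalue of modulus less than one of the substitution matrix. -/
def lam : ℝ := exists_lam.choose

theorem lam_pos : 0 < lam := exists_lam.choose_spec.1
theorem lam_eq : lam ^ 3 + lam ^ 2 + lam = 1 := exists_lam.choose_spec.2.2

/-- The heights of the three basis vectors: a positive left eigenvector of the substitution
matrix for `λ`. -/
def hgt : Fin 3 → ℝ := ![1, lam + lam ^ 2, lam]

theorem hgt_pos (a : Fin 3) : 0 < hgt a := by
  have := lam_pos
  fin_cases a <;> simp [hgt] <;> positivity

/-- The height of a point of `ℤ³`. -/
def ht (z : Fin 3 → ℤ) : ℝ := z 0 * hgt 0 + z 1 * hgt 1 + z 2 * hgt 2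

theorem ht_add (z w : Fin 3 → ℤ) : ht (z + w) = ht z + ht w := by
  simp [ht]; ring

theorem ht_sub (z w : Fin 3 → ℤ) : ht (z - w) = ht z - ht w := by
  simp [ht]; ring

theorem ht_single (a : Fin 3) (n : ℤ) : ht (Pi.single a n) = n * hgt a := by
  fin_cases a <;> simp [ht]

theorem substMatrix_mulVec (z : Fin 3 → ℤ) :
    substMatrix.mulVec z = ![z 1, z 2, z 0 - z 1 - z 2] := by
  ext j
  fin_cases j <;> simp [substMatrix, Matrix.mulVec, dotProduct, Fin.sum_univ_three]; ring

theorem substMatrix_col_one : substMatrix.col 1 = ![1, 0, -1] := by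
  ext j; fin_cases j <;> simp [substMatrix, Matrix.col]

theorem substMatrix_col_two : substMatrix.col 2 = ![0, 1, -1] := by
  ext j; fin_cases j <;> simp [substMatrix, Matrix.col]

theorem ht_mulVec (z : Fin 3 → ℤ) : ht (substMatrix.mulVec z) = lam * ht z := by
  rw [substMatrix_mulVec]
  simp only [ht, hgt, Matrix.cons_val_zero, Matrix.cons_val_one, Matrix.cons_val, Int.cast_sub]
  have := lam_eq
  linear_combination (-(z 1 : ℝ)) * this

/-- The faces of the discrete plane: the height of the lowest corner is nonnegative and smaller
than the height of the normal vector. -/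
def InPlane (f : Face) : Prop := 0 ≤ ht f.1 ∧ ht f.1 < hgt f.2

theorem mem_inflate {f g : Face} : g ∈ inflate f ↔
    (f.2 = 0 ∧ (g = (substMatrix.mulVec f.1, 2) ∨ g = (substMatrix.mulVec f.1 + ![1, 0, -1], 0) ∨
      g = (substMatrix.mulVec f.1 + ![0, 1, -1], 1))) ∨
    (f.2 = 1 ∧ g = (substMatrix.mulVec f.1, 0)) ∨ (f.2 = 2 ∧ g = (substMatrix.mulVec f.1, 1)) := by
  obtain ⟨z, j⟩ := f
  fin_cases j <;> simp [inflate, substMatrix_col_one, substMatrix_col_two]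

theorem ht_colOne : ht ![1, 0, -1] = lam * (lam + lam ^ 2) := by
  simp only [ht, hgt, Matrix.cons_val_zero, Matrix.cons_val_one, Matrix.cons_val]
  push_cast
  linear_combination -lam_eq

theorem ht_colTwo : ht ![0, 1, -1] = lam * lam := by
  simp only [ht, hgt, Matrix.cons_val_zero, Matrix.cons_val_one, Matrix.cons_val]
  push_cast
  ring

theorem InPlane.inflate {f g : Face} (hf : InPlane f) (hg : g ∈ inflate f) : InPlane g := by
  obtain ⟨z, j⟩ := f
  obtain ⟨h0, h1⟩ := hf
  have hp := lam_pos
  have he := lam_eq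
  simp only at h0 h1
  have h2 : 0 ≤ lam * ht z := by positivity
  have h3 : lam * ht z < lam * hgt j := by gcongr
  rw [mem_inflate] at hg
  simp only at hg
  rcases hg with ⟨rfl, rfl | rfl | rfl⟩ | ⟨rfl, rfl⟩ | ⟨rfl, rfl⟩ <;>
    simp only [InPlane, ht_add, ht_mulVec, ht_colOne, ht_colTwo] <;> simp [hgt] at h3 ⊢ <;>
    constructor <;> nlinarith [mul_pos hp hp]

theorem inPlane_of_mem_patch {i : ℕ} {f : Face} (hf : f ∈ patch i) : InPlane f := by
  induction i generalizing f with
  | zero =>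
    simp only [patch, Finset.mem_insert, Finset.mem_singleton] at hf
    have h : ht 0 = 0 := by simp [ht]
    rcases hf with rfl | rfl | rfl <;> simp [InPlane, h, hgt_pos]
  | succ i ih =>
    simp only [patch, Finset.mem_biUnion] at hf
    obtain ⟨f', hf', h⟩ := hf
    exact (ih hf').inflate h

theorem mulVec_injective {z w : Fin 3 → ℤ}
    (h : substMatrix.mulVec z = substMatrix.mulVec w) : z = w := by
  simp only [substMatrix_mulVec] at h
  have h0 := congrFun h 0
  have h1 := congrFun h 1
  have h2 := congrFun h 2
  simp at h0 h1 h2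
  ext j; fin_cases j
  · simp only [h0, h1] at h2; simpa using h2
  · exact h0
  · exact h1

/-- A face of the discrete plane has at most one parent. -/
theorem inflate_inj {f f' g : Face} (hf : InPlane f) (hf' : InPlane f')
    (h : g ∈ inflate f) (h' : g ∈ inflate f') : f = f' := by
  obtain ⟨z, j⟩ := f
  obtain ⟨z', j'⟩ := f'
  obtain ⟨h0, h1⟩ := hf
  obtain ⟨h0', h1'⟩ := hf'
  have hp := lam_pos
  simp only at h0 h1 h0' h1'
  have h2 : 0 ≤ lam * ht z := by positivity
  have h3 : lam * ht z < lam * hgt j := by gcongr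
  have h2' : 0 ≤ lam * ht z' := by positivity
  have h3' : lam * ht z' < lam * hgt j' := by gcongr
  rw [mem_inflate] at h h'
  simp only at h h'
  -- two parents of different types would have images in disjoint height intervals
  rcases h with ⟨rfl, rfl | rfl | rfl⟩ | ⟨rfl, rfl⟩ | ⟨rfl, rfl⟩ <;>
    rcases h' with ⟨rfl, h | h | h⟩ | ⟨rfl, h⟩ | ⟨rfl, h⟩ <;>
    simp only [Prod.mk.injEq] at h <;> obtain ⟨h, hj⟩ := h <;>
    first
    | exact absurd hj (by decide)
    | (have e := mulVec_injective h; rw [e])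
    | (have e := mulVec_injective (add_right_cancel h); rw [e])
    | (have e := congrArg ht h
       simp only [ht_add, ht_mulVec, ht_colOne, ht_colTwo] at e
       simp [hgt] at h3 h3'
       nlinarith)

/-! ### Lifts of the vertices -/

/-- The points of `ℤ³` between the two planes that bound the stepped surface; every vertex of the
tiling is the projection of exactly one of them. -/
def InX (z : Fin 3 → ℤ) : Prop := 0 ≤ ht z ∧ ht z < hgt 0 + hgt 1 + hgt 2

theorem proj_add (z w : Fin 3 → ℤ) : proj (z + w) = proj z + proj w := by
  ext <;> simp [proj] <;> ring

theorem proj_sub (z w : Fin 3 → ℤ) : proj (z - w) = proj z - proj w := by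
  ext <;> simp [proj] <;> ring

/-- The kernel of the projection is spanned by `(1, 1, 1)`, whose height is the distance of the two
planes, so the lift of a vertex is unique. -/
theorem InX.eq_of_proj {z w : Fin 3 → ℤ} (hz : InX z) (hw : InX w) (h : proj z = proj w) :
    z = w := by
  simp only [proj, Prod.mk.injEq] at h
  obtain ⟨h1, h2⟩ := h
  have e1 : (w 1 : ℝ) = z 1 + (w 0 - z 0) := by
    have : w 1 = z 1 + (w 0 - z 0) := by omega
    exact_mod_cast this
  have e2 : (w 2 : ℝ) = z 2 + (w 0 - z 0) := by
    have : w 2 = z 2 + (w 0 - z 0) := by omega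
    exact_mod_cast this
  have e : ht w = ht z + ((w 0 - z 0 : ℤ) : ℝ) * (hgt 0 + hgt 1 + hgt 2) := by
    simp only [ht, e1, e2]; push_cast; ring
  have hp : 0 < hgt 0 + hgt 1 + hgt 2 := by
    have := hgt_pos 0; have := hgt_pos 1; have := hgt_pos 2; positivity
  have hn : w 0 - z 0 = 0 := by
    by_contra hne
    rcases lt_or_gt_of_ne hne with hlt | hgt'
    · have : ((w 0 - z 0 : ℤ) : ℝ) ≤ -1 := by exact_mod_cast (by omega : w 0 - z 0 ≤ -1)
      nlinarith [hz.1, hz.2, hw.1, hw.2]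
    · have : (1 : ℝ) ≤ ((w 0 - z 0 : ℤ) : ℝ) := by exact_mod_cast (by omega : 1 ≤ w 0 - z 0)
      nlinarith [hz.1, hz.2, hw.1, hw.2]
  ext j; fin_cases j <;> simp <;> omega

/-- The six unit steps in `ℤ³`: an axis and a sign. -/
abbrev Step : Type := Fin 3 × ℤˣ

/-- The opposite step. -/
def Step.bar (s : Step) : Step := (s.1, -s.2)

/-- The step as a vector of `ℤ³`. -/
def vec (s : Step) : Fin 3 → ℤ := Pi.single s.1 (s.2 : ℤ)

/-- The step as a vector of the planar lattice. -/
def pv (s : Step) : Pt := proj (vec s)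

@[simp] theorem Step.bar_bar (s : Step) : s.bar.bar = s := by simp [Step.bar]

@[simp] theorem Step.bar_fst (s : Step) : s.bar.1 = s.1 := rfl

theorem vec_bar (s : Step) : vec s.bar = -vec s := by
  simp [vec, Step.bar, Pi.single_neg]

theorem pv_bar (s : Step) : pv s.bar = -pv s := by
  rw [pv, vec_bar, pv]; ext <;> simp [proj] <;> ring

theorem pv_injective : Function.Injective pv := by
  have : ∀ s t : Step, pv s = pv t → s = t := by
    decide
  exact fun s t => this s t

theorem bar_ne (s : Step) : s.bar ≠ s := by
  revert s; decide

theorem ht_vec (s : Step) : ht (vec s) = (s.2 : ℤ) * hgt s.1 := by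
  rw [vec, ht_single]

theorem proj_add_vec (z : Fin 3 → ℤ) (s : Step) : proj (z + vec s) = proj z + pv s := proj_add _ _

theorem add_vec_bar (z : Fin 3 → ℤ) (s : Step) : z + vec s + vec s.bar = z := by
  rw [vec_bar]; simp

theorem pv_pos (a : Fin 3) : pv (a, 1) = dir a := rfl

theorem pv_neg (a : Fin 3) : pv (a, -1) = -dir a := pv_bar (a, 1)

/-- The four lifted corners of a face. -/
theorem InPlane.inX {z : Fin 3 → ℤ} {k a b : Fin 3} (h : InPlane (z, k)) (ha : a ≠ k) (hb : b ≠ k)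
    (hab : a ≠ b) : InX z ∧ InX (z + vec (a, 1)) ∧ InX (z + vec (a, 1) + vec (b, 1)) := by
  obtain ⟨h0, h1⟩ := h
  have p0 := hgt_pos 0
  have p1 := hgt_pos 1
  have p2 := hgt_pos 2
  simp only at h0 h1
  simp only [InX, ht_add, ht_vec]
  fin_cases k <;> fin_cases a <;> fin_cases b <;> simp at ha hb hab h0 h1 ⊢ <;>
    refine ⟨⟨?_, ?_⟩, ⟨?_, ?_⟩, ?_, ?_⟩ <;> linarith

theorem exists_lift {t : Tile} (ht : t ∈ tiling) :
    ∃ z, proj z = t.1 ∧ InPlane (z, t.2) ∧ ∃ i, (z, t.2) ∈ patch i := by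
  obtain ⟨i, hi⟩ := ht
  simp only [patchTiles, Finset.mem_image] at hi
  obtain ⟨f, hf, rfl⟩ := hi
  exact ⟨f.1, rfl, inPlane_of_mem_patch hf, i, hf⟩

theorem mem_tiling_of_mem_patch {i : ℕ} {z : Fin 3 → ℤ} {k : Fin 3} (h : (z, k) ∈ patch i) :
    (proj z, k) ∈ tiling :=
  ⟨i, Finset.mem_image.2 ⟨(z, k), h, rfl⟩⟩

theorem isSide_symm {t : Tile} {x y : Pt} (h : IsSide t x y) : IsSide t y x := by
  obtain ⟨j, h | h⟩ := h
  exacts [⟨j, Or.inr h⟩, ⟨j, Or.inl h⟩]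

theorem Adj.symm {x y : Pt} (h : Adj x y) : Adj y x := by
  obtain ⟨t, ht, h⟩ := h
  exact ⟨t, ht, isSide_symm h⟩

/-- The sides of a rhombus: the axis `a` of the side, the other axis `b`, and the end `x` of the
side from which the side points in the positive direction. -/
theorem isSide_iff {q : Pt} {k : Fin 3} {x y : Pt} : IsSide (q, k) x y ↔
    ∃ a b, a ≠ k ∧ b ≠ k ∧ a ≠ b ∧ ∃ x', (x' = q ∨ x' = q + dir b) ∧
      (x = x' ∧ y = x' + dir a ∨ y = x' ∧ x = x' + dir a) := by
  have key : ∀ k : Fin 3, k + 1 ≠ k ∧ k + 2 ≠ k ∧ k + 1 ≠ k + 2 ∧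
      ∀ a b, a ≠ k → b ≠ k → a ≠ b → (a = k + 1 ∧ b = k + 2) ∨ (a = k + 2 ∧ b = k + 1) := by
    decide
  obtain ⟨k1, k2, k12, kk⟩ := key k
  constructor
  · rintro ⟨j, h⟩
    fin_cases j
    · exact ⟨k + 1, k + 2, k1, k2, k12, q, Or.inl rfl, h⟩
    · refine ⟨k + 2, k + 1, k2, k1, k12.symm, q + dir (k + 1), Or.inr rfl, h⟩
    · refine ⟨k + 1, k + 2, k1, k2, k12, q + dir (k + 2), Or.inr rfl, ?_⟩
      rw [add_right_comm]
      exact h.elim (fun h => Or.inr h.symm) (fun h => Or.inl h.symm)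
    · exact ⟨k + 2, k + 1, k2, k1, k12.symm, q, Or.inl rfl,
        h.elim (fun h => Or.inr h.symm) (fun h => Or.inl h.symm)⟩
  · rintro ⟨a, b, ha, hb, hab, x', hx, h⟩
    obtain ⟨rfl, rfl⟩ | ⟨rfl, rfl⟩ := kk a b ha hb hab <;> obtain rfl | rfl := hx
    · exact ⟨0, h⟩
    · refine ⟨2, ?_⟩
      rw [add_right_comm] at h
      exact h.elim (fun h => Or.inr h.symm) (fun h => Or.inl h.symm)
    · exact ⟨3, h.elim (fun h => Or.inr h.symm) (fun h => Or.inl h.symm)⟩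
    · exact ⟨1, h⟩

theorem Adj.exists_step {x y : Pt} (h : Adj x y) : ∃ s, y = x + pv s := by
  obtain ⟨⟨q, k⟩, -, h⟩ := h
  obtain ⟨a, b, -, -, -, x', -, ⟨rfl, rfl⟩ | ⟨rfl, rfl⟩⟩ := isSide_iff.1 h
  · exact ⟨(a, 1), rfl⟩
  · exact ⟨(a, -1), by rw [pv_neg]; abel⟩

end Rauzy

namespace Rauzy

/-! ### The tiling around a vertex -/

/-- The points `z`, `z + s`, `z + t`, `z + s + t` are the lifted corners of a rhombus. -/
def Cot (z : Fin 3 → ℤ) (s t : Step) : Prop :=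
  s.1 ≠ t.1 ∧ InX (z + vec s) ∧ InX (z + vec t) ∧ InX (z + vec s + vec t)

theorem Cot.symm {z : Fin 3 → ℤ} {s t : Step} (h : Cot z s t) : Cot z t s :=
  ⟨h.1.symm, h.2.2.1, h.2.1, by rw [add_right_comm]; exact h.2.2.2⟩

theorem cot_comm {z : Fin 3 → ℤ} {s t : Step} : Cot z s t ↔ Cot z t s := ⟨Cot.symm, Cot.symm⟩

theorem Cot.shift {z : Fin 3 → ℤ} {s t : Step} (hz : InX z) (h : Cot z s t) :
    Cot (z + vec s) s.bar t :=
  ⟨h.1, by rwa [add_vec_bar], h.2.2.2, by rw [add_vec_bar]; exact h.2.2.1⟩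

/-- A lifted vertex around which the tiling covers a full angle: every rhombus at this vertex which
the heights allow belongs to the tiling. -/
structure Good (z : Fin 3 → ℤ) : Prop where
  inX : InX z
  tile : ∀ s t, Cot z s t → ∃ T ∈ tiling, ∃ j, corner T j = proj z ∧
    corner T (j + 2) = proj z + pv s + pv t ∧
    (corner T (j + 1) = proj z + pv s ∧ corner T (j + 3) = proj z + pv t ∨
      corner T (j + 1) = proj z + pv t ∧ corner T (j + 3) = proj z + pv s)

theorem isSide_corner (T : Tile) (j : Fin 4) : IsSide T (corner T j) (corner T (j + 1)) :=
  ⟨j, Or.inl ⟨rfl, rfl⟩⟩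

theorem Good.sides {z : Fin 3 → ℤ} (hz : Good z) {s t : Step} (h : Cot z s t) :
    ∃ T ∈ tiling, IsSide T (proj z) (proj z + pv s) ∧
      IsSide T (proj z + pv s) (proj z + pv s + pv t) ∧ IsSide T (proj z) (proj z + pv t) ∧
      IsSide T (proj z + pv t) (proj z + pv s + pv t) := by
  obtain ⟨T, hT, j, h0, h2, h⟩ := hz.tile s t h
  have e3 : IsSide T (corner T (j + 3)) (corner T j) := by
    simpa [add_assoc] using isSide_corner T (j + 3)
  have e1 : IsSide T (corner T (j + 1)) (corner T (j + 2)) := by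
    simpa [add_assoc] using isSide_corner T (j + 1)
  have e2 : IsSide T (corner T (j + 2)) (corner T (j + 3)) := by
    simpa [add_assoc] using isSide_corner T (j + 2)
  have e0 := isSide_corner T j
  rw [h0] at e0 e3
  rw [h2] at e1 e2
  refine ⟨T, hT, ?_⟩
  obtain ⟨h, h'⟩ | ⟨h, h'⟩ := h <;> rw [h] at e0 e1 <;> rw [h'] at e2 e3
  · exact ⟨e0, e1, isSide_symm e3, isSide_symm e2⟩
  · exact ⟨isSide_symm e3, isSide_symm e2, e0, e1⟩

theorem eq_of_ne_of_ne {k a b c : Fin 3} (ha : a ≠ k) (hb : b ≠ k) (hab : a ≠ b) (hc : c ≠ k)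
    (hca : c ≠ a) : c = b := by
  revert k a b c; decide

theorem exists_third (a b : Fin 3) (h : a ≠ b) : ∃ c, c ≠ a ∧ c ≠ b := by
  revert a b; decide

theorem sum_hgt {a b c : Fin 3} (hab : a ≠ b) (hca : c ≠ a) (hcb : c ≠ b) :
    hgt 0 + hgt 1 + hgt 2 = hgt a + hgt b + hgt c := by
  fin_cases a <;> fin_cases b <;> fin_cases c <;> simp at hab hca hcb ⊢ <;> ring

theorem step_cases (s : Step) : s = (s.1, 1) ∨ s = (s.1, -1) := by
  obtain ⟨a, e⟩ := s
  rcases Int.units_eq_one_or e with rfl | rfl <;> simp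

/-- Every edge of the stepped surface at `z` lies in a rhombus. -/
theorem exists_cot {z : Fin 3 → ℤ} (hz : InX z) {s : Step} (h : InX (z + vec s)) (b : Fin 3)
    (hb : b ≠ s.1) : ∃ t, Cot z s t := by
  obtain ⟨a, e⟩ := s
  simp only at hb
  obtain ⟨c, hca, hcb⟩ := exists_third a b hb.symm
  have hs := sum_hgt hb.symm hca hcb
  have p := hgt_pos a
  have p' := hgt_pos b
  have p'' := hgt_pos c
  simp only [InX, ht_add, ht_vec, hs] at h hz
  obtain ⟨h1, h2⟩ := h
  obtain ⟨h3, h4⟩ := hz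
  rcases Int.units_eq_one_or e with rfl | rfl <;> simp at h1 h2
  · by_cases hc : ht z < hgt c
    · refine ⟨(b, 1), hb.symm, ?_⟩
      simp only [InX, ht_add, ht_vec, hs]; simp
      refine ⟨⟨?_, ?_⟩, ⟨?_, ?_⟩, ?_, ?_⟩ <;> linarith
    · refine ⟨(c, -1), hca.symm, ?_⟩
      simp only [InX, ht_add, ht_vec, hs]; simp
      refine ⟨⟨?_, ?_⟩, ⟨?_, ?_⟩, ?_, ?_⟩ <;> linarith
  · by_cases hc : ht z < hgt a + hgt c
    · refine ⟨(b, 1), hb.symm, ?_⟩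
      simp only [InX, ht_add, ht_vec, hs]; simp
      refine ⟨⟨?_, ?_⟩, ⟨?_, ?_⟩, ?_, ?_⟩ <;> linarith
    · refine ⟨(c, -1), hca.symm, ?_⟩
      simp only [InX, ht_add, ht_vec, hs]; simp
      refine ⟨⟨?_, ?_⟩, ⟨?_, ?_⟩, ?_, ?_⟩ <;> linarith

/-- A side of a rhombus of the tiling, seen from a lift of one of its ends. -/
theorem lift_side {z : Fin 3 → ℤ} (hz : InX z) {z₀ : Fin 3 → ℤ} {k : Fin 3}
    (h₀ : InPlane (z₀, k)) {s : Step} (h : IsSide (proj z₀, k) (proj z) (proj z + pv s)) :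
    s.1 ≠ k ∧ ∃ b, b ≠ k ∧ s.1 ≠ b ∧ ∃ w, (w = z₀ ∨ w = z₀ + vec (b, 1)) ∧
      (s.2 = 1 ∧ z = w ∨ s.2 = -1 ∧ z = w + vec (s.1, 1)) := by
  obtain ⟨a, b, ha, hb, hab, x', hx', h⟩ := isSide_iff.1 h
  obtain ⟨w, hw, rfl⟩ : ∃ w, (w = z₀ ∨ w = z₀ + vec (b, 1)) ∧ x' = proj w := by
    obtain rfl | rfl := hx'
    · exact ⟨z₀, Or.inl rfl, rfl⟩
    · exact ⟨z₀ + vec (b, 1), Or.inr rfl, by rw [proj_add_vec, pv_pos]⟩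
  have hwX : InX w ∧ InX (w + vec (a, 1)) := by
    obtain rfl | rfl := hw
    · exact ⟨(h₀.inX ha hb hab).1, (h₀.inX ha hb hab).2.1⟩
    · exact (h₀.inX hb ha hab.symm).2
  obtain ⟨h1, h2⟩ | ⟨h1, h2⟩ := h
  · obtain rfl := hz.eq_of_proj hwX.1 h1
    rw [← pv_pos] at h2
    obtain rfl := pv_injective (add_left_cancel h2)
    exact ⟨ha, b, hb, hab, z, hw, Or.inl ⟨rfl, rfl⟩⟩
  · rw [← pv_pos, ← proj_add_vec] at h2
    obtain rfl := hz.eq_of_proj hwX.2 h2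
    rw [proj_add_vec, pv_pos, add_assoc] at h1
    have h3 : pv s = pv (a, -1) := by
      rw [pv_neg]
      exact (eq_neg_of_add_eq_zero_right (by simpa using h1))
    obtain rfl := pv_injective h3
    exact ⟨ha, b, hb, hab, w, hw, Or.inr ⟨rfl, rfl⟩⟩

theorem InX.of_adj {z : Fin 3 → ℤ} (hz : InX z) {s : Step} (h : Adj (proj z) (proj z + pv s)) :
    InX (z + vec s) := by
  obtain ⟨⟨q, k⟩, hT, h⟩ := h
  obtain ⟨z₀, rfl, h₀, -⟩ := exists_lift hT
  obtain ⟨ha, b, hb, hab, w, hw, h⟩ := lift_side hz h₀ h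
  obtain ⟨a, e⟩ := s
  simp only at ha hab h
  have hwX : InX w ∧ InX (w + vec (a, 1)) := by
    obtain rfl | rfl := hw
    · exact ⟨(h₀.inX ha hb hab).1, (h₀.inX ha hb hab).2.1⟩
    · exact (h₀.inX hb ha hab.symm).2
  obtain ⟨rfl, rfl⟩ | ⟨rfl, rfl⟩ := h
  · exact hwX.2
  · exact (add_vec_bar w (a, 1)).symm ▸ hwX.1

/-- A path of length two along the boundary of a rhombus of the tiling which does not turn back
joins two opposite corners, and the lifts are the corners of a lifted rhombus. -/
theorem cot_of_sides {z : Fin 3 → ℤ} (hz : InX z) {T : Tile} (hT : T ∈ tiling) {s t : Step}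
    (h : IsSide T (proj z) (proj z + pv s))
    (h' : IsSide T (proj z + pv s) (proj z + pv s + pv t)) (hst : t ≠ s.bar) : Cot z s t := by
  have hzs : InX (z + vec s) := hz.of_adj ⟨T, hT, h⟩
  obtain ⟨q, k⟩ := T
  obtain ⟨z₀, rfl, h₀, -⟩ := exists_lift hT
  obtain ⟨ha, b, hb, hab, w, hw, h1⟩ := lift_side hz h₀ h
  rw [← proj_add_vec] at h'
  obtain ⟨ha', b', hb', hab', w', hw', h1'⟩ := lift_side hzs h₀ h'
  obtain ⟨a, e⟩ := s
  obtain ⟨a', e'⟩ := t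
  simp only at *
  have X := h₀.inX ha hb hab
  have X' := (h₀.inX hb ha hab.symm).2
  have ev : ∀ c d, c ≠ d → vec (c, 1) c = 1 ∧ vec (c, 1) d = 0 := by
    intro c d h
    simp [vec, h.symm]
  have third : ∀ c, c ≠ k → c ≠ a → c = b := fun c => eq_of_ne_of_ne ha hb hab
  by_cases haa : a' = a
  · -- the second step runs along the same axis, which forces it to turn back
    exfalso
    subst haa
    obtain rfl := third b' hb' hab'.symm
    have c1 := (ev a' b' hab).1
    have c2 := (ev b' a' hab.symm).2
    have hw1 : w a' = z₀ a' := by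
      obtain rfl | rfl := hw <;> simp [c2]
    have hw1' : w' a' = z₀ a' := by
      obtain rfl | rfl := hw' <;> simp [c2]
    obtain ⟨rfl, rfl⟩ | ⟨rfl, rfl⟩ := h1 <;> obtain ⟨rfl, h2⟩ | ⟨rfl, h2⟩ := h1'
    · have := congrFun h2 a'
      simp [c1, hw1, hw1'] at this
    · exact hst rfl
    · exact hst (by simp [Step.bar])
    · have := congrFun h2 a'
      have hm : vec (a', -1) a' = -1 := by simp [vec]
      simp [c1, hw1, hw1', hm] at this
  · obtain rfl := third a' ha' haa
    refine ⟨hab, hzs, ?_⟩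
    have c1 := (ev a' a hab.symm).1
    have c2 := (ev a a' hab).2
    have m1 : vec (a, -1) a' = 0 := by simp [vec, hab.symm]
    have hb'' : b' = a := eq_of_ne_of_ne hb ha hab.symm hb' hab'.symm
    subst hb''
    have hw1' : w' a' = z₀ a' := by
      obtain rfl | rfl := hw' <;> simp [c2]
    have n1 : ∀ x : Fin 3 → ℤ, x + vec (b', 1) + vec (b', -1) = x := fun x => add_vec_bar x (b', 1)
    have n2 : ∀ x : Fin 3 → ℤ, x + vec (a', 1) + vec (a', -1) = x := fun x => add_vec_bar x (a', 1)
    have n3 := add_right_comm z₀ (vec (b', 1)) (vec (a', 1))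
    obtain ⟨rfl, rfl⟩ | ⟨rfl, rfl⟩ := h1 <;> obtain ⟨rfl, h2⟩ | ⟨rfl, h2⟩ := h1' <;>
      obtain rfl | rfl := hw
    all_goals
      have h3 := congrFun h2 a'
      simp [c1, c2, hw1', m1] at h3
    · exact ⟨X'.1, X.2.2⟩
    · rw [n2, add_right_comm, n2]
      exact ⟨X.1, X.2.1⟩
    · rw [n1, n3]
      exact ⟨n3 ▸ X.2.2, X'.1⟩
    · rw [n1, n2, add_right_comm, n2]
      exact ⟨X.2.1, X.1⟩

theorem Good.adj {z : Fin 3 → ℤ} (hz : Good z) {s : Step} (h : InX (z + vec s)) :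
    Adj (proj z) (proj z + pv s) := by
  obtain ⟨b, hb, -⟩ := exists_third s.1 (s.1 + 1) (by simp)
  obtain ⟨t, ht⟩ := exists_cot hz.inX h b hb
  obtain ⟨T, hT, h1, -⟩ := hz.sides ht
  exact ⟨T, hT, h1⟩

theorem Good.isVertex {z : Fin 3 → ℤ} (hz : Good z) : IsVertex (proj z) := by
  have hp0 := hgt_pos 0
  have hp1 := hgt_pos 1
  have hp2 := hgt_pos 2
  -- at least one of the two steps along the first axis stays inside
  have : ∃ s, InX (z + vec s) := by
    have h := hz.inX
    simp only [InX] at h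
    by_cases h0 : ht z < hgt 1 + hgt 2
    · refine ⟨(0, 1), ?_⟩
      simp only [InX, ht_add, ht_vec]; simp
      constructor <;> linarith
    · by_cases h1 : hgt 0 ≤ ht z
      · refine ⟨(0, -1), ?_⟩
        simp only [InX, ht_add, ht_vec]; simp
        constructor <;> linarith
      · refine ⟨(1, -1), ?_⟩
        simp only [InX, ht_add, ht_vec]; simp
        constructor <;> linarith
  obtain ⟨s, hs⟩ := this
  exact (hz.adj hs).isVertex_left

/-- A family of faces that contains, for each of the six sectors at `z`, one of the three faces that
may cover this sector. The sector lies between the directions `e_a` and `-e_b`. -/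
def Surrounds (S : Face → Prop) (z : Fin 3 → ℤ) : Prop :=
  ∀ a b c : Fin 3, a ≠ b → c ≠ a → c ≠ b →
    S (z - Pi.single b 1, c) ∨ S (z, b) ∨ S (z - Pi.single b 1 - Pi.single c 1, a)

theorem exists_corner {a b k : Fin 3} (ha : a ≠ k) (hb : b ≠ k) (hab : a ≠ b) (q : Pt) :
    (∃ j, corner (q, k) j = q ∧ corner (q, k) (j + 2) = q + dir a + dir b ∧
      (corner (q, k) (j + 1) = q + dir a ∧ corner (q, k) (j + 3) = q + dir b ∨
        corner (q, k) (j + 1) = q + dir b ∧ corner (q, k) (j + 3) = q + dir a)) ∧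
    (∃ j, corner (q, k) j = q + dir b ∧ corner (q, k) (j + 2) = q + dir a ∧
      (corner (q, k) (j + 1) = q + dir a + dir b ∧ corner (q, k) (j + 3) = q ∨
        corner (q, k) (j + 1) = q ∧ corner (q, k) (j + 3) = q + dir a + dir b)) ∧
    (∃ j, corner (q, k) j = q + dir a + dir b ∧ corner (q, k) (j + 2) = q ∧
      (corner (q, k) (j + 1) = q + dir a ∧ corner (q, k) (j + 3) = q + dir b ∨
        corner (q, k) (j + 1) = q + dir b ∧ corner (q, k) (j + 3) = q + dir a)) := by
  have key : ∀ k : Fin 3, ∀ a b, a ≠ k → b ≠ k → a ≠ b →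
      (a = k + 1 ∧ b = k + 2) ∨ (a = k + 2 ∧ b = k + 1) := by decide
  obtain ⟨rfl, rfl⟩ | ⟨rfl, rfl⟩ := key k a b ha hb hab
  · refine ⟨⟨0, rfl, rfl, Or.inl ⟨rfl, rfl⟩⟩, ⟨3, rfl, rfl, Or.inr ⟨rfl, rfl⟩⟩,
      ⟨2, rfl, rfl, Or.inr ⟨rfl, rfl⟩⟩⟩
  · rw [add_right_comm]
    refine ⟨⟨0, rfl, rfl, Or.inr ⟨rfl, rfl⟩⟩, ⟨1, rfl, rfl, Or.inl ⟨rfl, rfl⟩⟩,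
      ⟨2, rfl, rfl, Or.inl ⟨rfl, rfl⟩⟩⟩

theorem Surrounds.inX {S : Face → Prop} {z : Fin 3 → ℤ} (hS : ∀ f, S f → InPlane f)
    (h : Surrounds S z) : InX z := by
  have hv : ∀ a : Fin 3, Pi.single a (1 : ℤ) = vec (a, 1) := fun a => rfl
  rcases h 0 1 2 (by decide) (by decide) (by decide) with h | h | h
  · have := ((hS _ h).inX (k := 2) (a := 1) (b := 0) (by decide) (by decide) (by decide)).2.1
    simpa [hv] using this
  · exact ((hS _ h).inX (k := 1) (a := 0) (b := 2) (by decide) (by decide) (by decide)).1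
  · have := ((hS _ h).inX (k := 0) (a := 1) (b := 2) (by decide) (by decide) (by decide)).2.2
    rwa [hv, hv, sub_sub, sub_add_eq_add_sub, sub_add_eq_add_sub, add_assoc,
      add_sub_cancel_right] at this

/-- If the faces around `z` are known, then each face at `z` that the heights allow is one of them,
since the three faces for a sector have disjoint height intervals. -/
theorem Surrounds.of_cot {S : Face → Prop} {z : Fin 3 → ℤ} (hS : ∀ f, S f → InPlane f)
    (h : Surrounds S z) {a b c : Fin 3} (hab : a ≠ b) (hca : c ≠ a) (hcb : c ≠ b) :
    (Cot z (a, 1) (b, -1) → S (z - Pi.single b 1, c)) ∧ (Cot z (a, 1) (c, 1) → S (z, b)) ∧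
      (Cot z (b, -1) (c, -1) → S (z - Pi.single b 1 - Pi.single c 1, a)) := by
  have hs := sum_hgt hab hca hcb
  have hsec := (h a b c hab hca hcb).imp (fun h => And.intro h (hS _ h))
    (Or.imp (fun h => And.intro h (hS _ h)) (fun h => And.intro h (hS _ h)))
  simp only [InPlane, ht_sub, ht_single] at hsec
  simp only [Cot, InX, ht_add, ht_vec, hs]
  simp at hsec ⊢
  refine ⟨fun _ => ?_, fun _ => ?_, fun _ => ?_⟩ <;> intros <;>
    rcases hsec with ⟨h, h1, h2⟩ | ⟨h, h1, h2⟩ | ⟨h, h1, h2⟩ <;>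
    first
    | exact h
    | (exfalso; linarith)

/-- A point is good if the rhombi that cover the six sectors around it are known. -/
theorem good_of_surrounds {z : Fin 3 → ℤ} (h : Surrounds (fun f => ∃ i, f ∈ patch i) z) :
    Good z := by
  have hS : ∀ f : Face, (∃ i, f ∈ patch i) → InPlane f := fun f ⟨i, hi⟩ => inPlane_of_mem_patch hi
  refine ⟨h.inX hS, ?_⟩
  have hv : ∀ a : Fin 3, proj (Pi.single a 1) = dir a := fun a => rfl
  have main : ∀ (a b c : Fin 3), a ≠ b → c ≠ a → c ≠ b → ∀ e e', Cot z (a, e) (b, e') →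
      ∃ T ∈ tiling, ∃ j, corner T j = proj z ∧
    corner T (j + 2) = proj z + pv (a, e) + pv (b, e') ∧
    (corner T (j + 1) = proj z + pv (a, e) ∧ corner T (j + 3) = proj z + pv (b, e') ∨
      corner T (j + 1) = proj z + pv (b, e') ∧ corner T (j + 3) = proj z + pv (a, e)) := by
    intro a b c hab hca hcb e e' hc
    rcases Int.units_eq_one_or e with rfl | rfl <;> rcases Int.units_eq_one_or e' with rfl | rfl
    · obtain ⟨i, hi⟩ := (h.of_cot hS hca.symm hab.symm hcb.symm).2.1 hc
      refine ⟨_, mem_tiling_of_mem_patch hi, ?_⟩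
      simpa only [pv_pos] using (exists_corner hca.symm hcb.symm hab (proj z)).1
    · obtain ⟨i, hi⟩ := (h.of_cot hS hab hca hcb).1 hc
      refine ⟨_, mem_tiling_of_mem_patch hi, ?_⟩
      obtain ⟨j, h1, h2, h3⟩ :=
        (exists_corner hca.symm hcb.symm hab (proj (z - Pi.single b 1))).2.1
      refine ⟨j, ?_⟩
      rw [h1, h2, pv_pos, pv_neg]
      simp only [proj_sub, hv] at h3 ⊢
      simp only [sub_add_cancel, true_and]
      refine ⟨by abel, ?_⟩
      rcases h3 with ⟨h3, h4⟩ | ⟨h3, h4⟩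
      · exact Or.inl ⟨h3.trans (by abel), h4.trans (by abel)⟩
      · exact Or.inr ⟨h3.trans (by abel), h4.trans (by abel)⟩
    · obtain ⟨i, hi⟩ := (h.of_cot hS hab.symm hcb hca).1 hc.symm
      refine ⟨_, mem_tiling_of_mem_patch hi, ?_⟩
      obtain ⟨j, h1, h2, h3⟩ :=
        (exists_corner hcb.symm hca.symm hab.symm (proj (z - Pi.single a 1))).2.1
      refine ⟨j, ?_⟩
      rw [h1, h2, pv_pos, pv_neg]
      simp only [proj_sub, hv] at h3 ⊢
      simp only [sub_add_cancel, true_and]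
      refine ⟨by abel, ?_⟩
      rcases h3 with ⟨h3, h4⟩ | ⟨h3, h4⟩
      · exact Or.inr ⟨h3.trans (by abel), h4.trans (by abel)⟩
      · exact Or.inl ⟨h3.trans (by abel), h4.trans (by abel)⟩
    · obtain ⟨i, hi⟩ := (h.of_cot hS hca hcb.symm hab.symm).2.2 hc
      refine ⟨_, mem_tiling_of_mem_patch hi, ?_⟩
      obtain ⟨j, h1, h2, h3⟩ := (exists_corner hca.symm hcb.symm hab
        (proj (z - Pi.single a 1 - Pi.single b 1))).2.2
      refine ⟨j, ?_⟩
      rw [h1, h2, pv_neg, pv_neg]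
      simp only [proj_sub, hv] at h3 ⊢
      refine ⟨by abel, by abel, ?_⟩
      rcases h3 with ⟨h3, h4⟩ | ⟨h3, h4⟩
      · exact Or.inr ⟨h3.trans (by abel), h4.trans (by abel)⟩
      · exact Or.inl ⟨h3.trans (by abel), h4.trans (by abel)⟩
  rintro ⟨a, e⟩ ⟨b, e'⟩ hc
  obtain ⟨c, hca, hcb⟩ := exists_third a b hc.1
  exact main a b c hc.1 hca hcb e e' hc

/-- If all the rhombi around a vertex are outside `P_i`, then so is the vertex. -/
theorem proj_not_mem_patchPts {i : ℕ} {z : Fin 3 → ℤ}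
    (h : Surrounds (fun f => (∃ j, f ∈ patch j) ∧ f ∉ patch i) z) : proj z ∉ patchPts i := by
  have hS : ∀ f : Face, ((∃ i, f ∈ patch i) ∧ f ∉ patch i) → InPlane f :=
    fun f ⟨⟨i, hi⟩, _⟩ => inPlane_of_mem_patch hi
  have hzX := h.inX hS
  intro hm
  simp only [patchPts, patchTiles, Finset.mem_biUnion, Finset.mem_image, Finset.mem_univ,
    true_and] at hm
  obtain ⟨_, ⟨⟨z₀, k⟩, hf, rfl⟩, j, hj⟩ := hm
  have h₀ := inPlane_of_mem_patch hf
  simp only at hj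
  obtain ⟨a, b, ha, hb, hab, e1, e2⟩ : ∃ a b : Fin 3, a ≠ k ∧ b ≠ k ∧ a ≠ b ∧
      a = k + 1 ∧ b = k + 2 := by
    have key : ∀ k : Fin 3, k + 1 ≠ k ∧ k + 2 ≠ k ∧ k + 1 ≠ k + 2 := by decide
    exact ⟨_, _, (key k).1, (key k).2.1, (key k).2.2, rfl, rfl⟩
  have X := h₀.inX ha hb hab
  have X' := (h₀.inX hb ha hab.symm).2
  have hc : proj z = proj z₀ ∨ proj z = proj (z₀ + vec (a, 1)) ∨
      proj z = proj (z₀ + vec (a, 1) + vec (b, 1)) ∨ proj z = proj (z₀ + vec (b, 1)) := by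
    simp only [proj_add_vec, pv_pos, e1, e2]
    fin_cases j
    exacts [Or.inl hj.symm, Or.inr (Or.inl hj.symm), Or.inr (Or.inr (Or.inl hj.symm)),
      Or.inr (Or.inr (Or.inr hj.symm))]
  have n1 : ∀ x a, x + vec (a, 1) + vec (a, -1) = x := fun x a => add_vec_bar x (a, 1)
  have n3 := add_right_comm z₀ (vec (a, 1)) (vec (b, 1))
  have n4 : ∀ x a, x + vec (a, 1) - Pi.single a 1 = x := fun x a => by simp [vec]
  rcases hc with e | e | e | e
  · obtain rfl := hzX.eq_of_proj X.1 e
    exact ((h.of_cot hS ha hab.symm hb).2.1 ⟨hab, X.2.1, X'.1, X.2.2⟩).2 hf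
  · obtain rfl := hzX.eq_of_proj X.2.1 e
    refine ((h.of_cot hS hab.symm hb.symm ha.symm).1 ⟨hab.symm, X.2.2, ?_, ?_⟩).2 ?_
    · rw [n1]; exact X.1
    · rw [add_right_comm, n1]; exact X'.1
    · rwa [n4]
  · obtain rfl := hzX.eq_of_proj X.2.2 e
    refine ((h.of_cot hS ha.symm hb hab.symm).2.2 ⟨hab, ?_, ?_, ?_⟩).2 ?_
    · rw [n3, n1]; exact X'.1
    · rw [n1]; exact X.2.1
    · rw [n3, n1, n1]; exact X.1
    · rwa [n3, n4, n4]
  · obtain rfl := hzX.eq_of_proj X'.1 e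
    refine ((h.of_cot hS hab ha.symm hb.symm).1 ⟨hab, X'.2, ?_, ?_⟩).2 ?_
    · rw [n1]; exact X.1
    · rw [add_right_comm, n1]; exact X.2.1
    · rwa [n4]

end Rauzy

namespace PathAlgebra

variable {k : Type u} {V : Type v} [Field k] [Quiver.{0} V]

instance : IsScalarTower k (PathAlgebra k V) (PathAlgebra k V) :=
  ⟨fun c a b => by simp only [smul_eq_mul, mul_def, map_smul, LinearMap.smul_apply]⟩

instance : SMulCommClass k (PathAlgebra k V) (PathAlgebra k V) :=
  ⟨fun c a b => by simp only [smul_eq_mul, mul_def, map_smul]⟩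

/-- Every element of the path algebra is fixed by the sum of sufficiently many trivial paths. -/
theorem exists_local_unit (a : PathAlgebra k V) :
    ∃ s₀ : Finset V, ∀ s, s₀ ⊆ s → (∑ x ∈ s, vertexIdem k x) * a = a := by
  classical
  induction a using induction_linear with
  | zero => exact ⟨∅, fun s _ => mul_zero _⟩
  | add a b ha hb =>
    obtain ⟨s, hs⟩ := ha
    obtain ⟨t, ht⟩ := hb
    refine ⟨s ∪ t, fun r hr => ?_⟩
    rw [mul_add, hs r (Finset.union_subset_left hr), ht r (Finset.union_subset_right hr)]
  | smul c p =>
    refine ⟨{p.1}, fun s hs => ?_⟩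
    rw [mul_smul_comm, Finset.sum_mul, Finset.sum_eq_single p.1]
    · obtain ⟨x, y, p⟩ := p
      rw [vertexIdem, ofPath_mul_ofPath_of_comp, Path.nil_comp]
    · intro y _ hy
      exact ofPath_mul_ofPath_of_ne hy
    · exact fun h => absurd (hs (Finset.mem_singleton_self _)) h

theorem span_range_ofPath :
    Submodule.span k (Set.range (ofPath k : QPath V → PathAlgebra k V)) = ⊤ :=
  (pathBasis k).span_eq

end PathAlgebra

namespace Rauzy

open PathAlgebra

variable (k : Type u) [Field k] (ε₀ : Fin 3 → ℤˣ)

/-! ### The algebra `A` as a vector space -/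

theorem smul_mem_relIdeal (c : k) {a : PathAlgebra k Vertex} (ha : a ∈ relIdeal k ε₀) :
    c • a ∈ relIdeal k ε₀ := by
  obtain ⟨s, hs⟩ := exists_local_unit a
  rw [← hs s subset_rfl, ← smul_mul_assoc]
  exact TwoSidedIdeal.mul_mem_left _ _ _ ha

theorem ringCon_smul (c : k) {a b : PathAlgebra k Vertex} (h : (relIdeal k ε₀).ringCon a b) :
    (relIdeal k ε₀).ringCon (c • a) (c • b) := by
  rw [TwoSidedIdeal.rel_iff] at h ⊢
  rw [← smul_sub]
  exact smul_mem_relIdeal k ε₀ c h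

instance : SMul k (InfAlgebra k ε₀) :=
  ⟨fun c => Quotient.map' (c • ·) fun _ _ h => ringCon_smul k ε₀ c h⟩

/-- The quotient map `kQ → A` as a homomorphism of groups. -/
def mkHom : PathAlgebra k Vertex →+ InfAlgebra k ε₀ where
  toFun a := (a : InfAlgebra k ε₀)
  map_zero' := rfl
  map_add' _ _ := rfl

theorem mkHom_surjective : Function.Surjective (mkHom k ε₀) := Quotient.mk''_surjective

instance : Module k (InfAlgebra k ε₀) :=
  Function.Surjective.module k (mkHom k ε₀) (mkHom_surjective k ε₀) fun _ _ => rfl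

/-- The quotient map `kQ → A`. -/
def mk : PathAlgebra k Vertex →ₗ[k] InfAlgebra k ε₀ :=
  { mkHom k ε₀ with map_smul' := fun _ _ => rfl }

theorem mk_surjective : Function.Surjective (mk k ε₀) := mkHom_surjective k ε₀

theorem mk_mul (a b : PathAlgebra k Vertex) : mk k ε₀ (a * b) = mk k ε₀ a * mk k ε₀ b := rfl

theorem mk_eq_zero {a : PathAlgebra k Vertex} : mk k ε₀ a = 0 ↔ a ∈ relIdeal k ε₀ :=
  (RingCon.eq _).trans (TwoSidedIdeal.mem_iff _ _).symm

instance : IsScalarTower k (InfAlgebra k ε₀) (InfAlgebra k ε₀) :=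
  ⟨fun c a b => by
    obtain ⟨a, rfl⟩ := mk_surjective k ε₀ a
    obtain ⟨b, rfl⟩ := mk_surjective k ε₀ b
    rw [smul_eq_mul, smul_eq_mul, ← map_smul, ← mk_mul, ← mk_mul, ← map_smul, smul_mul_assoc]⟩

instance : SMulCommClass k (InfAlgebra k ε₀) (InfAlgebra k ε₀) :=
  ⟨fun c a b => by
    obtain ⟨a, rfl⟩ := mk_surjective k ε₀ a
    obtain ⟨b, rfl⟩ := mk_surjective k ε₀ b
    rw [smul_eq_mul, smul_eq_mul, ← map_smul, ← mk_mul, ← mk_mul, ← map_smul, mul_smul_comm]⟩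

theorem span_range_mk_ofPath :
    Submodule.span k (Set.range fun p : QPath Vertex => mk k ε₀ (ofPath k p)) = ⊤ := by
  have := congrArg (Submodule.map (mk k ε₀)) (span_range_ofPath (k := k) (V := Vertex))
  rwa [Submodule.map_span, ← Set.range_comp, Submodule.map_top,
    LinearMap.range_eq_top.2 (mk_surjective k ε₀)] at this

/-! ### Arrows and words -/

open Classical in
/-- The arrow from `x` to `y` in `kQ`; zero if `x` and `y` are not adjacent. -/
def arrow (x y : Pt) : PathAlgebra k Vertex :=
  if h : Adj x y then
    let x' : Vertex := ⟨x, h.isVertex_left⟩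
    let y' : Vertex := ⟨y, h.isVertex_right⟩
    let a : x' ⟶ y' := PLift.up h
    ofPath k ⟨x', y', Path.nil.cons a⟩
  else 0

open Classical in
/-- The trivial path at `x` in `kQ`; zero if `x` is not a vertex. -/
def idemAt (x : Pt) : PathAlgebra k Vertex :=
  if h : IsVertex x then vertexIdem k ⟨x, h⟩ else 0

theorem arrow_of_not_adj {x y : Pt} (h : ¬ Adj x y) : arrow k x y = 0 := by
  rw [arrow, dif_neg h]

theorem IsVertex.exists_eq {x : Pt} (h : IsVertex x) : ∃ v : Vertex, v.1 = x :=
  ⟨⟨x, h⟩, rfl⟩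

theorem arrow_of_adj {x y : Vertex} (h : Adj x.1 y.1) :
    arrow k x.1 y.1 = ofPath k ⟨x, y, Path.nil.cons (PLift.up h : x ⟶ y)⟩ := by
  rw [arrow, dif_pos h]
  rfl

theorem idemAt_of_vertex (x : Vertex) : idemAt k x.1 = ofPath k ⟨x, x, Path.nil⟩ := by
  rw [idemAt, dif_pos x.2]
  rfl

theorem path2_eq (x y z : Pt) : path2 k x y z = arrow k x y * arrow k y z := by
  by_cases h1 : Adj x y
  · by_cases h2 : Adj y z
    · rw [path2, dif_pos ⟨h1, h2⟩]
      obtain ⟨x, rfl⟩ := (h1.isVertex_left).exists_eq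
      obtain ⟨y, rfl⟩ := (h1.isVertex_right).exists_eq
      obtain ⟨z, rfl⟩ := (h2.isVertex_right).exists_eq
      rw [arrow_of_adj k h1, arrow_of_adj k h2, ofPath_mul_ofPath_of_comp]
      rfl
    · rw [path2, dif_neg fun h => h2 h.2, arrow_of_not_adj k h2, mul_zero]
  · rw [path2, dif_neg fun h => h1 h.1, arrow_of_not_adj k h1, zero_mul]

theorem idemAt_mul_arrow (x y : Pt) : idemAt k x * arrow k x y = arrow k x y := by
  by_cases h : Adj x y
  · obtain ⟨x, rfl⟩ := (h.isVertex_left).exists_eq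
    obtain ⟨y, rfl⟩ := (h.isVertex_right).exists_eq
    rw [arrow_of_adj k h, idemAt_of_vertex, ofPath_mul_ofPath_of_comp, Path.nil_comp]
  · rw [arrow_of_not_adj k h, mul_zero]

theorem arrow_mul_idemAt (x y : Pt) : arrow k x y * idemAt k y = arrow k x y := by
  by_cases h : Adj x y
  · obtain ⟨x, rfl⟩ := (h.isVertex_left).exists_eq
    obtain ⟨y, rfl⟩ := (h.isVertex_right).exists_eq
    rw [arrow_of_adj k h, idemAt_of_vertex, ofPath_mul_ofPath_of_comp, Path.comp_nil]
  · rw [arrow_of_not_adj k h, zero_mul]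

theorem idemAt_mul_self (x : Pt) : idemAt k x * idemAt k x = idemAt k x := by
  by_cases h : IsVertex x
  · obtain ⟨x, rfl⟩ := h.exists_eq
    rw [idemAt_of_vertex, ofPath_mul_ofPath_of_comp, Path.comp_nil]
  · rw [idemAt, dif_neg h, zero_mul]

theorem idemAt_mul_idemAt {x y : Pt} (h : x ≠ y) : idemAt k x * idemAt k y = 0 := by
  by_cases hx : IsVertex x
  · by_cases hy : IsVertex y
    · rw [idemAt, idemAt, dif_pos hx, dif_pos hy]
      exact ofPath_mul_ofPath_of_ne fun e => h (congrArg Subtype.val e)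
    · rw [idemAt.eq_def k y, dif_neg hy, mul_zero]
  · rw [idemAt, dif_neg hx, zero_mul]

/-- The trivial path at the projection of `z`, in `A`. -/
def E (z : Fin 3 → ℤ) : InfAlgebra k ε₀ := mk k ε₀ (idemAt k (proj z))

/-- The arrow of `A` that starts at the projection of `z` in the direction of the step `s`. -/
def G (z : Fin 3 → ℤ) (s : Step) : InfAlgebra k ε₀ :=
  mk k ε₀ (arrow k (proj z) (proj z + pv s))

/-- The product of the arrows along a sequence of steps that starts at `z`. -/
def word (z : Fin 3 → ℤ) : List Step → InfAlgebra k ε₀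
  | [] => E k ε₀ z
  | s :: w => G k ε₀ z s * word (z + vec s) w

/-- The end of a sequence of steps that starts at `z`. -/
def wend (z : Fin 3 → ℤ) : List Step → (Fin 3 → ℤ)
  | [] => z
  | s :: w => wend (z + vec s) w

variable {k ε₀}

theorem E_mul_self (z : Fin 3 → ℤ) : E k ε₀ z * E k ε₀ z = E k ε₀ z := by
  rw [E, ← mk_mul, idemAt_mul_self]

theorem E_mul_E {z w : Fin 3 → ℤ} (h : proj z ≠ proj w) : E k ε₀ z * E k ε₀ w = 0 := by
  rw [E, E, ← mk_mul, idemAt_mul_idemAt k h, map_zero]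

theorem E_mul_G (z : Fin 3 → ℤ) (s : Step) : E k ε₀ z * G k ε₀ z s = G k ε₀ z s := by
  rw [E, G, ← mk_mul, idemAt_mul_arrow]

theorem G_mul_E (z : Fin 3 → ℤ) (s : Step) : G k ε₀ z s * E k ε₀ (z + vec s) = G k ε₀ z s := by
  rw [E, G, ← mk_mul, proj_add_vec, arrow_mul_idemAt]

theorem word_cons (z : Fin 3 → ℤ) (s : Step) (w : List Step) :
    word k ε₀ z (s :: w) = G k ε₀ z s * word k ε₀ (z + vec s) w := rfl

theorem word_singleton (z : Fin 3 → ℤ) (s : Step) : word k ε₀ z [s] = G k ε₀ z s := G_mul_E z s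

theorem E_mul_word (z : Fin 3 → ℤ) (w : List Step) :
    E k ε₀ z * word k ε₀ z w = word k ε₀ z w := by
  cases w with
  | nil => exact E_mul_self z
  | cons s w => rw [word_cons, ← mul_assoc, E_mul_G]

theorem word_mul_E (z : Fin 3 → ℤ) (w : List Step) :
    word k ε₀ z w * E k ε₀ (wend z w) = word k ε₀ z w := by
  induction w generalizing z with
  | nil => exact E_mul_self z
  | cons s w ih => rw [word_cons, mul_assoc, wend, ih]

theorem word_mul_word (z : Fin 3 → ℤ) (w w' : List Step) :
    word k ε₀ z w * word k ε₀ (wend z w) w' = word k ε₀ z (w ++ w') := by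
  induction w generalizing z with
  | nil => exact E_mul_word z w'
  | cons s w ih => rw [word_cons, mul_assoc, wend, ih, List.cons_append, word_cons]

/-- Words that do not fit together have product zero. -/
theorem word_mul_word_of_ne {z z' : Fin 3 → ℤ} {w w' : List Step}
    (h : proj (wend z w) ≠ proj z') : word k ε₀ z w * word k ε₀ z' w' = 0 := by
  rw [← word_mul_E, ← E_mul_word z', mul_assoc, ← mul_assoc (E k ε₀ (wend z w)), E_mul_E h,
    zero_mul, mul_zero]

theorem word_mul_G (z : Fin 3 → ℤ) (w : List Step) (s : Step) :
    word k ε₀ z w * G k ε₀ (wend z w) s = word k ε₀ z (w ++ [s]) := by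
  rw [← word_singleton, word_mul_word]

theorem mk_eq_zero_of_relation {a : PathAlgebra k Vertex} (h : Relation k ε₀ a) :
    mk k ε₀ a = 0 :=
  (mk_eq_zero k ε₀).2 (TwoSidedIdeal.subset_span h)

theorem G_eq_zero {z : Fin 3 → ℤ} (hz : InX z) {s : Step} (h : ¬ InX (z + vec s)) :
    G k ε₀ z s = 0 := by
  rw [G, arrow_of_not_adj k fun h' => h (hz.of_adj h'), map_zero]

theorem G_mul_G (z : Fin 3 → ℤ) (s t : Step) : G k ε₀ z s * G k ε₀ (z + vec s) t =
    mk k ε₀ (path2 k (proj z) (proj z + pv s) (proj z + pv s + pv t)) := by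
  rw [path2_eq, mk_mul, G, G, proj_add_vec]

/-- A path of length two vanishes unless it turns back or runs around a rhombus. -/
theorem G_mul_G_eq_zero {z : Fin 3 → ℤ} (hz : InX z) {s t : Step} (h : ¬ Cot z s t)
    (hst : t ≠ s.bar) : G k ε₀ z s * G k ε₀ (z + vec s) t = 0 := by
  rw [G_mul_G]
  by_cases h1 : Adj (proj z) (proj z + pv s)
  · by_cases h2 : Adj (proj z + pv s) (proj z + pv s + pv t)
    · exact mk_eq_zero_of_relation (.two_rhombus _ _ _ h1 h2 fun ⟨T, hT, h3, h4⟩ =>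
        h (cot_of_sides hz hT h3 h4 hst))
    · rw [path2_eq, arrow_of_not_adj k h2, mul_zero, map_zero]
  · rw [path2_eq, arrow_of_not_adj k h1, zero_mul, map_zero]

theorem ne_bar_of_ne {s t : Step} (h : s.1 ≠ t.1) : t ≠ s.bar := by
  rintro rfl
  exact h rfl

/-- Steps along different axes commute. -/
theorem G_mul_G_comm {z : Fin 3 → ℤ} (hz : Good z) {s t : Step} (h : s.1 ≠ t.1) :
    G k ε₀ z s * G k ε₀ (z + vec s) t = G k ε₀ z t * G k ε₀ (z + vec t) s := by
  by_cases hc : Cot z s t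
  · rw [G_mul_G, G_mul_G, ← sub_eq_zero]
    obtain ⟨T, hT, j, h0, h2, h⟩ := hz.tile s t hc
    have hr := mk_eq_zero_of_relation (Relation.mirror (k := k) (ε₀ := ε₀) T hT j)
    rw [map_sub, h0, h2] at hr
    rw [add_right_comm _ (pv t)]
    obtain ⟨h, h'⟩ | ⟨h, h'⟩ := h <;> rw [h, h'] at hr
    · exact hr
    · rw [← neg_sub, hr, neg_zero]
  · rw [G_mul_G_eq_zero hz.inX hc (ne_bar_of_ne h),
      G_mul_G_eq_zero hz.inX (fun h' => hc h'.symm) (ne_bar_of_ne h.symm)]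

/-- The loop `s s̄` at `z`. -/
def loop (z : Fin 3 → ℤ) (s : Step) : InfAlgebra k ε₀ :=
  G k ε₀ z s * G k ε₀ (z + vec s) s.bar

/-- The star relation, for any two axes. -/
theorem loop_star {z : Fin 3 → ℤ} (hz : IsVertex (proj z)) {a b : Fin 3} (h : a ≠ b) :
    ∃ c : k, (loop z (a, 1) - loop z (a, -1) : InfAlgebra k ε₀) =
      c • (loop z (b, 1) - loop z (b, -1)) := by
  have hl : ∀ a, (loop z (a, 1) - loop z (a, -1) : InfAlgebra k ε₀) =
      mk k ε₀ (loopDiff k a (proj z)) := by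
    intro a
    have e : ∀ s : Step, proj z + pv s + pv s.bar = proj z := fun s => by
      rw [pv_bar]; exact add_neg_cancel_right _ _
    rw [loop, loop, G_mul_G, G_mul_G, e, e, ← map_sub, loopDiff, pv_pos, pv_neg, ← sub_eq_add_neg]
  have hd : ∀ d : Fin 3, (loop z (d + 1, 1) - loop z (d + 1, -1) : InfAlgebra k ε₀) =
      ((sign ε₀ d (proj z) : ℤ) : k) • (loop z (d + 2, 1) - loop z (d + 2, -1)) := by
    intro d
    have hr := mk_eq_zero_of_relation (Relation.star (k := k) (ε₀ := ε₀) (proj z) hz d)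
    rw [map_sub, map_smul, ← hl, ← hl] at hr
    exact sub_eq_zero.1 hr
  have key : ∀ a b : Fin 3, a ≠ b → ∃ d : Fin 3, (a = d + 1 ∧ b = d + 2) ∨
      (b = d + 1 ∧ a = d + 2) := by decide
  obtain ⟨d, ⟨rfl, rfl⟩ | ⟨rfl, rfl⟩⟩ := key a b h
  · exact ⟨_, hd d⟩
  · refine ⟨((sign ε₀ d (proj z) : ℤ) : k), ?_⟩
    rw [hd d, smul_smul, ← Int.cast_mul, Int.units_coe_mul_self, Int.cast_one, one_smul]

/-- The star relation inside a subspace: a loop along one axis is a combination of the opposite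
loop and of the two loops along any other axis. -/
theorem loop_mem {z : Fin 3 → ℤ} (hz : IsVertex (proj z)) {s u : Step} (h : s.1 ≠ u.1)
    {S : Submodule k (InfAlgebra k ε₀)} {x y : InfAlgebra k ε₀} (h1 : x * loop z s.bar * y ∈ S)
    (h2 : x * loop z u * y ∈ S) (h3 : x * loop z u.bar * y ∈ S) : x * loop z s * y ∈ S := by
  obtain ⟨c, hc⟩ := loop_star (k := k) (ε₀ := ε₀) hz h
  have hd : x * (loop z (u.1, 1) - loop z (u.1, -1)) * y ∈ S := by
    rw [mul_sub, sub_mul]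
    rcases step_cases u with hu | hu <;> rw [hu] at h2 h3 <;> simp only [Step.bar, neg_neg] at h3
    · exact sub_mem h2 h3
    · exact sub_mem h3 h2
  have he : x * (loop z (s.1, 1) - loop z (s.1, -1)) * y ∈ S := by
    rw [hc, mul_smul_comm, smul_mul_assoc]
    exact S.smul_mem c hd
  rw [mul_sub, sub_mul] at he
  rcases step_cases s with hs | hs <;> rw [hs] at h1 ⊢ <;> simp only [Step.bar, neg_neg] at h1
  · simpa using add_mem he h1
  · simpa using sub_mem h1 he

theorem InX.opposite {z : Fin 3 → ℤ} {s t u : Step} (hst : s.1 ≠ t.1) (hsu : s.1 ≠ u.1)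
    (htu : t.1 ≠ u.1) (h0 : InX z) (hs : InX (z + vec s)) (ht' : InX (z + vec t))
    (hu : InX (z + vec u)) (h1 : InX (z + vec s + vec t)) (h2 : InX (z + vec s + vec u))
    (h3 : InX (z + vec t + vec u)) (h4 : InX (z + vec s + vec t + vec u)) : False := by
  have hsum := sum_hgt hst hsu.symm htu.symm
  simp only [InX, ht_add, ht_vec, hsum] at *
  obtain ⟨a, e⟩ := s
  obtain ⟨b, e'⟩ := t
  obtain ⟨c, e''⟩ := u
  rcases Int.units_eq_one_or e with rfl | rfl <;> rcases Int.units_eq_one_or e' with rfl | rfl <;>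
    rcases Int.units_eq_one_or e'' with rfl | rfl <;> simp at * <;> linarith

/-- A path of length three along three different axes is zero: otherwise all eight corners of a
cube would lie between the two planes. -/
theorem cube_eq_zero {z : Fin 3 → ℤ} (hz : Good z) (hz' : ∀ s, InX (z + vec s) → Good (z + vec s))
    {s t u : Step} (hst : s.1 ≠ t.1) (hsu : s.1 ≠ u.1) (htu : t.1 ≠ u.1) :
    G k ε₀ z s * (G k ε₀ (z + vec s) t * G k ε₀ (z + vec s + vec t) u) = 0 := by
  by_cases c1 : Cot z s t
  swap
  · rw [← mul_assoc, G_mul_G_eq_zero hz.inX c1 (ne_bar_of_ne hst), zero_mul]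
  by_cases c2 : Cot (z + vec s) t u
  swap
  · rw [G_mul_G_eq_zero c1.2.1 c2 (ne_bar_of_ne htu), mul_zero]
  by_cases c3 : Cot z s u
  swap
  · rw [G_mul_G_comm (hz' s c1.2.1) htu, ← mul_assoc,
      G_mul_G_eq_zero hz.inX c3 (ne_bar_of_ne hsu), zero_mul]
  by_cases c4 : Cot (z + vec t) s u
  swap
  · rw [← mul_assoc, G_mul_G_comm hz hst, mul_assoc, add_right_comm,
      G_mul_G_eq_zero c1.2.2.1 c4 (ne_bar_of_ne hsu), mul_zero]
  exact (InX.opposite hst hsu htu hz.inX c1.2.1 c1.2.2.1 c3.2.2.1 c1.2.2.2 c3.2.2.2 c4.2.2.1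
    c2.2.2.2).elim

end Rauzy

namespace PathAlgebra

variable {k : Type u} {V : Type v} [Field k] [Quiver.{0} V]

theorem exists_local_unit_right (a : PathAlgebra k V) :
    ∃ s₀ : Finset V, ∀ s, s₀ ⊆ s → a * (∑ x ∈ s, vertexIdem k x) = a := by
  classical
  induction a using induction_linear with
  | zero => exact ⟨∅, fun s _ => zero_mul _⟩
  | add a b ha hb =>
    obtain ⟨s, hs⟩ := ha
    obtain ⟨t, ht⟩ := hb
    refine ⟨s ∪ t, fun r hr => ?_⟩
    rw [add_mul, hs r (Finset.union_subset_left hr), ht r (Finset.union_subset_right hr)]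
  | smul c p =>
    refine ⟨{p.2.1}, fun s hs => ?_⟩
    rw [smul_mul_assoc, Finset.mul_sum, Finset.sum_eq_single p.2.1]
    · obtain ⟨x, y, p⟩ := p
      rw [vertexIdem, ofPath_mul_ofPath_of_comp, Path.comp_nil]
    · intro y _ hy
      exact ofPath_mul_ofPath_of_ne hy.symm
    · exact fun h => absurd (hs (Finset.mem_singleton_self _)) h

end PathAlgebra

namespace Rauzy

open PathAlgebra

/-! ### Trace forms -/

open Classical in
/-- The indicator of `Cot`. -/
def cnt (z : Fin 3 → ℤ) (s t : Step) : ℤ := if Cot z s t then 1 else 0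

theorem cnt_comm (z : Fin 3 → ℤ) (s t : Step) : cnt z s t = cnt z t s := by
  classical exact if_congr cot_comm rfl rfl

theorem cnt_of_not {z : Fin 3 → ℤ} {s t : Step} (h : ¬ Cot z s t) : cnt z s t = 0 := if_neg h

theorem cnt_of {z : Fin 3 → ℤ} {s t : Step} (h : Cot z s t) : cnt z s t = 1 := if_pos h

/-- The difference between the numbers of rhombi on the positive and on the negative side of the
step `t` with respect to the axis `d`. -/
def cntDiff (z : Fin 3 → ℤ) (t : Step) (d : Fin 3) : ℤ := cnt z t (d, 1) - cnt z t (d, -1)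

theorem cntDiff_eq {z : Fin 3 → ℤ} (hz : InX z) {t : Step} {a b : Fin 3} (ha : a ≠ t.1)
    (hb : b ≠ t.1) (hab : a ≠ b) : cntDiff z t a = cntDiff z t b := by
  obtain ⟨c, e⟩ := t
  simp only at ha hb
  have hs := sum_hgt hab ha.symm hb.symm
  have pa := hgt_pos a
  have pb := hgt_pos b
  have pc := hgt_pos c
  obtain ⟨h0, h1⟩ := hz
  simp only [cntDiff, cnt, Cot, InX, ht_add, ht_vec, hs, ne_eq, ha.symm, hb.symm,
    not_false_eq_true, true_and] at *
  rcases Int.units_eq_one_or e with rfl | rfl <;> simp <;> split_ifs <;>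
    first | rfl | (exfalso; simp_all; done) | (exfalso; grind)

/-- The weights of the three types of rhombi in the trace form at a vertex. They satisfy the sign
rule `θ_a = ε_c θ_b` for distinct axes `a`, `b`, `c`. -/
def theta (ε₀ : Fin 3 → ℤˣ) (q : Pt) : Fin 3 → ℤˣ := ![1, sign ε₀ 2 q, sign ε₀ 1 q]

theorem prod_sign {ε₀ : Fin 3 → ℤˣ} (hε : ∏ d, ε₀ d = 1) (q : Pt) :
    sign ε₀ 0 q * sign ε₀ 1 q * sign ε₀ 2 q = 1 := by
  rw [Fin.prod_univ_three] at hε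
  obtain ⟨m, n⟩ := q
  simp only [sign, Matrix.cons_val_zero, Matrix.cons_val_one, Matrix.cons_val]
  rw [mul_mul_mul_comm (ε₀ 0), mul_mul_mul_comm (ε₀ 0 * ε₀ 1), hε, one_mul, ← zpow_add, ← zpow_add]
  exact Even.neg_one_zpow ⟨m + n, by ring⟩

theorem theta_eq {ε₀ : Fin 3 → ℤˣ} (hε : ∏ d, ε₀ d = 1) (q : Pt) (d : Fin 3) :
    theta ε₀ q (d + 2) = sign ε₀ d q * theta ε₀ q (d + 1) := by
  have h := prod_sign hε q
  have h0 := Int.units_mul_self (sign ε₀ 0 q)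
  have h1 := Int.units_mul_self (sign ε₀ 1 q)
  have h2 := Int.units_mul_self (sign ε₀ 2 q)
  fin_cases d <;> simp [theta]
  · calc sign ε₀ 1 q = sign ε₀ 0 q * sign ε₀ 1 q * sign ε₀ 2 q * sign ε₀ 1 q := by rw [h, one_mul]
      _ = sign ε₀ 0 q * sign ε₀ 2 q * (sign ε₀ 1 q * sign ε₀ 1 q) := by
        simp only [mul_assoc, mul_comm, mul_left_comm]
      _ = _ := by rw [h1, mul_one]

theorem sign_add_pv (ε₀ : Fin 3 → ℤˣ) (d : Fin 3) (q : Pt) (s : Step) :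
    sign ε₀ d (q + pv s) = if s.1 = d then sign ε₀ d q else -sign ε₀ d q := by
  obtain ⟨a, e⟩ := s
  rcases Int.units_eq_one_or e with rfl | rfl
  · rw [pv_pos, sign_add_dir]
  · have h := sign_add_dir ε₀ d a (q + pv (a, -1))
    rw [pv_neg, neg_add_cancel_right] at h
    rw [pv_neg, h]
    split_ifs <;> simp

variable (ε₀ : Fin 3 → ℤˣ)

/-- The bilinear form behind the trace form at `z`: the value of the closed path `s s̄ t t̄`. -/
def form (z : Fin 3 → ℤ) (s t : Step) : ℤ :=
  if s.1 = t.1 then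
    if s = t then s.2 * sign ε₀ (s.1 + 2) (proj z) * cntDiff z s (s.1 + 1) *
      theta ε₀ (proj z) (s.1 + 2)
    else 0
  else cnt z s t * theta ε₀ (proj z) (-(s.1 + t.1))

theorem form_comm (z : Fin 3 → ℤ) (s t : Step) : form ε₀ z s t = form ε₀ z t s := by
  by_cases h : s = t
  · rw [h]
  · simp only [form, h, Ne.symm h, if_false, eq_comm (a := s.1), cnt_comm z s, add_comm s.1]

theorem form_of_not {z : Fin 3 → ℤ} {s t : Step} (h : s.1 ≠ t.1) (h' : ¬ Cot z s t) :
    form ε₀ z s t = 0 := by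
  rw [form, if_neg h, cnt_of_not h', zero_mul]

theorem form_bar (z : Fin 3 → ℤ) (s : Step) : form ε₀ z s s.bar = 0 := by
  rw [form, if_pos (Step.bar_fst s).symm, if_neg (bar_ne s).symm]

theorem form_of_cot {z : Fin 3 → ℤ} {s t : Step} (h : Cot z s t) :
    form ε₀ z s t = 1 ∨ form ε₀ z s t = -1 := by
  rw [form, if_neg h.1, cnt_of h, one_mul]
  rcases Int.units_eq_one_or (theta ε₀ (proj z) (-(s.1 + t.1))) with h | h <;> rw [h] <;> simp

theorem form_sub {z : Fin 3 → ℤ} {q : Step} {a : Fin 3} (h : q.1 ≠ a) :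
    form ε₀ z q (a, 1) - form ε₀ z q (a, -1) =
      cntDiff z q a * theta ε₀ (proj z) (-(q.1 + a)) := by
  rw [form, form, if_neg h, if_neg h, cntDiff, sub_mul]

theorem form_sub_self {z : Fin 3 → ℤ} {q : Step} :
    form ε₀ z q (q.1, 1) - form ε₀ z q (q.1, -1) =
      sign ε₀ (q.1 + 2) (proj z) * cntDiff z q (q.1 + 1) * theta ε₀ (proj z) (q.1 + 2) := by
  obtain ⟨d, e⟩ := q
  rcases Int.units_eq_one_or e with rfl | rfl <;> simp [form]

theorem axis_cases (d c : Fin 3) : c = d ∨ c = d + 1 ∨ c = d + 2 := by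
  revert c d; decide

variable {ε₀}

/-- The form satisfies the star relations. -/
theorem form_star (hε : ∏ d, ε₀ d = 1) {z : Fin 3 → ℤ} (hz : InX z) (q : Step) (d : Fin 3) :
    form ε₀ z q (d + 1, 1) - form ε₀ z q (d + 1, -1) =
      sign ε₀ d (proj z) * (form ε₀ z q (d + 2, 1) - form ε₀ z q (d + 2, -1)) := by
  have key : ∀ d : Fin 3, d ≠ d + 1 ∧ d ≠ d + 2 ∧ d + 1 ≠ d + 2 ∧ -(d + (d + 1)) = d + 2 ∧
      -(d + (d + 2)) = d + 1 ∧ -(d + 1 + (d + 2)) = d ∧ -(d + 2 + (d + 1)) = d ∧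
      d + 1 + 2 = d ∧ d + 1 + 1 = d + 2 ∧ d + 2 + 2 = d + 1 ∧ d + 2 + 1 = d := by decide
  obtain ⟨k1, k2, k3, k4, k5, k6, k7, k8, k9, k10, k11⟩ := key d
  have t := theta_eq hε (proj z)
  rcases axis_cases d q.1 with h | h | h
  · rw [form_sub ε₀ (h.trans_ne k1), form_sub ε₀ (h.trans_ne k2),
      cntDiff_eq hz (b := d + 2) (k1.symm.trans_eq h.symm) (k2.symm.trans_eq h.symm) k3, h, k4, k5,
      t d, Units.val_mul]
    ring
  · have h1 := form_sub_self ε₀ (z := z) (q := q)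
    rw [h, k8, k9] at h1
    rw [h1, form_sub ε₀ (h.trans_ne k3), h, k6]
    ring
  · have h1 := form_sub_self ε₀ (z := z) (q := q)
    rw [h, k10, k11] at h1
    rw [h1, form_sub ε₀ (h.trans_ne k3.symm), h, k7,
      cntDiff_eq hz (b := d) (k3.trans_eq h.symm) (k2.trans_eq h.symm) k1.symm]
    have t1 := t (d + 1)
    rw [k8, k9] at t1
    have e := t d
    rw [t1, e, Units.val_mul, Units.val_mul]
    ring

/-- The trace form at `z` on the paths from the projection of `z`, given by their steps. -/
def trWord (ε₀ : Fin 3 → ℤˣ) (z : Fin 3 → ℤ) : List Step → ℤ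
  | [a, b, c, d] =>
    if b = a.bar then if d = c.bar then form ε₀ z a c else 0
    else if b = a then 0
    else if c = a.bar ∧ d = b.bar ∨ c = b.bar ∧ d = a.bar then form ε₀ z a b
    else 0
  | _ => 0

theorem trWord_of_length {ε₀ : Fin 3 → ℤˣ} {z : Fin 3 → ℤ} {w : List Step} (h : w.length ≠ 4) :
    trWord ε₀ z w = 0 := by
  match w, h with
  | [], _ | [_], _ | [_, _], _ | [_, _, _], _ | _ :: _ :: _ :: _ :: _ :: _, _ => rfl
  | [_, _, _, _], h => exact absurd rfl h

theorem trWord_four (ε₀ : Fin 3 → ℤˣ) (z : Fin 3 → ℤ) (a b c d : Step) :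
    trWord ε₀ z [a, b, c, d] =
      if b = a.bar then if d = c.bar then form ε₀ z a c else 0
      else if b = a then 0
      else if c = a.bar ∧ d = b.bar ∨ c = b.bar ∧ d = a.bar then form ε₀ z a b
      else 0 := rfl

theorem bar_eq_iff {s t : Step} : s.bar = t ↔ s = t.bar := by
  revert s t; decide

theorem length_two_cases {α : Type*} {P Q : List α} (h : P.length + Q.length = 2) :
    (P = [] ∧ ∃ p q, Q = [p, q]) ∨ (∃ p, P = [p] ∧ ∃ q, Q = [q]) ∨
      ∃ p q, P = [p, q] ∧ Q = [] := by
  rcases P with _ | ⟨p, _ | ⟨q, _ | ⟨r, P⟩⟩⟩ <;> rcases Q with _ | ⟨p', _ | ⟨q', _ | ⟨r', Q⟩⟩⟩ <;>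
    simp at h ⊢ <;> omega

/-- Steps along different axes may be exchanged. -/
theorem trWord_swap (ε₀ : Fin 3 → ℤˣ) (z : Fin 3 → ℤ) {s t : Step} (h : s.1 ≠ t.1)
    (P Q : List Step) : trWord ε₀ z (P ++ [s, t] ++ Q) = trWord ε₀ z (P ++ [t, s] ++ Q) := by
  have h1 : s ≠ t := fun e => h (congrArg _ e)
  have h2 : s ≠ t.bar := ne_bar_of_ne h.symm
  have h3 : t ≠ s.bar := ne_bar_of_ne h
  by_cases hl : P.length + Q.length = 2
  swap
  · rw [trWord_of_length, trWord_of_length] <;> simp <;> omega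
  obtain ⟨rfl, p, q, rfl⟩ | ⟨p, rfl, q, rfl⟩ | ⟨p, q, rfl, rfl⟩ := length_two_cases hl
  · simp only [List.nil_append, List.cons_append, trWord_four, h1, h1.symm, h2, h3, if_false,
      form_comm ε₀ z s t, or_comm (a := p = s.bar ∧ q = t.bar)]
  · simp only [List.nil_append, List.cons_append, trWord_four]
    have h4 : s.bar ≠ t.bar := fun e => h1 (by rw [← Step.bar_bar s, e, Step.bar_bar])
    by_cases e1 : s = p
    · subst e1
      have := (bar_ne s).symm
      grind [Step.bar_bar]
    by_cases e2 : t = p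
    · subst e2
      have := (bar_ne t).symm
      grind [Step.bar_bar]
    by_cases e3 : s = p.bar
    · subst e3
      have := (bar_ne p)
      grind [Step.bar_bar]
    by_cases e4 : t = p.bar
    · subst e4
      have := (bar_ne p)
      grind [Step.bar_bar]
    simp only [e1, e2, e3, e4, h2, h3, if_false, false_and, or_false]
  · simp only [List.nil_append, List.cons_append, List.append_nil, trWord_four, h2, h3, if_false]
    simp only [and_comm (a := s = q.bar), and_comm (a := s = p.bar)]
    simp only [or_comm (a := t = q.bar ∧ s = p.bar)]

/-- The end of a sequence of steps in the plane. -/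
theorem proj_wend (z : Fin 3 → ℤ) (w : List Step) : proj (wend z w) = proj z + (w.map pv).sum := by
  induction w generalizing z with
  | nil => simp [wend]
  | cons s w ih => rw [wend, ih, proj_add_vec, List.map_cons, List.sum_cons, add_assoc]

/-- Paths of length two that are not contained in a rhombus have trace zero. -/
theorem trWord_two_rhombus {z : Fin 3 → ℤ} (hz : Good z) (P Q : List Step) {s t : Step}
    (h1 : Adj (proj (wend z P)) (proj (wend z P) + pv s))
    (h : ¬ ∃ T ∈ tiling, IsSide T (proj (wend z P)) (proj (wend z P) + pv s) ∧
      IsSide T (proj (wend z P) + pv s) (proj (wend z P) + pv s + pv t)) :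
    trWord ε₀ z (P ++ [s, t] ++ Q) = 0 := by
  have hts : t ≠ s.bar := by
    rintro rfl
    obtain ⟨T, hT, h1⟩ := h1
    refine h ⟨T, hT, h1, ?_⟩
    rw [pv_bar, add_neg_cancel_right]
    exact isSide_symm h1
  have hst : s ≠ t.bar := fun e => hts (bar_eq_iff.1 e.symm)
  by_cases hl : P.length + Q.length = 2
  swap
  · exact trWord_of_length (by simp; omega)
  have axis : ∀ {a b : Step}, b ≠ a.bar → b ≠ a → a.1 ≠ b.1 := by decide
  obtain ⟨rfl, p, q, rfl⟩ | ⟨p, rfl, q, rfl⟩ | ⟨p, q, rfl, rfl⟩ := length_two_cases hl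
  · simp only [List.nil_append, List.cons_append, trWord_four, hts, if_false, wend] at h ⊢
    split_ifs with h2 h3
    · rfl
    · refine form_of_not ε₀ (axis hts h2) fun hc => h ?_
      obtain ⟨T, hT, hs⟩ := hz.sides hc
      exact ⟨T, hT, hs.1, hs.2.1⟩
    · rfl
  · simp only [List.nil_append, List.cons_append, trWord_four, wend, proj_add_vec] at h ⊢
    split_ifs with h2 h3 h4 h5
    · subst h2 h3
      by_cases hpt : t = p.bar
      · rw [hpt, form_bar]
      have hpt' : t ≠ p := by rwa [Step.bar_bar] at hts
      refine form_of_not ε₀ (axis hpt hpt') fun hc => h ?_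
      obtain ⟨T, hT, hs⟩ := hz.sides hc
      refine ⟨T, hT, ?_⟩
      rw [pv_bar, add_neg_cancel_right]
      exact ⟨isSide_symm hs.1, hs.2.2.1⟩
    · rfl
    · rfl
    · obtain ⟨rfl, rfl⟩ | ⟨rfl, rfl⟩ := h5
      · refine form_of_not ε₀ (axis h2 h4) fun hc => h ?_
        obtain ⟨T, hT, hs⟩ := hz.sides hc
        refine ⟨T, hT, hs.2.1, ?_⟩
        rw [pv_bar, show proj z + pv p + pv s + -pv p = proj z + pv s by abel]
        exact isSide_symm hs.2.2.2
      · exact absurd rfl hts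
    · rfl
  · simp only [List.nil_append, List.cons_append, List.append_nil, trWord_four, hts, if_false,
      wend, proj_add_vec] at h ⊢
    split_ifs with h2 h3 h4
    · rfl
    · rfl
    · have hc : Cot z p q → False := by
        intro hc
        apply h
        obtain ⟨T, hT, hs⟩ := hz.sides hc
        refine ⟨T, hT, ?_⟩
        obtain ⟨rfl, rfl⟩ | ⟨rfl, rfl⟩ := h4 <;> rw [pv_bar, pv_bar]
        · rw [add_right_comm (proj z), add_neg_cancel_right, add_neg_cancel_right,
            add_right_comm (proj z)]
          exact ⟨isSide_symm (by simpa only [add_right_comm] using hs.2.2.2), isSide_symm hs.2.2.1⟩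
        · rw [add_neg_cancel_right, add_neg_cancel_right]
          exact ⟨isSide_symm hs.2.1, isSide_symm hs.1⟩
      exact form_of_not ε₀ (axis h2 h3) hc
    · rfl

/-- The value of the closed path along `s` and back, if that arrow exists. -/
def trLoop (ε₀ : Fin 3 → ℤˣ) (z : Fin 3 → ℤ) (P Q : List Step) (s : Step) : ℤ :=
  open Classical in
  if Adj (proj (wend z P)) (proj (wend z P) + pv s) then trWord ε₀ z (P ++ [s, s.bar] ++ Q) else 0

theorem eq_or_eq_bar {s t : Step} (h : s.1 = t.1) : s = t ∨ s = t.bar := by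
  revert s t; decide

/-- The trace form respects the star relation in every position of a path. Only paths of length four
matter, so the two remaining steps lie before, around or after the loop; each case reduces to
`form_star`. -/
theorem trLoop_star (hε : ∏ d, ε₀ d = 1) {z : Fin 3 → ℤ} (hz : Good z) (P Q : List Step)
    (d : Fin 3) :
    trLoop ε₀ z P Q (d + 1, 1) - trLoop ε₀ z P Q (d + 1, -1) =
      sign ε₀ d (proj (wend z P)) *
        (trLoop ε₀ z P Q (d + 2, 1) - trLoop ε₀ z P Q (d + 2, -1)) := by
  classical
  by_cases hl : P.length + Q.length = 2
  swap
  · have : ∀ s, trLoop ε₀ z P Q s = 0 := fun s => by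
      rw [trLoop, trWord_of_length (by simp; omega), ite_self]
    simp only [this]; simp
  have hadj : ∀ s, form ε₀ z s s ≠ 0 → Adj (proj z) (proj z + pv s) := by
    intro s h
    refine hz.adj ?_
    by_contra h'
    apply h
    rw [form, if_pos rfl, if_pos rfl, cntDiff, cnt_of_not fun c => h' c.2.1,
      cnt_of_not fun c => h' c.2.1]
    simp
  have hadj' : ∀ s t, form ε₀ z s t ≠ 0 → Adj (proj z) (proj z + pv s) := by
    intro s t h
    by_cases h1 : s.1 = t.1
    · by_cases h2 : s = t
      · exact hadj s (by rwa [← h2] at h)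
      · rw [form, if_pos h1, if_neg h2] at h
        exact absurd rfl h
    · by_contra h'
      exact h (form_of_not ε₀ h1 fun c => h' (hz.adj c.2.1))
  have h0 : ∀ q q', ∀ s, trLoop ε₀ z [] [q, q'] s = if q' = q.bar then form ε₀ z q s else 0 := by
    intro q q' s
    rw [trLoop]
    simp only [wend, List.nil_append, List.cons_append, trWord_four, if_true]
    rw [form_comm]
    by_cases h : form ε₀ z q s = 0
    · simp [h]
    · rw [if_pos (hadj' s q (by rwa [form_comm]))]
  obtain ⟨rfl, p, q, rfl⟩ | ⟨p, rfl, q, rfl⟩ | ⟨p, q, rfl, rfl⟩ := length_two_cases hl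
  · simp only [h0 p q, wend]
    split_ifs
    · exact form_star hε hz.inX p d
    · simp
  · have h1 : ∀ s, trLoop ε₀ z [p] [q] s =
        if q = p.bar then form ε₀ z p (if s.1 = p.1 then s.bar else s) else 0 := by
      intro s
      rw [trLoop]
      simp only [wend, List.nil_append, List.cons_append, trWord_four, proj_add_vec]
      by_cases e1 : s = p.bar
      · subst e1
        rw [if_pos rfl, Step.bar_bar, Step.bar_fst, if_pos rfl]
        by_cases hq : q = p.bar
        · rw [if_pos hq, Step.bar_bar]
          by_cases h : form ε₀ z p p = 0
          · rw [h, ite_self]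
          · rw [if_pos]
            rw [pv_bar, add_neg_cancel_right]
            exact (hadj p h).symm
        · rw [if_neg hq, ite_self]
      rw [if_neg e1]
      by_cases e2 : s = p
      · subst e2
        rw [if_pos rfl, if_pos rfl, form_bar, ite_self, ite_self]
      have e3 : s.1 ≠ p.1 := fun h => (eq_or_eq_bar h).elim e2 e1
      rw [if_neg e2, if_neg e3]
      have e4 : s.bar ≠ p.bar := fun h => e2 (by rw [← Step.bar_bar s, h, Step.bar_bar])
      simp only [e4, false_and, true_and, false_or]
      by_cases hq : q = p.bar
      · rw [if_pos hq]
        by_cases h : Cot z p s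
        · obtain ⟨T, hT, hs⟩ := hz.sides h
          rw [if_pos ⟨T, hT, hs.2.1⟩]
        · rw [form_of_not ε₀ e3.symm h, ite_self]
      · rw [if_neg hq, ite_self]
    simp only [h1]
    by_cases hq : q = p.bar
    swap
    · simp [hq]
    simp only [hq, if_true, wend, proj_add_vec, sign_add_pv]
    have h2 := form_star hε hz.inX p d
    have key : ∀ d : Fin 3, d + 1 ≠ d + 2 ∧ d ≠ d + 1 ∧ d ≠ d + 2 := by decide
    obtain ⟨k1, k2, k3⟩ := key d
    rcases axis_cases d p.1 with h | h | h
    · simp only [h, k2.symm, k3.symm, if_true, if_false]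
      exact h2
    · simp only [h, k2.symm, k1.symm, if_true, if_false, Step.bar, neg_neg, Units.val_neg]
      linear_combination -h2
    · simp only [h, k3.symm, k1, if_true, if_false, Step.bar, neg_neg, Units.val_neg]
      linear_combination h2
  · have h2 : ∀ s, trLoop ε₀ z [p, q] [] s =
        if q = p.bar then form ε₀ z p s else 0 := by
      intro s
      rw [trLoop]
      simp only [wend, List.nil_append, List.cons_append, List.append_nil, trWord_four]
      by_cases hq : q = p.bar
      · subst hq
        simp only [if_true, add_vec_bar]
        by_cases h : form ε₀ z p s = 0
        · rw [h, ite_self]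
        · rw [if_pos (hadj' s p (by rwa [form_comm]))]
      · rw [if_neg hq, if_neg hq]
        by_cases hq' : q = p
        · rw [if_pos hq', ite_self]
        rw [if_neg hq', if_neg (c := _ ∧ _ ∨ _ ∧ _), ite_self]
        rintro (⟨rfl, h⟩ | ⟨rfl, h⟩)
        · exact hq (bar_eq_iff.1 (by simpa using h.symm))
        · exact hq (by simpa using h)
    simp only [h2]
    split_ifs with h
    · subst h
      simp only [wend, add_vec_bar]
      exact form_star hε hz.inX p d
    · simp

end Rauzy

namespace Rauzy

open PathAlgebra

/-! ### The trace form on the algebra -/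

open Classical in
/-- The step from `x` to `y`, for adjacent points `x` and `y`. -/
def stepTo (x y : Pt) : Step := if h : ∃ s, y = x + pv s then h.choose else (0, 1)

theorem stepTo_add (x : Pt) (s : Step) : stepTo x (x + pv s) = s := by
  have h : ∃ s', x + pv s = x + pv s' := ⟨s, rfl⟩
  rw [stepTo, dif_pos h]
  exact (pv_injective (add_left_cancel h.choose_spec)).symm

/-- The sequence of steps of a path. -/
def stepsOf {x : Vertex} : {y : Vertex} → Path x y → List Step
  | _, .nil => []
  | _, .cons (b := b) (c := c) p _ => stepsOf p ++ [stepTo b.1 c.1]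

theorem stepsOf_comp {x y z : Vertex} (p : Path x y) (q : Path y z) :
    stepsOf (p.comp q) = stepsOf p ++ stepsOf q := by
  induction q with
  | nil => simp [stepsOf]
  | cons q a ih => rw [Path.comp_cons, stepsOf, ih, stepsOf, List.append_assoc]

theorem wend_append (z : Fin 3 → ℤ) (w w' : List Step) :
    wend z (w ++ w') = wend (wend z w) w' := by
  induction w generalizing z with
  | nil => rfl
  | cons s w ih => exact ih _

theorem proj_wend_stepsOf {x y : Vertex} (p : Path x y) {z : Fin 3 → ℤ} (h : proj z = x.1) :
    proj (wend z (stepsOf p)) = y.1 := by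
  induction p with
  | nil => exact h
  | cons p a ih =>
    obtain ⟨s, hs⟩ := a.down.exists_step
    rw [stepsOf, wend_append, wend, wend, proj_add_vec, ih, hs, stepTo_add]

variable (k : Type u) [Field k] (ε₀ : Fin 3 → ℤˣ)

open Classical in
/-- The trace form at `z` as a functional on `kQ`. -/
def trPath (z : Fin 3 → ℤ) : PathAlgebra k Vertex →ₗ[k] k :=
  (pathBasis k).constr k fun p =>
    if proj z = p.1.1 then ((trWord ε₀ z (stepsOf p.2.2) : ℤ) : k) else 0

variable {k}

theorem trPath_ofPath {z : Fin 3 → ℤ} {x y : Vertex} (p : Path x y) (h : proj z = x.1) :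
    trPath k ε₀ z (ofPath k ⟨x, y, p⟩) = (trWord ε₀ z (stepsOf p) : ℤ) := by
  rw [trPath, ofPath, Module.Basis.constr_basis, if_pos h]

theorem trPath_ofPath_of_ne {z : Fin 3 → ℤ} {x y : Vertex} (p : Path x y) (h : proj z ≠ x.1) :
    trPath k ε₀ z (ofPath k ⟨x, y, p⟩) = 0 := by
  rw [trPath, ofPath, Module.Basis.constr_basis, if_neg h]

theorem path2_of_adj {x y z : Vertex} (h : Adj x.1 y.1) (h' : Adj y.1 z.1) :
    path2 k x.1 y.1 z.1 =
      ofPath k ⟨x, z, (Path.nil.cons (PLift.up h : x ⟶ y)).cons (PLift.up h' : y ⟶ z)⟩ := by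
  rw [path2, dif_pos ⟨h, h'⟩]
  rfl

open Classical in
theorem trPath_mul_path2_mul_vertex (z : Fin 3 → ℤ) {a b b' c x y w : Vertex} (p : Path a b)
    (q : Path b' c) (h : Adj x.1 y.1) (h' : Adj y.1 w.1) :
    trPath k ε₀ z (ofPath k ⟨a, b, p⟩ * path2 k x.1 y.1 w.1 * ofPath k ⟨b', c, q⟩) =
    if proj z = a.1 ∧ b.1 = x.1 ∧ w.1 = b'.1
    then ((trWord ε₀ z (stepsOf p ++ [stepTo x.1 y.1, stepTo y.1 w.1] ++ stepsOf q) : ℤ) : k)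
    else 0 := by
  rw [path2_of_adj h h']
  by_cases h1 : b = x
  swap
  · rw [ofPath_mul_ofPath_of_ne (by simpa using h1), zero_mul, map_zero,
      if_neg fun h' => h1 (Subtype.ext h'.2.1)]
  by_cases h2 : w = b'
  swap
  · rw [mul_assoc, ofPath_mul_ofPath_of_ne (q := ⟨b', c, q⟩) (by simpa using h2),
      mul_zero, map_zero, if_neg fun h' => h2 (Subtype.ext h'.2.2)]
  subst h1 h2
  rw [ofPath_mul_ofPath_of_comp, ofPath_mul_ofPath_of_comp]
  by_cases hz : proj z = a.1
  · rw [trPath_ofPath ε₀ _ hz, if_pos ⟨hz, rfl, rfl⟩, stepsOf_comp, stepsOf_comp, stepsOf,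
      stepsOf, stepsOf]
    rfl
  · rw [trPath_ofPath_of_ne ε₀ _ hz, if_neg fun h' => hz h'.1]

open Classical in
theorem trPath_mul_path2_mul (z : Fin 3 → ℤ) {a b b' c : Vertex} (p : Path a b) (q : Path b' c)
    (x : Pt) (s t : Step) :
    trPath k ε₀ z (ofPath k ⟨a, b, p⟩ * path2 k x (x + pv s) (x + pv s + pv t) *
      ofPath k ⟨b', c, q⟩) =
    if proj z = a.1 ∧ b.1 = x ∧ x + pv s + pv t = b'.1 ∧ Adj x (x + pv s) ∧
      Adj (x + pv s) (x + pv s + pv t)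
    then ((trWord ε₀ z (stepsOf p ++ [s, t] ++ stepsOf q) : ℤ) : k) else 0 := by
  by_cases h : Adj x (x + pv s) ∧ Adj (x + pv s) (x + pv s + pv t)
  swap
  · rw [path2, dif_neg h, mul_zero, zero_mul, map_zero, if_neg fun h' => h h'.2.2.2]
  obtain ⟨h, h'⟩ := h
  obtain ⟨X, hX⟩ := h.isVertex_left.exists_eq
  obtain ⟨Y, hY⟩ := h.isVertex_right.exists_eq
  obtain ⟨W, hW⟩ := h'.isVertex_right.exists_eq
  have := trPath_mul_path2_mul_vertex (k := k) ε₀ z p q (x := X) (y := Y) (w := W)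
    (by rwa [hX, hY]) (by rwa [hY, hW])
  rw [hX, hY, hW, stepTo_add, stepTo_add] at this
  rw [this]
  simp only [h, h', and_true]

variable {ε₀}

theorem exists_corner_steps (T : Tile) (j : Fin 4) : ∃ x s t, s.1 ≠ t.1 ∧ corner T j = x ∧
    corner T (j + 1) = x + pv s ∧ corner T (j + 2) = x + pv s + pv t ∧
    corner T (j + 3) = x + pv t := by
  obtain ⟨q, c⟩ := T
  have hc : c + 1 ≠ c + 2 := by revert c; decide
  have e : ∀ a, pv (a, -1) = -dir a := pv_neg
  have e' : ∀ a, pv (a, 1) = dir a := pv_pos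
  fin_cases j
  · exact ⟨_, (c + 1, 1), (c + 2, 1), hc, rfl, rfl, rfl, rfl⟩
  · refine ⟨_, (c + 2, 1), (c + 1, -1), hc.symm, rfl, rfl, ?_, ?_⟩ <;>
      rw [e] <;> simp [corner, e'] <;> abel
  · refine ⟨_, (c + 1, -1), (c + 2, -1), hc, rfl, ?_, ?_, ?_⟩ <;>
      simp only [e] <;> simp [corner] <;> abel
  · refine ⟨_, (c + 2, -1), (c + 1, 1), hc.symm, rfl, ?_, ?_, ?_⟩ <;>
      simp only [e, e'] <;> simp [corner] <;> abel

/-- The trace form vanishes on the products of paths with relations. -/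
theorem trPath_relation (hε : ∏ d, ε₀ d = 1) {z : Fin 3 → ℤ} (hz : Good z) {a b b' c : Vertex}
    (p : Path a b) (q : Path b' c) {r : PathAlgebra k Vertex} (hr : Relation k ε₀ r) :
    trPath k ε₀ z (ofPath k ⟨a, b, p⟩ * r * ofPath k ⟨b', c, q⟩) = 0 := by
  cases hr with
  | two_rhombus x y w hxy hyw h =>
    obtain ⟨s, rfl⟩ := hxy.exists_step
    obtain ⟨t, rfl⟩ := hyw.exists_step
    rw [trPath_mul_path2_mul]
    split_ifs with hc
    · obtain ⟨ha, hb, -⟩ := hc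
      have hw := proj_wend_stepsOf p ha
      rw [hb] at hw
      subst hw
      rw [trWord_two_rhombus hz _ _ hxy h, Int.cast_zero]
    · rfl
  | mirror T hT j =>
    obtain ⟨x, s, t, hst, h0, h1, h2, h3⟩ : ∃ x s t, s.1 ≠ t.1 ∧ corner T j = x ∧
        corner T (j + 1) = x + pv s ∧ corner T (j + 2) = x + pv s + pv t ∧
        corner T (j + 3) = x + pv t := by
      exact exists_corner_steps T j
    have adj : ∀ i, Adj (corner T i) (corner T (i + 1)) := fun i => ⟨T, hT, isSide_corner T i⟩
    have a0 := adj j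
    have a1 := adj (j + 1)
    have a2 := (adj (j + 2)).symm
    have a3 := (adj (j + 3)).symm
    rw [show j + 3 + 1 = j by rw [add_assoc]; exact add_zero j] at a3
    rw [show j + 1 + 1 = j + 2 from add_assoc _ _ _] at a1
    rw [show j + 2 + 1 = j + 3 from add_assoc _ _ _] at a2
    rw [h0, h1] at a0
    rw [h1, h2] at a1
    rw [h3, h2, add_right_comm] at a2
    rw [h0, h3] at a3
    have m1 := trPath_mul_path2_mul (k := k) ε₀ z p q x s t
    have m2 := trPath_mul_path2_mul (k := k) ε₀ z p q x t s
    simp only [a0, a1, a2, a3, and_true] at m1 m2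
    rw [add_right_comm x (pv t)] at m2
    rw [h0, h1, h2, h3, mul_sub, sub_mul, map_sub, m1, m2, trWord_swap ε₀ z hst, sub_self]
  | star x hx d =>
    have hl : ∀ e, trPath k ε₀ z (ofPath k ⟨a, b, p⟩ * loopDiff k e x * ofPath k ⟨b', c, q⟩) =
        if proj z = a.1 ∧ b.1 = x ∧ x = b'.1 then
          ((trLoop ε₀ z (stepsOf p) (stepsOf q) (e, 1) -
            trLoop ε₀ z (stepsOf p) (stepsOf q) (e, -1) : ℤ) : k) else 0 := by
      intro e
      have hs : ∀ s : Step, trPath k ε₀ z (ofPath k ⟨a, b, p⟩ * path2 k x (x + pv s) x *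
          ofPath k ⟨b', c, q⟩) =
          if proj z = a.1 ∧ b.1 = x ∧ x = b'.1 then
          ((trLoop ε₀ z (stepsOf p) (stepsOf q) s : ℤ) : k) else 0 := by
        classical
        intro s
        have h := trPath_mul_path2_mul (k := k) ε₀ z p q x s s.bar
        have e0 : x + pv s + pv s.bar = x := by rw [pv_bar, add_neg_cancel_right]
        rw [e0] at h
        rw [h]
        by_cases hc : proj z = a.1 ∧ b.1 = x ∧ x = b'.1
        · have hw := proj_wend_stepsOf p hc.1
          rw [hc.2.1] at hw
          rw [if_pos hc, trLoop, hw]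
          by_cases ha : Adj x (x + pv s)
          · rw [if_pos ⟨hc.1, hc.2.1, hc.2.2, ha, ha.symm⟩, if_pos ha]
          · rw [if_neg fun h => ha h.2.2.2.1, if_neg ha, Int.cast_zero]
        · rw [if_neg hc, if_neg fun h => hc ⟨h.1, h.2.1, h.2.2.1⟩]
      rw [loopDiff, mul_sub, sub_mul, map_sub, sub_eq_add_neg x, ← pv_neg, ← pv_pos, hs, hs]
      split_ifs <;> simp
    rw [mul_sub, sub_mul, map_sub, mul_smul_comm, smul_mul_assoc, map_smul, hl, hl]
    split_ifs with hc
    · have hw := proj_wend_stepsOf p hc.1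
      rw [trLoop_star hε hz, hw, hc.2.1, Int.cast_mul, smul_eq_mul, sub_self]
    · simp

theorem trPath_relation_mul (hε : ∏ d, ε₀ d = 1) {z : Fin 3 → ℤ} (hz : Good z)
    (a b : PathAlgebra k Vertex) {r : PathAlgebra k Vertex} (hr : Relation k ε₀ r) :
    trPath k ε₀ z (a * r * b) = 0 := by
  induction a using induction_linear with
  | zero => simp
  | add a a' h h' => rw [add_mul, add_mul, map_add, h, h', add_zero]
  | smul ca p =>
  induction b using induction_linear with
  | zero => simp
  | add b b' h h' => rw [mul_add, map_add, h, h', add_zero]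
  | smul cb q =>
    obtain ⟨x, y, p⟩ := p
    obtain ⟨x', y', q⟩ := q
    rw [smul_mul_assoc, smul_mul_assoc, mul_smul_comm, map_smul, map_smul,
      trPath_relation hε hz p q hr, smul_zero, smul_zero]

/-- The trace form vanishes on the ideal of relations. -/
theorem trPath_eq_zero (hε : ∏ d, ε₀ d = 1) {z : Fin 3 → ℤ} (hz : Good z)
    {r : PathAlgebra k Vertex} (hr : r ∈ relIdeal k ε₀) : trPath k ε₀ z r = 0 := by
  let J : TwoSidedIdeal (PathAlgebra k Vertex) :=
    TwoSidedIdeal.mk' {r | ∀ a b, trPath k ε₀ z (a * r * b) = 0} (fun a b => by simp)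
      (fun {x y} hx hy a b => by rw [mul_add, add_mul, map_add, hx, hy, add_zero])
      (fun {x} hx a b => by rw [mul_neg, neg_mul, map_neg, hx, neg_zero])
      (fun {x y} hy a b => by rw [← mul_assoc, hy])
      (fun {x y} hx a b => by rw [← mul_assoc, mul_assoc _ y, hx])
  have hJ : relIdeal k ε₀ ≤ J := TwoSidedIdeal.span_le.2 fun r hr => by
    rw [SetLike.mem_coe, TwoSidedIdeal.mem_mk']
    exact fun a b => trPath_relation_mul hε hz a b hr
  have h := hJ hr
  rw [TwoSidedIdeal.mem_mk'] at h
  obtain ⟨s, hs⟩ := exists_local_unit r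
  obtain ⟨t, ht⟩ := exists_local_unit_right r
  have := h (∑ x ∈ s, vertexIdem k x) (∑ x ∈ t, vertexIdem k x)
  rwa [hs s subset_rfl, ht t subset_rfl] at this

variable (k ε₀) in
/-- The trace form at `z` as a functional on `A`. -/
def tr (hε : ∏ d, ε₀ d = 1) {z : Fin 3 → ℤ} (hz : Good z) : InfAlgebra k ε₀ →ₗ[k] k :=
  (Submodule.liftQ (LinearMap.ker (mk k ε₀)) (trPath k ε₀ z) fun _ hr =>
    LinearMap.mem_ker.2 (trPath_eq_zero hε hz ((mk_eq_zero k ε₀).1 hr))) ∘ₗ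
  ((mk k ε₀).quotKerEquivOfSurjective (mk_surjective k ε₀)).symm.toLinearMap

theorem tr_mk (hε : ∏ d, ε₀ d = 1) {z : Fin 3 → ℤ} (hz : Good z) (a : PathAlgebra k Vertex) :
    tr k ε₀ hε hz (mk k ε₀ a) = trPath k ε₀ z a := by
  have : ((mk k ε₀).quotKerEquivOfSurjective (mk_surjective k ε₀)).symm (mk k ε₀ a) =
      Submodule.Quotient.mk a := by
    rw [LinearEquiv.symm_apply_eq]; rfl
  rw [tr, LinearMap.comp_apply, LinearEquiv.coe_coe, this, Submodule.liftQ_apply]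

/-- The consecutive points along a sequence of steps are adjacent. -/
def IsPath (z : Fin 3 → ℤ) : List Step → Prop
  | [] => IsVertex (proj z)
  | s :: w => Adj (proj z) (proj z + pv s) ∧ IsPath (z + vec s) w

theorem exists_path {z : Fin 3 → ℤ} {w : List Step} (h : IsPath z w) :
    ∃ (x y : Vertex) (p : Path x y), x.1 = proj z ∧ stepsOf p = w ∧
      word k ε₀ z w = mk k ε₀ (ofPath k ⟨x, y, p⟩) := by
  induction w generalizing z with
  | nil =>
    obtain ⟨x, hx⟩ := IsVertex.exists_eq (x := proj z) h
    exact ⟨x, x, Path.nil, hx, rfl, by rw [word, E, ← hx, idemAt_of_vertex]⟩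
  | cons s w ih =>
    obtain ⟨h1, h⟩ := h
    obtain ⟨y, c, p, hy, hp, e⟩ := ih h
    rw [proj_add_vec] at hy
    obtain ⟨x, hx⟩ := h1.isVertex_left.exists_eq
    have hxy : Adj x.1 y.1 := by rwa [hx, hy]
    refine ⟨x, c, (Path.nil.cons (PLift.up hxy : x ⟶ y)).comp p, hx, ?_, ?_⟩
    · rw [stepsOf_comp, hp, stepsOf, stepsOf, hx, hy, stepTo_add]
      rfl
    · rw [word_cons, e, G, ← mk_mul, ← ofPath_mul_ofPath_of_comp, ← arrow_of_adj k hxy, hx, hy]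

theorem word_of_not_isPath {z : Fin 3 → ℤ} {w : List Step} (h : ¬ IsPath z w) :
    word k ε₀ z w = 0 := by
  induction w generalizing z with
  | nil =>
    rw [IsPath] at h
    rw [word, E, idemAt, dif_neg h, map_zero]
  | cons s w ih =>
    rw [IsPath, not_and_or] at h
    obtain h | h := h
    · rw [word_cons, G, arrow_of_not_adj k h, map_zero, zero_mul]
    · rw [word_cons, ih h, mul_zero]

theorem tr_word (hε : ∏ d, ε₀ d = 1) {z : Fin 3 → ℤ} (hz : Good z) {w : List Step}
    (h : IsPath z w) : tr k ε₀ hε hz (word k ε₀ z w) = (trWord ε₀ z w : ℤ) := by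
  obtain ⟨x, y, p, hx, rfl, e⟩ := exists_path (k := k) (ε₀ := ε₀) h
  rw [e, tr_mk, trPath_ofPath ε₀ p hx.symm]

theorem tr_word_of_length (hε : ∏ d, ε₀ d = 1) {z : Fin 3 → ℤ} (hz : Good z) {w : List Step}
    (h : w.length ≠ 4) : tr k ε₀ hε hz (word k ε₀ z w) = 0 := by
  by_cases hw : IsPath z w
  · rw [tr_word hε hz hw, trWord_of_length h, Int.cast_zero]
  · rw [word_of_not_isPath hw, map_zero]

end Rauzy

namespace Rauzy

variable {k : Type u} [Field k] {ε₀ : Fin 3 → ℤˣ}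

/-! ### Rewriting rules for words -/

/-- A point such that it, its neighbours and the far corners of the rhombi at it are surrounded by
the tiling. -/
structure Deep (y : Fin 3 → ℤ) : Prop where
  good : Good y
  good₁ : ∀ s, InX (y + vec s) → Good (y + vec s)
  good₂ : ∀ s t, Cot y s t → Good (y + vec s + vec t)

theorem word_append (z : Fin 3 → ℤ) (w w' : List Step) :
    word k ε₀ z (w ++ w') = word k ε₀ z w * word k ε₀ (wend z w) w' :=
  (word_mul_word z w w').symm

theorem word_pair_eq_zero {z : Fin 3 → ℤ} (hz : InX z) {s t : Step} (h : ¬ Cot z s t)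
    (hst : t ≠ s.bar) (Q : List Step) : word k ε₀ z (s :: t :: Q) = 0 := by
  rw [word_cons, word_cons, ← mul_assoc, G_mul_G_eq_zero hz h hst, zero_mul]

theorem word_cons_eq_zero {z : Fin 3 → ℤ} (hz : InX z) {s : Step} (h : ¬ InX (z + vec s))
    (Q : List Step) : word k ε₀ z (s :: Q) = 0 := by
  rw [word_cons, G_eq_zero hz h, zero_mul]

/-- A word either vanishes or ends at a point of `X`. -/
theorem word_eq_zero_or_inX {z : Fin 3 → ℤ} (hz : InX z) (P : List Step) :
    word k ε₀ z P = 0 ∨ InX (wend z P) := by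
  induction P generalizing z with
  | nil => exact .inr hz
  | cons s P ih =>
    by_cases h : InX (z + vec s)
    · exact (ih h).imp (fun h => by rw [word_cons, h, mul_zero]) id
    · exact .inl (word_cons_eq_zero hz h P)

theorem word_sq {z : Fin 3 → ℤ} (hz : InX z) (P : List Step) (s : Step) (Q : List Step) :
    word k ε₀ z (P ++ s :: s :: Q) = 0 := by
  rw [word_append]
  obtain h | h := word_eq_zero_or_inX (k := k) (ε₀ := ε₀) hz P
  · rw [h, zero_mul]
  · rw [word_pair_eq_zero h (fun h => h.1 rfl) (bar_ne s).symm, mul_zero]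

theorem step_rel (a b : Step) : b = a ∨ b = a.bar ∨ a.1 ≠ b.1 := by
  revert a b; decide

theorem step_rel₂ {a b : Step} (h : a.1 ≠ b.1) (c : Step) : c = a ∨ c = a.bar ∨ c = b ∨
    c = b.bar ∨ (a.1 ≠ c.1 ∧ b.1 ≠ c.1) := by
  revert a b c; decide

/-- A step with two given other axes. -/
theorem exists_third_step (a b : Step) (h : a.1 ≠ b.1) : ∃ w : Step, a.1 ≠ w.1 ∧ b.1 ≠ w.1 := by
  revert a b; decide

/-- Words of length at most two lead only to good points, where relations can be applied. -/
theorem word_eq_zero_or_good {y : Fin 3 → ℤ} (hy : Deep y) {P : List Step} (hP : P.length ≤ 2) :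
    word k ε₀ y P = 0 ∨ Good (wend y P) := by
  match P, hP with
  | [], _ => exact .inr hy.good
  | [s], _ =>
    by_cases h : InX (y + vec s)
    · exact .inr (hy.good₁ s h)
    · exact .inl (word_cons_eq_zero hy.good.inX h [])
  | [s, t], _ =>
    by_cases h : Cot y s t
    · exact .inr (hy.good₂ s t h)
    by_cases hst : t = s.bar
    · right
      rw [hst, wend, wend, wend, add_vec_bar]
      exact hy.good
    · exact .inl (word_pair_eq_zero hy.good.inX h hst [])

theorem word_swap_of {y : Fin 3 → ℤ} {P : List Step} (hP : word k ε₀ y P = 0 ∨ Good (wend y P))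
    {s t : Step} (h : s.1 ≠ t.1) (Q : List Step) :
    word k ε₀ y (P ++ s :: t :: Q) = word k ε₀ y (P ++ t :: s :: Q) := by
  rw [word_append, word_append]
  obtain h' | h' := hP
  · rw [h', zero_mul, zero_mul]
  · rw [word_cons, word_cons, ← mul_assoc (G k ε₀ _ s), G_mul_G_comm h' h, mul_assoc,
      add_right_comm]
    rfl

namespace Deep

variable {y : Fin 3 → ℤ}

theorem swap₀ (hy : Deep y) {s t : Step} (h : s.1 ≠ t.1) (Q : List Step) :
    word k ε₀ y (s :: t :: Q) = word k ε₀ y (t :: s :: Q) :=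
  word_swap_of (P := []) (.inr hy.good) h Q

theorem swap₁ (hy : Deep y) (p : Step) {s t : Step} (h : s.1 ≠ t.1) (Q : List Step) :
    word k ε₀ y (p :: s :: t :: Q) = word k ε₀ y (p :: t :: s :: Q) :=
  word_swap_of (P := [p]) (word_eq_zero_or_good hy (by simp)) h Q

theorem swap₂ (hy : Deep y) (p q : Step) {s t : Step} (h : s.1 ≠ t.1) (Q : List Step) :
    word k ε₀ y (p :: q :: s :: t :: Q) = word k ε₀ y (p :: q :: t :: s :: Q) :=
  word_swap_of (P := [p, q]) (word_eq_zero_or_good hy (by simp)) h Q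

/-- Steps may also be exchanged after one step and a closed path `q q̄`. -/
theorem swap_after_detour (hy : Deep y) (p q : Step) {s t : Step} (h : s.1 ≠ t.1) (Q : List Step) :
    word k ε₀ y (p :: q :: q.bar :: s :: t :: Q) =
      word k ε₀ y (p :: q :: q.bar :: t :: s :: Q) := by
  refine word_swap_of (P := [p, q, q.bar]) ?_ h Q
  by_cases hp : InX (y + vec p)
  · right
    rw [wend, wend, wend, wend, add_vec_bar]
    exact hy.good₁ p hp
  · exact .inl (word_cons_eq_zero hy.good.inX hp _)

/-- Steps may also be exchanged after a closed path `p p̄` and one more step. -/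
theorem swap_after_loop (hy : Deep y) (p q : Step) {s t : Step} (h : s.1 ≠ t.1) (Q : List Step) :
    word k ε₀ y (p :: p.bar :: q :: s :: t :: Q) =
      word k ε₀ y (p :: p.bar :: q :: t :: s :: Q) := by
  refine word_swap_of (P := [p, p.bar, q]) ?_ h Q
  rw [wend, wend, wend, wend, add_vec_bar]
  by_cases hp : InX (y + vec q)
  · exact .inr (hy.good₁ q hp)
  · left
    rw [show [p, p.bar, q] = [p, p.bar] ++ [q] from rfl, word_append]
    rw [wend, wend, wend, add_vec_bar, word_cons_eq_zero hy.good.inX hp, mul_zero]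

theorem sq (hy : Deep y) (P : List Step) (s : Step) (Q : List Step) :
    word k ε₀ y (P ++ s :: s :: Q) = 0 :=
  word_sq hy.good.inX P s Q

theorem cube (hy : Deep y) {s t u : Step} (hst : s.1 ≠ t.1) (hsu : s.1 ≠ u.1) (htu : t.1 ≠ u.1)
    (Q : List Step) : word k ε₀ y (s :: t :: u :: Q) = 0 := by
  rw [word_cons, word_cons, word_cons, ← mul_assoc, ← mul_assoc, mul_assoc (G k ε₀ y s),
    cube_eq_zero hy.good hy.good₁ hst hsu htu, zero_mul]

/-- The star relation in the middle of a word, inside a subspace. -/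
theorem star (hy : Deep y) {P : List Step} (hP : P.length ≤ 2) {s u : Step} (h : s.1 ≠ u.1)
    {Q : List Step} {S : Submodule k (InfAlgebra k ε₀)}
    (h1 : word k ε₀ y (P ++ s.bar :: s :: Q) ∈ S)
    (h2 : word k ε₀ y (P ++ u :: u.bar :: Q) ∈ S) (h3 : word k ε₀ y (P ++ u.bar :: u :: Q) ∈ S) :
    word k ε₀ y (P ++ s :: s.bar :: Q) ∈ S := by
  obtain h0 | h0 := word_eq_zero_or_good (k := k) (ε₀ := ε₀) hy hP
  · rw [word_append, h0, zero_mul]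
    exact S.zero_mem
  have key : ∀ t : Step, word k ε₀ y (P ++ t :: t.bar :: Q) =
      word k ε₀ y P * loop (wend y P) t * word k ε₀ (wend y P) Q := by
    intro t
    rw [word_append, word_cons, word_cons, add_vec_bar, loop, mul_assoc, mul_assoc]
  have key' : ∀ t : Step, word k ε₀ y (P ++ t.bar :: t :: Q) =
      word k ε₀ y P * loop (wend y P) t.bar * word k ε₀ (wend y P) Q := by
    intro t
    rw [← key, Step.bar_bar]
  rw [key] at h2 ⊢
  rw [key'] at h1 h3
  exact loop_mem h0.isVertex h h1 h2 h3

/-- A path `t u ū` can only be continued by `t̄`. -/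
theorem word_four_eq_zero (hy : Deep y) {t u v : Step} (h : t.1 ≠ u.1) (hv : v ≠ t.bar)
    (Q : List Step) : word k ε₀ y (t :: u :: u.bar :: v :: Q) = 0 := by
  have hb : u.bar.1 = u.1 := rfl
  rcases step_rel₂ h v with rfl | rfl | rfl | rfl | ⟨h1, h2⟩
  · rw [hy.swap₂ _ _ (s := u.bar) h.symm, hy.swap₁ _ h.symm]
    exact hy.sq [] _ _
  · exact absurd rfl hv
  · obtain ⟨w, hw1, hw2⟩ := exists_third_step t v h
    have := hy.star (k := k) (ε₀ := ε₀) (P := [t, v]) le_rfl (s := v.bar) (u := w) (Q := Q)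
      (S := ⊥) hw2
    simp only [Step.bar_bar, List.cons_append, List.nil_append, Submodule.mem_bot] at this
    exact this (hy.sq [t] _ _) (hy.cube h hw1 hw2 _) (hy.cube (u := w.bar) h hw1 hw2 _)
  · exact hy.sq [t, u] _ _
  · rw [hy.swap₂ t u (s := u.bar) h2]
    exact hy.cube h h1 h2 _

/-- A closed path `s s̄` followed by steps along the two other axes is zero. -/
theorem word_loop_eq_zero (hy : Deep y) {a c d : Step} (h : a.1 ≠ c.1) (h' : a.1 ≠ d.1)
    (h'' : c.1 ≠ d.1) (Q : List Step) : word k ε₀ y (a :: a.bar :: c :: d :: Q) = 0 := by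
  rw [hy.swap₁ a (s := a.bar) h, hy.swap₂ a c (s := a.bar) h']
  exact hy.cube h h' h'' _

/-- A closed path along two different axes can be reordered. -/
theorem loops_comm (hy : Deep y) {a b : Step} (h : a.1 ≠ b.1) (Q : List Step) :
    word k ε₀ y (a :: b :: b.bar :: a.bar :: Q) = word k ε₀ y (a :: a.bar :: b :: b.bar :: Q) := by
  rw [hy.swap₂ a b (s := b.bar) (t := a.bar) h.symm, hy.swap₁ a (s := b) (t := a.bar) h.symm]

theorem loops_symm (hy : Deep y) {a b : Step} (h : a.1 ≠ b.1) (Q : List Step) :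
    word k ε₀ y (a :: a.bar :: b :: b.bar :: Q) = word k ε₀ y (b :: b.bar :: a :: a.bar :: Q) := by
  rw [← hy.loops_comm h, hy.swap₂ a b (s := b.bar) (t := a.bar) h.symm, hy.swap₀ h,
    hy.loops_comm h.symm]

theorem loops_append_eq_zero (hy : Deep y) {a b : Step} (h : a.1 ≠ b.1) (e : Step) (Q : List Step) :
    word k ε₀ y (a :: a.bar :: b :: b.bar :: e :: Q) = 0 := by
  have h1 : ∀ {a b : Step}, a.1 ≠ b.1 → word k ε₀ y (a :: a.bar :: b :: b.bar :: a :: Q) = 0 := by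
    intro a b h
    rw [hy.loops_symm h, ← hy.loops_comm h.symm, hy.swap_after_detour b a (s := b.bar) h.symm,
      hy.word_four_eq_zero h.symm (ne_bar_of_ne h.symm)]
  rcases step_rel₂ h e with rfl | rfl | rfl | rfl | ⟨h3, h4⟩
  · exact h1 h
  · rw [hy.loops_symm h]
    exact hy.sq [b, b.bar, a] _ _
  · rw [hy.loops_symm h]
    exact h1 h.symm
  · exact hy.sq [a, a.bar, b] _ _
  · rw [hy.swap_after_loop a b (s := b.bar) h4, hy.word_loop_eq_zero h h3 h4]

/-- Words of length five vanish. Up to commutation, the first three steps contain a loop, a repeated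
step or three different axes; a loop can be moved along the word until one of the preceding
vanishing rules applies. -/
theorem word_five_eq_zero (hy : Deep y) (a b c d e : Step) (Q : List Step) :
    word k ε₀ y (a :: b :: c :: d :: e :: Q) = 0 := by
  -- closed paths `b b̄` after the first step
  have h1 : ∀ {a b : Step} (d e : Step), a.1 ≠ b.1 →
      word k ε₀ y (a :: b :: b.bar :: d :: e :: Q) = 0 := by
    intro a b d e h
    by_cases hd : d = a.bar
    · rw [hd, hy.loops_comm h]
      exact hy.loops_append_eq_zero h e Q
    · exact hy.word_four_eq_zero h hd _
  have h2 : ∀ (a d e : Step), word k ε₀ y (a :: a.bar :: a :: d :: e :: Q) = 0 := by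
    intro a d e
    obtain ⟨w, hw, -⟩ := exists_third_step a (a.1 + 1, 1) (by simp)
    have := hy.star (k := k) (ε₀ := ε₀) (P := [a]) (by simp) (s := a.bar) (u := w)
      (Q := d :: e :: Q) (S := ⊥) hw
    simp only [Step.bar_bar, List.cons_append, List.nil_append, Submodule.mem_bot] at this
    refine this (hy.sq [] _ _) (h1 d e hw) ?_
    have := h1 (a := a) (b := w.bar) d e hw
    rwa [Step.bar_bar] at this
  have h3 : ∀ (a c d e : Step), a.1 ≠ c.1 → word k ε₀ y (a :: a.bar :: c :: d :: e :: Q) = 0 := by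
    intro a c d e h
    rcases step_rel₂ h d with rfl | rfl | rfl | rfl | ⟨h3, h4⟩
    · rw [hy.swap₂ d d.bar h.symm, h2]
    · rw [hy.swap₂ a a.bar (t := a.bar) h.symm]
      exact hy.sq [a] _ _
    · exact hy.sq [a, a.bar] _ _
    · exact hy.loops_append_eq_zero h e Q
    · exact hy.word_loop_eq_zero h h3 h4 _
  rcases step_rel a b with rfl | rfl | h
  · exact hy.sq [] _ _
  · rcases step_rel a c with rfl | rfl | h
    · exact h2 c d e
    · exact hy.sq [a] _ _
    · exact h3 a c d e h
  · rcases step_rel₂ h c with rfl | rfl | rfl | rfl | ⟨h4, h5⟩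
    · rw [hy.swap₁ c h.symm]
      exact hy.sq [] _ _
    · rw [hy.swap₁ a (t := a.bar) h.symm]
      exact h3 a b d e h
    · exact hy.sq [a] _ _
    · exact h1 d e h
    · exact hy.cube h h4 h5 _

/-- The words at `y` are combinations of normal forms. -/
theorem word_mem (hy : Deep y) {W : Submodule k (InfAlgebra k ε₀)} (h0 : word k ε₀ y [] ∈ W)
    (h1 : ∀ s, word k ε₀ y [s] ∈ W) (h2 : ∀ s t, s.1 ≠ t.1 → word k ε₀ y [s, t] ∈ W)
    (h2' : ∀ s, word k ε₀ y [s, s.bar] ∈ W)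
    (h3 : ∀ t u, t.1 ≠ u.1 → word k ε₀ y [t, u, u.bar] ∈ W)
    (h4 : ∀ t u, t.1 ≠ u.1 → word k ε₀ y [t, t.bar, u, u.bar] ∈ W) (w : List Step) :
    word k ε₀ y w ∈ W := by
  have z : ∀ {x : InfAlgebra k ε₀}, x = 0 → x ∈ W := fun h => h ▸ W.zero_mem
  have h3' : ∀ t u, t.1 ≠ u.1 → word k ε₀ y [t, t.bar, u] ∈ W := fun t u h => by
    rw [hy.swap₁ t (s := t.bar) h, hy.swap₀ h]
    exact h3 u t h.symm
  have s3 : ∀ a Q, (∀ u, a.1 ≠ u.1 → word k ε₀ y (a :: u :: u.bar :: Q) ∈ W) →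
      word k ε₀ y (a :: a.bar :: a :: Q) ∈ W := by
    intro a Q h
    obtain ⟨w, hw, -⟩ := exists_third_step a (a.1 + 1, 1) (by simp)
    have := hy.star (k := k) (ε₀ := ε₀) (P := [a]) (by simp) (s := a.bar) (u := w) (Q := Q)
      (S := W) hw
    simp only [Step.bar_bar, List.cons_append, List.nil_append] at this
    refine this (z (hy.sq [] _ _)) (h w hw) ?_
    have := h w.bar hw
    rwa [Step.bar_bar] at this
  have h4' : ∀ t u d, t.1 ≠ u.1 → word k ε₀ y [t, u, u.bar, d] ∈ W := fun t u d h => by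
    by_cases hd : d = t.bar
    · rw [hd, hy.loops_comm h]
      exact h4 t u h
    · exact z (hy.word_four_eq_zero h hd _)
  have h4'' : ∀ a c d, a.1 ≠ c.1 → word k ε₀ y [a, a.bar, c, d] ∈ W := fun a c d h => by
    rcases step_rel₂ h d with rfl | rfl | rfl | rfl | ⟨h3, h4⟩
    · rw [hy.swap₂ d d.bar h.symm]
      exact s3 d [c] fun u h => h4' d u c h
    · rw [hy.swap₂ a a.bar (t := a.bar) h.symm]
      exact z (hy.sq [a] _ _)
    · exact z (hy.sq [a, a.bar] _ _)
    · exact h4 a c h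
    · exact z (hy.word_loop_eq_zero h h3 h4 _)
  match w with
  | [] => exact h0
  | [s] => exact h1 s
  | [s, t] =>
    rcases step_rel s t with rfl | rfl | h
    · exact z (hy.sq [] _ _)
    · exact h2' s
    · exact h2 s t h
  | [a, b, c] =>
    rcases step_rel a b with rfl | rfl | h
    · exact z (hy.sq [] _ _)
    · rcases step_rel a c with rfl | rfl | h
      · exact s3 c [] (h3 c)
      · exact z (hy.sq [a] _ _)
      · exact h3' a c h
    · rcases step_rel₂ h c with rfl | rfl | rfl | rfl | ⟨h4, h5⟩
      · rw [hy.swap₁ c h.symm]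
        exact z (hy.sq [] _ _)
      · rw [hy.swap₁ a (t := a.bar) h.symm]
        exact h3' a b h
      · exact z (hy.sq [a] _ _)
      · exact h3 a b h
      · exact z (hy.cube h h4 h5 _)
  | [a, b, c, d] =>
    rcases step_rel a b with rfl | rfl | h
    · exact z (hy.sq [] _ _)
    · rcases step_rel a c with rfl | rfl | h
      · exact s3 c [d] fun u h => h4' c u d h
      · exact z (hy.sq [a] _ _)
      · exact h4'' a c d h
    · rcases step_rel₂ h c with rfl | rfl | rfl | rfl | ⟨h4, h5⟩
      · rw [hy.swap₁ c h.symm]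
        exact z (hy.sq [] _ _)
      · rw [hy.swap₁ a (t := a.bar) h.symm]
        exact h4'' a b d h
      · exact z (hy.sq [a] _ _)
      · exact h4' a b d h
      · exact z (hy.cube h h4 h5 _)
  | a :: b :: c :: d :: e :: Q =>
    exact z (hy.word_five_eq_zero a b c d e Q)

end Deep

end Rauzy

namespace Rauzy

open PathAlgebra

variable {k : Type u} [Field k] {ε₀ : Fin 3 → ℤˣ}

/-! ### Spanning sets and dual words -/

theorem G_congr {z z' : Fin 3 → ℤ} (h : proj z = proj z') (s : Step) :
    G k ε₀ z s = G k ε₀ z' s := by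
  rw [G, G, h]

theorem word_congr {z z' : Fin 3 → ℤ} (h : proj z = proj z') (w : List Step) :
    word k ε₀ z w = word k ε₀ z' w := by
  induction w generalizing z z' with
  | nil => rw [word, word, E, E, h]
  | cons s w ih =>
    rw [word_cons, word_cons, G_congr h,
      ih (z := z + vec s) (z' := z' + vec s) (by rw [proj_add_vec, proj_add_vec, h])]

theorem word_stepsOf {z : Fin 3 → ℤ} {x y : Vertex} (p : Path x y) (h : proj z = x.1) :
    word k ε₀ z (stepsOf p) = mk k ε₀ (ofPath k ⟨x, y, p⟩) := by
  induction p with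
  | nil => rw [stepsOf, word, E, h, idemAt_of_vertex]
  | cons p a ih =>
    rename_i b c
    have hb := proj_wend_stepsOf p h
    obtain ⟨s, hs⟩ := a.down.exists_step
    rw [stepsOf, ← word_mul_G, ih, G, hb, hs, stepTo_add, ← hs, arrow_of_adj k a.down, ← mk_mul,
      ofPath_mul_ofPath_of_comp]
    rfl

/-- The right ideal of a vertex is spanned by the words. -/
theorem E_mul_mem {z : Fin 3 → ℤ} {W : Submodule k (InfAlgebra k ε₀)}
    (h : ∀ w, word k ε₀ z w ∈ W) (x : InfAlgebra k ε₀) : E k ε₀ z * x ∈ W := by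
  have hx : x ∈ Submodule.span k (Set.range fun p : QPath Vertex => mk k ε₀ (ofPath k p)) := by
    rw [span_range_mk_ofPath]; trivial
  induction hx using Submodule.span_induction with
  | mem x hx =>
    obtain ⟨⟨a, b, p⟩, rfl⟩ := hx
    by_cases hz : proj z = a.1
    · dsimp only
      rw [← word_stepsOf p hz, E_mul_word]
      exact h _
    · have : E k ε₀ z * mk k ε₀ (ofPath k ⟨a, b, p⟩) = 0 := by
        rw [E, ← mk_mul]
        by_cases hv : IsVertex (proj z)
        · obtain ⟨v, hv⟩ := hv.exists_eq
          rw [← hv, idemAt_of_vertex, ofPath_mul_ofPath_of_ne, map_zero]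
          exact fun e => hz (by rw [← hv]; exact congrArg Subtype.val e)
        · rw [idemAt, dif_neg hv, zero_mul, map_zero]
      rw [this]
      exact W.zero_mem
  | zero => rw [mul_zero]; exact W.zero_mem
  | add x y _ _ hx hy => rw [mul_add]; exact W.add_mem hx hy
  | smul c x _ hx => rw [mul_smul_comm]; exact W.smul_mem c hx

/-- A coefficient of a linear relation between words at `z` vanishes if its word can be continued
to a word of trace `±1`, such that all the other products with that continuation have trace
zero. -/
theorem coeff_eq_zero (hε : ∏ d, ε₀ d = 1) {z : Fin 3 → ℤ} (hz : Good z) {n : ℕ}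
    {F : Fin n → List Step} {c : Fin n → k} (h : ∑ i, c i • word k ε₀ z (F i) = 0) (j : Fin n)
    (W : List Step) (hd : IsPath z (F j ++ W) ∧
      (trWord ε₀ z (F j ++ W) = 1 ∨ trWord ε₀ z (F j ++ W) = -1))
    (ho : ∀ i, i ≠ j → (F i).length + W.length ≠ 4 ∨
      ((F i).map pv).sum ≠ ((F j).map pv).sum ∨ trWord ε₀ z (F i ++ W) = 0 ∨
      c i • word k ε₀ z (F i) = 0) : c j = 0 := by
  have h1 := congrArg (fun x => tr k ε₀ hε hz (x * word k ε₀ (wend z (F j)) W)) h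
  simp only [zero_mul, map_zero, Finset.sum_mul, map_sum] at h1
  rw [Finset.sum_eq_single j] at h1
  · rw [smul_mul_assoc, map_smul, word_mul_word, tr_word hε hz hd.1] at h1
    rcases hd.2 with h2 | h2 <;> rw [h2] at h1 <;> simpa using h1
  · intro i _ hij
    by_cases he : proj (wend z (F i)) = proj (wend z (F j))
    · rw [← word_congr he, smul_mul_assoc, word_mul_word, map_smul]
      rcases ho i hij with h2 | h2 | h2 | h2
      · rw [tr_word_of_length hε hz (by rwa [List.length_append]), smul_zero]
      · rw [proj_wend, proj_wend] at he
        exact absurd (add_left_cancel he) h2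
      · by_cases hw : IsPath z (F i ++ W)
        · rw [tr_word hε hz hw, h2, Int.cast_zero, smul_zero]
        · rw [word_of_not_isPath hw, map_zero, smul_zero]
      · rw [← map_smul, word_append, ← smul_mul_assoc, h2, zero_mul, map_zero]
    · rw [smul_mul_assoc, word_mul_word_of_ne he, smul_zero, map_zero]
  · exact fun h => absurd (Finset.mem_univ j) h

theorem IsPath.nil {z : Fin 3 → ℤ} (hz : Good z) : IsPath z [] := hz.isVertex

theorem IsPath.cons {z : Fin 3 → ℤ} (hz : Good z) {s : Step} (h : InX (z + vec s)) {w : List Step}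
    (hw : IsPath (z + vec s) w) : IsPath z (s :: w) := ⟨hz.adj h, hw⟩

/-- The closed paths along the sides of a rhombus at `z` have trace `±1`. -/
theorem trace_rhombus {z : Fin 3 → ℤ} {s t : Step} (h : Cot z s t) (hz : Good z)
    (hs : Good (z + vec s)) (ht : Good (z + vec t)) (hst : Good (z + vec s + vec t)) :
    (IsPath z [s, s.bar, t, t.bar] ∧
      (trWord ε₀ z [s, s.bar, t, t.bar] = 1 ∨ trWord ε₀ z [s, s.bar, t, t.bar] = -1)) ∧
    (IsPath z [s, t, t.bar, s.bar] ∧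
      (trWord ε₀ z [s, t, t.bar, s.bar] = 1 ∨ trWord ε₀ z [s, t, t.bar, s.bar] = -1)) ∧
    (IsPath z [s, t, s.bar, t.bar] ∧
      (trWord ε₀ z [s, t, s.bar, t.bar] = 1 ∨ trWord ε₀ z [s, t, s.bar, t.bar] = -1)) := by
  have h1 : t ≠ s.bar := ne_bar_of_ne h.1
  have h2 : t ≠ s := fun e => h.1 (by rw [e])
  have hf := form_of_cot ε₀ h
  have e1 := add_vec_bar z s
  have e2 := add_vec_bar z t
  have e3 := add_vec_bar (z + vec s) t
  have e4 : z + vec s + vec t + vec s.bar = z + vec t := by rw [vec_bar]; abel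
  refine ⟨⟨?_, ?_⟩, ⟨?_, ?_⟩, ?_, ?_⟩
  · refine .cons hz h.2.1 (.cons hs ?_ ?_) <;> rw [e1]
    · exact hz.inX
    · refine .cons hz h.2.2.1 (.cons ht ?_ ?_) <;> rw [e2]
      exacts [hz.inX, .nil hz]
  · simpa only [trWord_four, if_true] using hf
  · refine .cons hz h.2.1 (.cons hs h.2.2.2 (.cons hst ?_ ?_)) <;> rw [e3]
    · exact hs.inX
    · refine .cons hs ?_ ?_ <;> rw [e1]
      exacts [hz.inX, .nil hz]
  · rw [trWord_four, if_neg h1, if_neg h2, if_pos (.inr ⟨rfl, rfl⟩)]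
    exact hf
  · refine .cons hz h.2.1 (.cons hs h.2.2.2 (.cons hst ?_ ?_)) <;> rw [e4]
    · exact ht.inX
    · refine .cons ht ?_ ?_ <;> rw [e2]
      exacts [hz.inX, .nil hz]
  · rw [trWord_four, if_neg h1, if_neg h2, if_pos (.inl ⟨rfl, rfl⟩)]
    exact hf

/-! ### Exactness at a vertex after a vertex -/

/-- The right ideal generated by an arrow. -/
def arrowIdeal (y : Fin 3 → ℤ) (s : Step) : Submodule k (InfAlgebra k ε₀) :=
  LinearMap.range (LinearMap.mulLeft k (G k ε₀ y s))

theorem word_mem_arrowIdeal (y : Fin 3 → ℤ) (s : Step) (Q : List Step) :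
    word k ε₀ y (s :: Q) ∈ arrowIdeal y s := ⟨_, rfl⟩

theorem step_six {l u w : Step} (h : l.1 ≠ u.1) (h1 : l.1 ≠ w.1) (h2 : u.1 ≠ w.1) (s : Step) :
    s = l ∨ s = l.bar ∨ s = u ∨ s = u.bar ∨ s = w ∨ s = w.bar := by
  have key : ∀ a b c d : Fin 3, a ≠ b → a ≠ c → b ≠ c → d = a ∨ d = b ∨ d = c := by decide
  rcases key _ _ _ s.1 h h1 h2 with h | h | h <;> rcases eq_or_eq_bar h with h | h <;> simp [h]

/-- Representatives of the words at a vertex modulo the right ideals generated by `l̄`, `w`, `w̄`,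
where `w` is along the third axis. -/
def listArrow (l u : Step) : Fin 8 → List Step :=
  ![[], [l], [u], [u.bar], [l, u], [l, u.bar], [u, u.bar], [l, u, u.bar]]

/-- Since `l̄`, `w` and `w̄` can be moved to the front of a word, only words in
`l` and `u` remain. -/
theorem span_listArrow {y : Fin 3 → ℤ} (hy : Deep y) {l u w : Step} (h : l.1 ≠ u.1) (h1 : l.1 ≠ w.1)
    (h2 : u.1 ≠ w.1) (p : List Step) : word k ε₀ y p ∈
      Submodule.span k (Set.range fun i => word k ε₀ y (listArrow l u i)) ⊔
        (arrowIdeal y l.bar ⊔ (arrowIdeal y w ⊔ arrowIdeal y w.bar)) := by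
  set W := Submodule.span k (Set.range fun i => word k ε₀ y (listArrow l u i)) ⊔
        (arrowIdeal y l.bar ⊔ (arrowIdeal y w ⊔ arrowIdeal y w.bar)) with hW
  have hF : ∀ i, word k ε₀ y (listArrow l u i) ∈ W := fun i =>
    Submodule.mem_sup_left (Submodule.subset_span ⟨i, rfl⟩)
  have a1 : ∀ Q, word k ε₀ y (l.bar :: Q) ∈ W := fun Q =>
    Submodule.mem_sup_right (Submodule.mem_sup_left (word_mem_arrowIdeal _ _ _))
  have a2 : ∀ Q, word k ε₀ y (w :: Q) ∈ W := fun Q => Submodule.mem_sup_right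
    (Submodule.mem_sup_right (Submodule.mem_sup_left (word_mem_arrowIdeal _ _ _)))
  have a3 : ∀ Q, word k ε₀ y (w.bar :: Q) ∈ W := fun Q => Submodule.mem_sup_right
    (Submodule.mem_sup_right (Submodule.mem_sup_right (word_mem_arrowIdeal _ _ _)))
  clear_value W
  -- a detour along the third axis or backwards along `l` stays in the ideal
  have d : ∀ {t s : Step} (Q), t.1 ≠ s.1 → (∀ Q, word k ε₀ y (s :: Q) ∈ W) →
      word k ε₀ y (t :: s :: Q) ∈ W := fun Q h h' => by
    rw [hy.swap₀ h]; exact h' _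
  have ll : ∀ Q, word k ε₀ y (l :: l.bar :: Q) ∈ W := fun Q =>
    hy.star (P := []) (by simp) h1 (a1 _) (a2 _) (a3 _)
  have f := hF
  have f0 := hF 0
  have f1 := hF 1
  have f2 := hF 2
  have f3 := hF 3
  have f4 := hF 4
  have f5 := hF 5
  have f6 := hF 6
  have f7 := hF 7
  simp only [listArrow, Matrix.cons_val] at f0 f1 f2 f3 f4 f5 f6 f7
  have bb : ∀ s : Step, s.bar.1 = s.1 := fun _ => rfl
  have uu' : word k ε₀ y [u.bar, u] ∈ W := by
    have := hy.star (k := k) (ε₀ := ε₀) (P := []) (by simp) (s := u.bar) (u := w) (Q := [])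
      (S := W) h2
    rw [Step.bar_bar] at this
    exact this f6 (a2 _) (a3 _)
  have luu : word k ε₀ y [l, u.bar, u] ∈ W := by
    have := hy.star (k := k) (ε₀ := ε₀) (P := [l]) (by simp) (s := u.bar) (u := w) (Q := [])
      (S := W) h2
    rw [Step.bar_bar] at this
    exact this f7 (d _ h1 a2) (d _ h1 a3)
  have ull : ∀ s : Step, l.1 ≠ s.1 → word k ε₀ y [s, l, l.bar] ∈ W := fun s hs => by
    rw [hy.swap₀ hs.symm, hy.swap₁ l (t := l.bar) hs.symm]
    exact ll _
  have lluu : ∀ s : Step, l.1 ≠ s.1 → word k ε₀ y [s, s.bar, l, l.bar] ∈ W := fun s hs => by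
    rw [hy.loops_symm hs.symm]
    exact ll _
  refine hy.word_mem f0 (fun s => ?_) (fun s t hst => ?_) (fun s => ?_) (fun t u' htu => ?_)
    (fun t u' htu => ?_) p
  · rcases step_six h h1 h2 s with rfl | rfl | rfl | rfl | rfl | rfl
    exacts [f1, a1 _, f2, f3, a2 _, a3 _]
  · rcases step_six h h1 h2 s with rfl | rfl | rfl | rfl | rfl | rfl
    · rcases step_six h h1 h2 t with rfl | rfl | rfl | rfl | rfl | rfl
      exacts [absurd rfl hst, ll _, f4, f5, d _ h1 a2, d _ h1 a3]
    · exact a1 _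
    · rcases step_six h h1 h2 t with rfl | rfl | rfl | rfl | rfl | rfl
      exacts [by rw [hy.swap₀ hst]; exact f4, d _ hst a1, absurd rfl hst, absurd rfl hst,
        d _ hst a2, d _ hst a3]
    · rcases step_six h h1 h2 t with rfl | rfl | rfl | rfl | rfl | rfl
      exacts [by rw [hy.swap₀ hst]; exact f5, d _ hst a1, absurd rfl hst, absurd rfl hst,
        d _ hst a2, d _ hst a3]
    · exact a2 _
    · exact a3 _
  · rcases step_six h h1 h2 s with rfl | rfl | rfl | rfl | rfl | rfl
    exacts [ll _, a1 _, f6, by rw [Step.bar_bar]; exact uu', a2 _, a3 _]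
  · rcases step_six h h1 h2 t with rfl | rfl | rfl | rfl | rfl | rfl
    · rcases step_six h h1 h2 u' with rfl | rfl | rfl | rfl | rfl | rfl
      exacts [absurd rfl htu, absurd rfl htu, f7, by rw [Step.bar_bar]; exact luu, d _ h1 a2,
        d _ h1 a3]
    · exact a1 _
    · rcases step_six h h1 h2 u' with rfl | rfl | rfl | rfl | rfl | rfl
      exacts [ull _ h, d _ htu a1, absurd rfl htu, absurd rfl htu, d _ htu a2, d _ htu a3]
    · rcases step_six h h1 h2 u' with rfl | rfl | rfl | rfl | rfl | rfl
      exacts [ull _ h, d _ htu a1, absurd rfl htu, absurd rfl htu, d _ htu a2, d _ htu a3]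
    · exact a2 _
    · exact a3 _
  · rcases step_six h h1 h2 t with rfl | rfl | rfl | rfl | rfl | rfl
    · exact ll _
    · exact a1 _
    · rcases step_six h h1 h2 u' with rfl | rfl | rfl | rfl | rfl | rfl
      exacts [lluu _ h, by rw [hy.loops_symm htu]; exact a1 _, absurd rfl htu, absurd rfl htu,
        by rw [hy.loops_symm htu]; exact a2 _, by rw [hy.loops_symm htu]; exact a3 _]
    · rcases step_six h h1 h2 u' with rfl | rfl | rfl | rfl | rfl | rfl
      exacts [lluu _ h, by rw [hy.loops_symm htu]; exact a1 _, absurd rfl htu, absurd rfl htu,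
        by rw [hy.loops_symm htu]; exact a2 _, by rw [hy.loops_symm htu]; exact a3 _]
    · exact a2 _
    · exact a3 _

theorem Cot.unshift {y : Fin 3 → ℤ} {l v : Step} (h : InX (y + vec l))
    (hc : Cot (y + vec l) l.bar v) : Cot y l v := by
  have := hc.shift h
  rwa [add_vec_bar, Step.bar_bar] at this

/-- A step with rhombi on both sides of one axis has no rhombi along the other axis. -/
theorem not_cot_of_cot {y : Fin 3 → ℤ} {l u w : Step} (hu : Cot y l u) (hu' : Cot y l u.bar)
    (h1 : l.1 ≠ w.1) (h2 : u.1 ≠ w.1) : ¬ Cot y l w := by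
  rintro ⟨-, -, hw1, hw2⟩
  obtain ⟨h, hl, ha, hb⟩ := hu
  obtain ⟨-, -, ha', hb'⟩ := hu'
  have hs := sum_hgt h h1.symm h2.symm
  have p1 := hgt_pos l.1
  have p2 := hgt_pos u.1
  have p3 := hgt_pos w.1
  obtain ⟨a, e⟩ := l
  obtain ⟨b, e'⟩ := u
  obtain ⟨c, e''⟩ := w
  simp only [InX, ht_add, ht_vec, hs, Step.bar] at *
  rcases Int.units_eq_one_or e with rfl | rfl <;> rcases Int.units_eq_one_or e' with rfl | rfl <;>
    rcases Int.units_eq_one_or e'' with rfl | rfl <;> simp at * <;> linarith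

/-- Without a rhombus between `l` and `v`, the path along `l̄` and `v` is zero. -/
theorem arrow_mul_arrow_eq_zero {y : Fin 3 → ℤ} (hl : InX (y + vec l)) {v : Step}
    (h : ¬ Cot y l v) (hv : v ≠ l) (a : InfAlgebra k ε₀) :
    G k ε₀ (y + vec l) l.bar * (G k ε₀ y v * a) = 0 := by
  have := G_mul_G_eq_zero (k := k) (ε₀ := ε₀) hl (s := l.bar) (t := v)
    (fun hc => h (hc.unshift hl)) (by rwa [Step.bar_bar])
  rw [add_vec_bar] at this
  rw [← mul_assoc, this, zero_mul]

theorem arrow_mul_word {y : Fin 3 → ℤ} (l : Step) (p : List Step) :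
    G k ε₀ (y + vec l) l.bar * word k ε₀ y p = word k ε₀ (y + vec l) (l.bar :: p) := by
  rw [word_cons, add_vec_bar]

/-- If the arrow `l` lies in two rhombi at `y`, with sides `u` and `ū`, then the elements of `e_y A`
killed by `l̄` from the left lie in the right ideal of the arrows along `l̄` and along the third
axis. The words that represent the other elements stay independent after multiplication by `l̄`,
as their continuations to closed paths around rhombi show. -/
theorem exact_arrow (hε : ∏ d, ε₀ d = 1) {y : Fin 3 → ℤ} (hy : Deep y) {l u w : Step}
    (hu : Cot y l u) (hu' : Cot y l u.bar) (h1 : l.1 ≠ w.1) (h2 : u.1 ≠ w.1) {x : InfAlgebra k ε₀}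
    (hx : E k ε₀ y * x = x) (h : G k ε₀ (y + vec l) l.bar * x = 0) :
    x ∈ (arrowIdeal y l.bar ⊔ (arrowIdeal y w ⊔ arrowIdeal y w.bar) :
      Submodule k (InfAlgebra k ε₀)) := by
  have hm := E_mul_mem (span_listArrow (k := k) (ε₀ := ε₀) hy hu.1 h1 h2) x
  rw [hx] at hm
  obtain ⟨q, hq, s, hs, rfl⟩ := Submodule.mem_sup.1 hm
  obtain ⟨c, rfl⟩ := (Submodule.mem_span_range_iff_exists_fun k).1 hq
  have hs0 : G k ε₀ (y + vec l) l.bar * s = 0 := by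
    obtain ⟨s1, ⟨a1, rfl⟩, s', hs', rfl⟩ := Submodule.mem_sup.1 hs
    obtain ⟨s2, ⟨a2, rfl⟩, s3, ⟨a3, rfl⟩, rfl⟩ := Submodule.mem_sup.1 hs'
    rw [mul_add, mul_add]
    simp only [LinearMap.mulLeft_apply]
    have hw : ∀ w : Step, l.1 ≠ w.1 → w ≠ l := fun w h e => h (by rw [e])
    rw [arrow_mul_arrow_eq_zero hu.2.1 (v := l.bar) (fun h => h.1 rfl) (bar_ne l),
      arrow_mul_arrow_eq_zero hu.2.1 (not_cot_of_cot hu hu' h1 h2) (hw _ h1),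
      arrow_mul_arrow_eq_zero hu.2.1
        (not_cot_of_cot (w := w.bar) hu hu' h1 h2) (hw w.bar h1), add_zero, add_zero]
  rw [mul_add, hs0, add_zero, Finset.mul_sum] at h
  simp only [mul_smul_comm, arrow_mul_word] at h
  have gl := hy.good₁ l hu.2.1
  have ho : ∀ l u : Step, l.1 ≠ u.1 → ∀ j i, i ≠ j →
      (l.bar :: listArrow l u i).length + ((![[u, u.bar, l], [u, u.bar], [u.bar, l], [u, l],
        [u.bar], [u], [l], []] : Fin 8 → List Step) j).length ≠ 4 ∨
      ((l.bar :: listArrow l u i).map pv).sum ≠ ((l.bar :: listArrow l u j).map pv).sum := by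
    decide +kernel
  have t : ∀ u, Cot y l u → _ := fun u hu =>
    trace_rhombus (ε₀ := ε₀) (hu.shift hy.good.inX) gl (by rw [add_vec_bar]; exact hy.good)
      (hy.good₂ l u hu) (by rw [add_vec_bar]; exact hy.good₁ u hu.2.2.1)
  have t1 := t u hu
  have t2 := t u.bar hu'
  rw [Step.bar_bar] at t1
  rw [Step.bar_bar, Step.bar_bar] at t2
  have hc : ∀ j, c j = 0 := fun j => coeff_eq_zero hε gl h j
    ((![[u, u.bar, l], [u, u.bar], [u.bar, l], [u, l], [u.bar], [u], [l], []] :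
      Fin 8 → List Step) j) (by
      fin_cases j
      exacts [t1.2.1, t1.1, t1.2.1, t2.2.1, t1.1, t2.1, t1.2.1, t1.1])
    fun i hij => (ho l u hu.1 j i hij).imp_right .inl
  simp only [hc, zero_smul, Finset.sum_const_zero, zero_add]
  exact hs

end Rauzy

namespace Rauzy

variable {k : Type u} [Field k] {ε₀ : Fin 3 → ℤˣ}

/-! ### Exactness at a vertex after a pair of vertices -/

/-- Representatives of the words at a vertex modulo the right ideals generated by `l̄` and `l̄'`. -/
def listArrows (l l' u : Step) : Fin 12 → List Step :=
  ![[], [l], [l'], [u], [u.bar], [l, u], [l', u.bar], [l, l'], [u, u.bar], [u.bar, u],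
    [l, u, u.bar], [l', u.bar, u]]

/-- Every word at `y` reduces to a word of the list if `l̄` and `l̄'` are moved to the front. -/
theorem span_listArrows {y : Fin 3 → ℤ} (hy : Deep y) {l l' u : Step} (h : l.1 ≠ l'.1)
    (h1 : l.1 ≠ u.1) (h2 : l'.1 ≠ u.1) (c1 : ¬ Cot y l u.bar) (c2 : ¬ Cot y l' u) (p : List Step) :
    word k ε₀ y p ∈ Submodule.span k (Set.range fun i => word k ε₀ y (listArrows l l' u i)) ⊔
      (arrowIdeal y l.bar ⊔ arrowIdeal y l'.bar) := by
  set W := Submodule.span k (Set.range fun i => word k ε₀ y (listArrows l l' u i)) ⊔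
        (arrowIdeal y l.bar ⊔ arrowIdeal y l'.bar) with hW
  have hF : ∀ i, word k ε₀ y (listArrows l l' u i) ∈ W := fun i =>
    Submodule.mem_sup_left (Submodule.subset_span ⟨i, rfl⟩)
  have a1 : ∀ Q, word k ε₀ y (l.bar :: Q) ∈ W := fun Q =>
    Submodule.mem_sup_right (Submodule.mem_sup_left (word_mem_arrowIdeal _ _ _))
  have a2 : ∀ Q, word k ε₀ y (l'.bar :: Q) ∈ W := fun Q =>
    Submodule.mem_sup_right (Submodule.mem_sup_right (word_mem_arrowIdeal _ _ _))
  clear_value W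
  have hb : ∀ {s t : Step}, s.1 ≠ t.1 → s ≠ t.bar := fun h => ne_bar_of_ne h.symm
  have z1 : ∀ Q, word k ε₀ y (l :: u.bar :: Q) ∈ W := fun Q => by
    rw [word_pair_eq_zero hy.good.inX c1 (ne_bar_of_ne h1)]; exact W.zero_mem
  have z2 : ∀ Q, word k ε₀ y (l' :: u :: Q) ∈ W := fun Q => by
    rw [word_pair_eq_zero hy.good.inX c2 (ne_bar_of_ne h2)]; exact W.zero_mem
  have d : ∀ {t s : Step} (Q), t.1 ≠ s.1 → (∀ Q, word k ε₀ y (s :: Q) ∈ W) →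
      word k ε₀ y (t :: s :: Q) ∈ W := fun Q h h' => by
    rw [hy.swap₀ h]; exact h' _
  have f0 := hF 0
  have f1 := hF 1
  have f2 := hF 2
  have f3 := hF 3
  have f4 := hF 4
  have f5 := hF 5
  have f6 := hF 6
  have f7 := hF 7
  have f8 := hF 8
  have f9 := hF 9
  have f10 := hF 10
  have f11 := hF 11
  simp only [listArrows, Matrix.cons_val] at f0 f1 f2 f3 f4 f5 f6 f7 f8 f9 f10 f11
  have A : ∀ Q, word k ε₀ y (l :: l.bar :: u :: Q) ∈ W := fun Q => by
    refine hy.star (P := []) (by simp) (u := l') h (a1 _) ?_ (a2 _)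
    rw [List.nil_append, hy.swap₁ l' (s := l'.bar) h2]
    exact z2 _
  have A' : ∀ Q, word k ε₀ y (l' :: l'.bar :: u.bar :: Q) ∈ W := fun Q => by
    refine hy.star (P := []) (by simp) (u := l) h.symm (a2 _) ?_ (a1 _)
    rw [List.nil_append, hy.swap₁ l (s := l.bar) (t := u.bar) h1]
    exact z1 _
  have B : ∀ Q, word k ε₀ y (l :: l.bar :: u.bar :: Q) ∈ W := fun Q => by
    rw [hy.swap₁ l (s := l.bar) (t := u.bar) h1]
    exact z1 _
  have B' : ∀ Q, word k ε₀ y (l' :: l'.bar :: u :: Q) ∈ W := fun Q => by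
    rw [hy.swap₁ l' (s := l'.bar) h2]
    exact z2 _
  have ll' : word k ε₀ y [l, l.bar, l', l'.bar] ∈ W := by
    refine hy.star (P := [l, l.bar]) (by simp) (s := l') (u := u) (Q := []) h2 ?_ (A _) (B _)
    have := hy.loops_symm (k := k) (ε₀ := ε₀) (a := l) (b := l'.bar) h []
    rw [Step.bar_bar] at this
    rw [List.cons_append, List.cons_append, List.nil_append, this]
    exact a2 _
  refine hy.word_mem f0 (fun s => ?_) (fun s t hst => ?_) (fun s => ?_) (fun t u' htu => ?_)
    (fun t u' htu => ?_) p
  · rcases step_six h h1 h2 s with rfl | rfl | rfl | rfl | rfl | rfl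
    exacts [f1, a1 _, f2, a2 _, f3, f4]
  · rcases step_six h h1 h2 s with rfl | rfl | rfl | rfl | rfl | rfl
    · rcases step_six h h1 h2 t with rfl | rfl | rfl | rfl | rfl | rfl
      exacts [absurd rfl hst, absurd rfl hst, f7, d _ hst a2, f5, z1 _]
    · exact a1 _
    · rcases step_six h h1 h2 t with rfl | rfl | rfl | rfl | rfl | rfl
      exacts [by rw [hy.swap₀ hst]; exact f7, d _ hst a1, absurd rfl hst, absurd rfl hst, z2 _, f6]
    · exact a2 _
    · rcases step_six h h1 h2 t with rfl | rfl | rfl | rfl | rfl | rfl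
      exacts [by rw [hy.swap₀ hst]; exact f5, d _ hst a1, by rw [hy.swap₀ hst]; exact z2 _,
        d _ hst a2, absurd rfl hst, absurd rfl hst]
    · rcases step_six h h1 h2 t with rfl | rfl | rfl | rfl | rfl | rfl
      exacts [by rw [hy.swap₀ hst]; exact z1 _, d _ hst a1, by rw [hy.swap₀ hst]; exact f6,
        d _ hst a2, absurd rfl hst, absurd rfl hst]
  · rcases step_six h h1 h2 s with rfl | rfl | rfl | rfl | rfl | rfl
    · exact hy.star (P := []) (by simp) h1 (a1 _) f8 f9
    · exact a1 _
    · exact hy.star (P := []) (by simp) h2 (a2 _) f8 f9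
    · exact a2 _
    · exact f8
    · rw [Step.bar_bar]; exact f9
  · rcases step_six h h1 h2 t with rfl | rfl | rfl | rfl | rfl | rfl
    · rcases step_six h h1 h2 u' with rfl | rfl | rfl | rfl | rfl | rfl
      · exact absurd rfl htu
      · exact absurd rfl htu
      · exact hy.star (P := [t]) (by simp) h2 (d _ htu a2) f10 (z1 _)
      · exact d _ htu a2
      · exact f10
      · exact z1 _
    · exact a1 _
    · rcases step_six h h1 h2 u' with rfl | rfl | rfl | rfl | rfl | rfl
      · have := hy.star (k := k) (ε₀ := ε₀) (P := [t]) (by simp) (s := u') (u := u.bar) (Q := [])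
          (S := W) h1
        rw [Step.bar_bar] at this
        exact this (d _ htu a1) f11 (z2 _)
      · exact d _ htu a1
      · exact absurd rfl htu
      · exact absurd rfl htu
      · exact z2 _
      · rw [Step.bar_bar]; exact f11
    · exact a2 _
    · rcases step_six h h1 h2 u' with rfl | rfl | rfl | rfl | rfl | rfl
      · rw [hy.swap₀ htu, hy.swap₁ u' (t := u'.bar) htu]
        exact A _
      · exact d _ htu a1
      · rw [hy.swap₀ htu]
        exact z2 _
      · exact d _ htu a2
      · exact absurd rfl htu
      · exact absurd rfl htu
    · rcases step_six h h1 h2 u' with rfl | rfl | rfl | rfl | rfl | rfl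
      · rw [hy.swap₀ htu]
        exact z1 _
      · exact d _ htu a1
      · rw [hy.swap₀ htu, hy.swap₁ u' (t := u'.bar) htu]
        exact A' _
      · exact d _ htu a2
      · exact absurd rfl htu
      · exact absurd rfl htu
  · rcases step_six h h1 h2 t with rfl | rfl | rfl | rfl | rfl | rfl
    · rcases step_six h h1 h2 u' with rfl | rfl | rfl | rfl | rfl | rfl
      exacts [absurd rfl htu, absurd rfl htu, ll', by rw [hy.loops_symm htu]; exact a2 _, A _, B _]
    · exact a1 _
    · rcases step_six h h1 h2 u' with rfl | rfl | rfl | rfl | rfl | rfl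
      exacts [by rw [hy.loops_symm htu]; exact ll', by rw [hy.loops_symm htu]; exact a1 _,
        absurd rfl htu, absurd rfl htu, B' _, A' _]
    · exact a2 _
    · rw [hy.loops_symm htu]
      rcases step_six h h1 h2 u' with rfl | rfl | rfl | rfl | rfl | rfl
      exacts [A _, a1 _, B' _, a2 _, absurd rfl htu, absurd rfl htu]
    · rw [hy.loops_symm htu]
      rcases step_six h h1 h2 u' with rfl | rfl | rfl | rfl | rfl | rfl
      exacts [B _, a1 _, A' _, a2 _, absurd rfl htu, absurd rfl htu]

/-- Two rhombi along a step exclude the third one. -/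
theorem not_cot_bar {y : Fin 3 → ℤ} {l l' u : Step} (hl : Cot y l u) (hl' : Cot y l' u.bar)
    (hll : Cot y l l') : ¬ Cot y l l'.bar := by
  rintro ⟨-, -, hw1, hw2⟩
  obtain ⟨h, hl, ha, hb⟩ := hl
  obtain ⟨h1, -, ha', hb'⟩ := hl'
  obtain ⟨h2, -, ha'', hb''⟩ := hll
  have hs := sum_hgt h h2.symm h1
  have p1 := hgt_pos l.1
  have p2 := hgt_pos u.1
  have p3 := hgt_pos l'.1
  obtain ⟨a, e⟩ := l
  obtain ⟨b, e'⟩ := u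
  obtain ⟨c, e''⟩ := l'
  simp only [InX, ht_add, ht_vec, hs, Step.bar] at *
  rcases Int.units_eq_one_or e with rfl | rfl <;> rcases Int.units_eq_one_or e' with rfl | rfl <;>
    rcases Int.units_eq_one_or e'' with rfl | rfl <;> simp at * <;> linarith

/-- Continuations of the words in `listArrows` to closed paths along a rhombus. -/
def dualArrows (l l' u : Step) : Fin 12 → List Step :=
  ![[u, u.bar, l], [u, u.bar], [l'.bar, l], [u.bar, l], [u, l'], [u.bar], [u], [l'.bar], [l], [l'],
    [], []]

set_option synthInstance.maxSize 1000 in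
set_option synthInstance.maxHeartbeats 200000 in
/-- The analogue of `exact_arrow` for two arrows `l` and `l'` that span a rhombus at `y`: the common
kernel of `l̄` and `l̄'` lies in the right ideal of the arrows along `l̄` and `l̄'`. -/
theorem exact_arrows (hε : ∏ d, ε₀ d = 1) {y : Fin 3 → ℤ} (hy : Deep y) {l l' u : Step}
    (hl : Cot y l u) (hl' : Cot y l' u.bar) (hll : Cot y l l') {x : InfAlgebra k ε₀}
    (hx : E k ε₀ y * x = x) (h : G k ε₀ (y + vec l) l.bar * x = 0)
    (h' : G k ε₀ (y + vec l') l'.bar * x = 0) :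
    x ∈ (arrowIdeal y l.bar ⊔ arrowIdeal y l'.bar : Submodule k (InfAlgebra k ε₀)) := by
  have c1 : ¬ Cot y l u.bar := fun hc => not_cot_of_cot hl hc hll.1 hl'.1.symm hll
  have c2 : ¬ Cot y l' u := fun hc =>
    not_cot_of_cot (u := u.bar) hl' (by rwa [Step.bar_bar]) hll.1.symm hl.1.symm hll.symm
  have hm := E_mul_mem (span_listArrows (k := k) (ε₀ := ε₀) hy hll.1 hl.1 hl'.1 c1 c2) x
  rw [hx] at hm
  obtain ⟨q, hq, s, hs, rfl⟩ := Submodule.mem_sup.1 hm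
  obtain ⟨c, rfl⟩ := (Submodule.mem_span_range_iff_exists_fun k).1 hq
  have hw : ∀ {s t : Step}, s.1 ≠ t.1 → t ≠ s := fun h e => h (by rw [e])
  have hs0 : G k ε₀ (y + vec l) l.bar * s = 0 ∧ G k ε₀ (y + vec l') l'.bar * s = 0 := by
    obtain ⟨s1, ⟨a1, rfl⟩, s2, ⟨a2, rfl⟩, rfl⟩ := Submodule.mem_sup.1 hs
    rw [mul_add, mul_add]
    simp only [LinearMap.mulLeft_apply]
    rw [arrow_mul_arrow_eq_zero hl.2.1 (v := l.bar) (fun h => h.1 rfl) (bar_ne l),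
      arrow_mul_arrow_eq_zero hl.2.1 (not_cot_bar hl hl' hll) (hw (t := l'.bar) hll.1),
      arrow_mul_arrow_eq_zero hl'.2.1 (v := l'.bar) (fun h => h.1 rfl) (bar_ne l'),
      arrow_mul_arrow_eq_zero hl'.2.1
        (not_cot_bar hl' (by rwa [Step.bar_bar]) hll.symm) (hw (t := l.bar) hll.1.symm),
      add_zero]
    exact ⟨rfl, rfl⟩
  rw [mul_add, hs0.1, add_zero, Finset.mul_sum] at h
  rw [mul_add, hs0.2, add_zero, Finset.mul_sum] at h'
  simp only [mul_smul_comm, arrow_mul_word] at h h'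
  have gl := hy.good₁ l hl.2.1
  have gl' := hy.good₁ l' hl'.2.1
  have t : ∀ l u, Cot y l u → _ := fun l u hu =>
    trace_rhombus (ε₀ := ε₀) (hu.shift hy.good.inX) (hy.good₁ l hu.2.1)
      (by rw [add_vec_bar]; exact hy.good)
      (hy.good₂ l u hu) (by rw [add_vec_bar]; exact hy.good₁ u hu.2.2.1)
  have t1 := t l u hl
  have t2 := t l' u.bar hl'
  have t3 := t l l' hll
  rw [Step.bar_bar] at t1 t3
  rw [Step.bar_bar, Step.bar_bar] at t2
  -- the words that start with `u.bar`, or with `l'` and `u.bar`, are killed by the first arrow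
  let K : Finset (Fin 12) := {4, 6, 9, 11}
  have zz : ∀ Q, word k ε₀ (y + vec l) (l.bar :: u.bar :: Q) = 0 := fun Q =>
    word_pair_eq_zero gl.inX (fun hc => c1 (hc.unshift hl.2.1)) (ne_bar_of_ne (s := l.bar) hl.1) Q
  have zz' : ∀ Q, word k ε₀ (y + vec l) (l.bar :: l' :: u.bar :: Q) = 0 := fun Q => by
    rw [← arrow_mul_word, hy.swap₀ (t := u.bar) hl'.1, arrow_mul_word, zz]
  have ho : ∀ l l' u : Step, l.1 ≠ l'.1 → l.1 ≠ u.1 → l'.1 ≠ u.1 → ∀ j, j ∉ K → ∀ i, i ∉ K →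
      i ≠ j → (l.bar :: listArrows l l' u i).length + (dualArrows l l' u j).length ≠ 4 ∨
      ((l.bar :: listArrows l l' u i).map pv).sum ≠
        ((l.bar :: listArrows l l' u j).map pv).sum := by
    decide +kernel
  have ho' : ∀ l l' u : Step, l.1 ≠ l'.1 → l.1 ≠ u.1 → l'.1 ≠ u.1 → ∀ j, j ∈ K → ∀ i, i ∈ K →
      i ≠ j → (l'.bar :: listArrows l l' u i).length + (dualArrows l l' u j).length ≠ 4 ∨
      ((l'.bar :: listArrows l l' u i).map pv).sum ≠
        ((l'.bar :: listArrows l l' u j).map pv).sum := by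
    decide +kernel
  have hc1 : ∀ j, j ∉ K → c j = 0 := fun j hj => by
    refine coeff_eq_zero hε gl h j (dualArrows l l' u j) ?_ fun i hij => ?_
    · revert hj
      fin_cases j <;> intro hj
      exacts [t1.2.1, t1.1, t3.2.1, t1.2.1, absurd (by decide) hj, t1.1, absurd (by decide) hj,
        t3.1, t1.2.1, absurd (by decide) hj, t1.1, absurd (by decide) hj]
    · by_cases hi : i ∈ K
      · right; right; right
        fin_cases hi
        exacts [by rw [show listArrows l l' u 4 = [u.bar] from rfl, zz, smul_zero],
          by rw [show listArrows l l' u 6 = [l', u.bar] from rfl, zz', smul_zero],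
          by rw [show listArrows l l' u 9 = [u.bar, u] from rfl, zz, smul_zero],
          by rw [show listArrows l l' u 11 = [l', u.bar, u] from rfl, zz', smul_zero]]
      · exact (ho l l' u hll.1 hl.1 hl'.1 j hj i hi hij).imp_right .inl
  have hc2 : ∀ j, j ∈ K → c j = 0 := fun j hj => by
    refine coeff_eq_zero hε gl' h' j (dualArrows l l' u j) ?_ fun i hij => ?_
    · fin_cases hj
      exacts [t2.2.1, t2.1, t2.2.1, t2.1]
    · by_cases hi : i ∈ K
      · exact (ho' l l' u hll.1 hl.1 hl'.1 j hj i hi hij).imp_right .inl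
      · rw [hc1 i hi, zero_smul]
        exact .inr (.inr (.inr rfl))
  have hc : ∀ j, c j = 0 := fun j => (em (j ∈ K)).elim (hc2 j) (hc1 j)
  simp only [hc, zero_smul, Finset.sum_const_zero, zero_add]
  exact hs

end Rauzy

namespace Rauzy

variable {k : Type u} [Field k] {ε₀ : Fin 3 → ℤˣ}

/-! ### Exactness at a pair of vertices -/

/-- The right ideal generated by a path of length two. -/
def pathIdeal (y : Fin 3 → ℤ) (s t : Step) : Submodule k (InfAlgebra k ε₀) :=
  LinearMap.range (LinearMap.mulLeft k (G k ε₀ y s * G k ε₀ (y + vec s) t))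

theorem word_mem_pathIdeal (y : Fin 3 → ℤ) (s t : Step) (Q : List Step) :
    word k ε₀ y (s :: t :: Q) ∈ pathIdeal y s t :=
  ⟨word k ε₀ (y + vec s + vec t) Q, by rw [LinearMap.mulLeft_apply, mul_assoc]; rfl⟩

/-- Representatives of the words at a vertex with only three arrows `p`, `q`, `r`, modulo the right
ideal generated by `q`. -/
def listPairFst (p r : Step) : Fin 4 → List Step := ![[], [p], [r], [p, r]]

/-- Representatives of the words at a vertex with only three arrows `p`, `q`, `r`, modulo the right
ideal generated by the path `q r`. -/
def listPairSnd (p q r : Step) : Fin 8 → List Step :=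
  ![[], [q], [r], [p], [p, r], [q, p], [q, q.bar], [p, q, q.bar]]

section Pair

variable {y : Fin 3 → ℤ} {p q r : Step}

theorem span_listPairFst (hy : Deep y) (h : p.1 ≠ q.1) (h1 : p.1 ≠ r.1) (h2 : q.1 ≠ r.1)
    (hp : ¬ InX (y + vec p.bar)) (hq : ¬ InX (y + vec q.bar)) (hr : ¬ InX (y + vec r.bar))
    (w : List Step) : word k ε₀ y w ∈
      Submodule.span k (Set.range fun i => word k ε₀ y (listPairFst p r i)) ⊔ arrowIdeal y q := by
  set W := Submodule.span k (Set.range fun i => word k ε₀ y (listPairFst p r i)) ⊔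
    arrowIdeal y q with hW
  have hF : ∀ i, word k ε₀ y (listPairFst p r i) ∈ W := fun i =>
    Submodule.mem_sup_left (Submodule.subset_span ⟨i, rfl⟩)
  have a : ∀ Q, word k ε₀ y (q :: Q) ∈ W := fun Q =>
    Submodule.mem_sup_right (word_mem_arrowIdeal _ _ _)
  clear_value W
  have f0 := hF 0
  have f1 := hF 1
  have f2 := hF 2
  have f3 := hF 3
  simp only [listPairFst, Matrix.cons_val] at f0 f1 f2 f3
  have zp : ∀ Q, word k ε₀ y (p.bar :: Q) ∈ W := fun Q => by
    rw [word_cons_eq_zero hy.good.inX hp]; exact W.zero_mem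
  have zq : ∀ Q, word k ε₀ y (q.bar :: Q) ∈ W := fun Q => by
    rw [word_cons_eq_zero hy.good.inX hq]; exact W.zero_mem
  have zr : ∀ Q, word k ε₀ y (r.bar :: Q) ∈ W := fun Q => by
    rw [word_cons_eq_zero hy.good.inX hr]; exact W.zero_mem
  have d : ∀ {t s : Step} (Q), t.1 ≠ s.1 → (∀ Q, word k ε₀ y (s :: Q) ∈ W) →
      word k ε₀ y (t :: s :: Q) ∈ W := fun Q h h' => by
    rw [hy.swap₀ h]; exact h' _
  have pp : ∀ Q, word k ε₀ y (p :: p.bar :: Q) ∈ W := fun Q =>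
    hy.star (P := []) (by simp) h (zp _) (a _) (zq _)
  have rr : ∀ Q, word k ε₀ y (r :: r.bar :: Q) ∈ W := fun Q =>
    hy.star (P := []) (by simp) h2.symm (zr _) (a _) (zq _)
  refine hy.word_mem f0 (fun s => ?_) (fun s t hst => ?_) (fun s => ?_) (fun t u' htu => ?_)
    (fun t u' htu => ?_) w
  · rcases step_six h h1 h2 s with rfl | rfl | rfl | rfl | rfl | rfl
    exacts [f1, zp _, a _, zq _, f2, zr _]
  · rcases step_six h h1 h2 s with rfl | rfl | rfl | rfl | rfl | rfl
    · rcases step_six h h1 h2 t with rfl | rfl | rfl | rfl | rfl | rfl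
      exacts [absurd rfl hst, absurd rfl hst, d _ h a, d _ h zq, f3, d _ h1 zr]
    · exact zp _
    · exact a _
    · exact zq _
    · rcases step_six h h1 h2 t with rfl | rfl | rfl | rfl | rfl | rfl
      exacts [by rw [hy.swap₀ hst]; exact f3, d _ hst zp, d _ hst a, d _ hst zq, absurd rfl hst,
        absurd rfl hst]
    · exact zr _
  · rcases step_six h h1 h2 s with rfl | rfl | rfl | rfl | rfl | rfl
    exacts [pp _, zp _, a _, zq _, rr _, zr _]
  · rcases step_six h h1 h2 t with rfl | rfl | rfl | rfl | rfl | rfl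
    · rcases step_six h h1 h2 u' with rfl | rfl | rfl | rfl | rfl | rfl
      exacts [absurd rfl htu, absurd rfl htu, d _ htu a, d _ htu zq,
        hy.star (P := [t]) (by simp) h2.symm (d _ htu zr) (d _ h a) (d _ h zq), d _ htu zr]
    · exact zp _
    · exact a _
    · exact zq _
    · rcases step_six h h1 h2 u' with rfl | rfl | rfl | rfl | rfl | rfl
      exacts [hy.star (P := [t]) (by simp) h (d _ htu zp) (d _ h2.symm a) (d _ h2.symm zq),
        d _ htu zp, d _ htu a, d _ htu zq, absurd rfl htu, absurd rfl htu]
    · exact zr _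
  · rcases step_six h h1 h2 t with rfl | rfl | rfl | rfl | rfl | rfl
    exacts [pp _, zp _, a _, zq _, rr _, zr _]

theorem span_listPairSnd (hy : Deep y) (h : p.1 ≠ q.1) (h1 : p.1 ≠ r.1) (h2 : q.1 ≠ r.1)
    (hp : ¬ InX (y + vec p.bar)) (hq : ¬ InX (y + vec q.bar)) (hr : ¬ InX (y + vec r.bar))
    (w : List Step) : word k ε₀ y w ∈
      Submodule.span k (Set.range fun i => word k ε₀ y (listPairSnd p q r i)) ⊔
        pathIdeal y q r := by
  set W := Submodule.span k (Set.range fun i => word k ε₀ y (listPairSnd p q r i)) ⊔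
    pathIdeal y q r with hW
  have hF : ∀ i, word k ε₀ y (listPairSnd p q r i) ∈ W := fun i =>
    Submodule.mem_sup_left (Submodule.subset_span ⟨i, rfl⟩)
  have a : ∀ Q, word k ε₀ y (q :: r :: Q) ∈ W := fun Q =>
    Submodule.mem_sup_right (word_mem_pathIdeal _ _ _ _)
  clear_value W
  have a' : ∀ Q, word k ε₀ y (r :: q :: Q) ∈ W := fun Q => by
    rw [hy.swap₀ h2.symm]; exact a _
  have f0 := hF 0
  have f1 := hF 1
  have f2 := hF 2
  have f3 := hF 3
  have f4 := hF 4
  have f5 := hF 5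
  have f6 := hF 6
  have f7 := hF 7
  simp only [listPairSnd, Matrix.cons_val] at f0 f1 f2 f3 f4 f5 f6 f7
  have zp : ∀ Q, word k ε₀ y (p.bar :: Q) ∈ W := fun Q => by
    rw [word_cons_eq_zero hy.good.inX hp]; exact W.zero_mem
  have zq : ∀ Q, word k ε₀ y (q.bar :: Q) ∈ W := fun Q => by
    rw [word_cons_eq_zero hy.good.inX hq]; exact W.zero_mem
  have zr : ∀ Q, word k ε₀ y (r.bar :: Q) ∈ W := fun Q => by
    rw [word_cons_eq_zero hy.good.inX hr]; exact W.zero_mem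
  have d : ∀ {t s : Step} (Q), t.1 ≠ s.1 → (∀ Q, word k ε₀ y (s :: Q) ∈ W) →
      word k ε₀ y (t :: s :: Q) ∈ W := fun Q h h' => by
    rw [hy.swap₀ h]; exact h' _
  have qr : ∀ Q, word k ε₀ y (q :: q.bar :: r :: Q) ∈ W := fun Q => by
    rw [hy.swap₁ q (s := q.bar) h2]; exact a _
  have qp : word k ε₀ y [q, q.bar, p, p.bar] ∈ W := by
    refine hy.star (P := [q, q.bar]) (by simp) (s := p) (u := r) (Q := []) h1 ?_ (qr _) ?_
    · have := hy.loops_symm (k := k) (ε₀ := ε₀) (a := q) (b := p.bar) h.symm []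
      rw [Step.bar_bar] at this
      rw [List.cons_append, List.cons_append, List.nil_append, this]
      exact zp _
    · have := hy.loops_symm (k := k) (ε₀ := ε₀) (a := q) (b := r.bar) h2 []
      rw [Step.bar_bar] at this
      rw [List.cons_append, List.cons_append, List.nil_append, this]
      exact zr _
  have pr : word k ε₀ y [p, p.bar, r, r.bar] ∈ W :=
    hy.star (P := []) (by simp) h (zp _) (qr _) (zq _)
  refine hy.word_mem f0 (fun s => ?_) (fun s t hst => ?_) (fun s => ?_) (fun t u' htu => ?_)
    (fun t u' htu => ?_) w
  · rcases step_six h h1 h2 s with rfl | rfl | rfl | rfl | rfl | rfl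
    exacts [f3, zp _, f1, zq _, f2, zr _]
  · rcases step_six h h1 h2 s with rfl | rfl | rfl | rfl | rfl | rfl
    · rcases step_six h h1 h2 t with rfl | rfl | rfl | rfl | rfl | rfl
      exacts [absurd rfl hst, absurd rfl hst, by rw [hy.swap₀ hst]; exact f5, d _ hst zq, f4,
        d _ hst zr]
    · exact zp _
    · rcases step_six h h1 h2 t with rfl | rfl | rfl | rfl | rfl | rfl
      exacts [f5, d _ hst zp, absurd rfl hst, absurd rfl hst, a _, d _ hst zr]
    · exact zq _
    · rcases step_six h h1 h2 t with rfl | rfl | rfl | rfl | rfl | rfl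
      exacts [by rw [hy.swap₀ hst]; exact f4, d _ hst zp, a' _, d _ hst zq, absurd rfl hst,
        absurd rfl hst]
    · exact zr _
  · rcases step_six h h1 h2 s with rfl | rfl | rfl | rfl | rfl | rfl
    exacts [hy.star (P := []) (by simp) h (zp _) f6 (zq _), zp _, f6, zq _,
      hy.star (P := []) (by simp) h2.symm (zr _) f6 (zq _), zr _]
  · rcases step_six h h1 h2 t with rfl | rfl | rfl | rfl | rfl | rfl
    · rcases step_six h h1 h2 u' with rfl | rfl | rfl | rfl | rfl | rfl
      exacts [absurd rfl htu, absurd rfl htu, f7, d _ htu zq,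
        hy.star (P := [t]) (by simp) h2.symm (d _ htu zr) f7 (d _ h zq), d _ htu zr]
    · exact zp _
    · rcases step_six h h1 h2 u' with rfl | rfl | rfl | rfl | rfl | rfl
      exacts [hy.star (P := [t]) (by simp) h1 (d _ htu zp) (a _) (d _ h2 zr), d _ htu zp,
        absurd rfl htu, absurd rfl htu, a _, d _ htu zr]
    · exact zq _
    · rcases step_six h h1 h2 u' with rfl | rfl | rfl | rfl | rfl | rfl
      exacts [hy.star (P := [t]) (by simp) h (d _ htu zp) (a' _) (d _ h2.symm zq), d _ htu zp,
        a' _, d _ htu zq, absurd rfl htu, absurd rfl htu]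
    · exact zr _
  · rcases step_six h h1 h2 t with rfl | rfl | rfl | rfl | rfl | rfl
    · rcases step_six h h1 h2 u' with rfl | rfl | rfl | rfl | rfl | rfl
      exacts [absurd rfl htu, absurd rfl htu, by rw [hy.loops_symm htu]; exact qp,
        by rw [hy.loops_symm htu]; exact zq _, pr, by rw [hy.loops_symm htu]; exact zr _]
    · exact zp _
    · rcases step_six h h1 h2 u' with rfl | rfl | rfl | rfl | rfl | rfl
      exacts [qp, by rw [hy.loops_symm htu]; exact zp _, absurd rfl htu, absurd rfl htu, qr _,
        by rw [hy.loops_symm htu]; exact zr _]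
    · exact zq _
    · rcases step_six h h1 h2 u' with rfl | rfl | rfl | rfl | rfl | rfl
      exacts [by rw [hy.loops_symm htu]; exact pr, by rw [hy.loops_symm htu]; exact zp _,
        by rw [hy.loops_symm htu]; exact qr _, by rw [hy.loops_symm htu]; exact zq _,
        absurd rfl htu, absurd rfl htu]
    · exact zr _

end Pair

/-- The words that remain at a pair of vertices, seen from the vertex before the pair. -/
def listPair (a b d : Step) : Fin 12 → List Step :=
  ![[a], [a, a.bar], [a, d], [a, a.bar, d],
    [b], [b, a], [b, d.bar], [b, b.bar], [b, b.bar, d.bar], [b, a, b.bar], [b, a, a.bar],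
    [b, b.bar, a, a.bar]]

/-- Continuations of the words in `listPair` to closed paths along a rhombus. -/
def dualPair (a b d : Step) : Fin 12 → List Step :=
  ![[a.bar, d, d.bar], [d, d.bar], [d.bar, a.bar], [d.bar],
    [b.bar, d.bar, d], [a.bar, b.bar], [d, b.bar], [d.bar, d], [d], [a.bar], [b.bar], []]

/-- Exactness at the two vertices `y + a` and `y + b` of a rhombus, each with only three arrows: a
relation between the arrows `a` and `b` at `y` is a multiple of the commutation relation of the
rhombus. -/
theorem exact_pair (hε : ∏ d, ε₀ d = 1) {y : Fin 3 → ℤ} {a b d : Step} (hy : Deep y)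
    (hya : Deep (y + vec a)) (hyb : Deep (y + vec b)) (hab : Cot y a b) (had : Cot y a d)
    (hbd : Cot y b d.bar) (a1 : ¬ InX (y + vec a + vec a)) (a2 : ¬ InX (y + vec a + vec b.bar))
    (a3 : ¬ InX (y + vec a + vec d.bar)) (b1 : ¬ InX (y + vec b + vec b))
    (b2 : ¬ InX (y + vec b + vec a.bar)) (b3 : ¬ InX (y + vec b + vec d))
    {x x' : InfAlgebra k ε₀} (hx : E k ε₀ (y + vec a) * x = x) (hx' : E k ε₀ (y + vec b) * x' = x')
    (h : G k ε₀ y a * x + G k ε₀ y b * x' = 0) :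
    ∃ z, x = G k ε₀ (y + vec a) b * z ∧ x' = -(G k ε₀ (y + vec b) a * z) := by
  have hm := E_mul_mem (span_listPairFst (k := k) (ε₀ := ε₀) (p := a.bar) (q := b) (r := d) hya
    hab.1 had.1 hbd.1 (by rwa [Step.bar_bar]) a2 a3) x
  rw [hx] at hm
  obtain ⟨q, hq, s, ⟨z1, rfl⟩, rfl⟩ := Submodule.mem_sup.1 hm
  obtain ⟨c, rfl⟩ := (Submodule.mem_span_range_iff_exists_fun k).1 hq
  rw [LinearMap.mulLeft_apply] at *
  have hcomm := G_mul_G_comm (k := k) (ε₀ := ε₀) hy.good hab.1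
  have hx'' : E k ε₀ (y + vec b) * (x' + G k ε₀ (y + vec b) a * z1) =
      x' + G k ε₀ (y + vec b) a * z1 := by
    rw [mul_add, hx', ← mul_assoc, E_mul_G]
  have hm' := E_mul_mem (span_listPairSnd (k := k) (ε₀ := ε₀) (p := b.bar) (q := a) (r := d.bar) hyb
    hab.1.symm hbd.1 had.1 (by rwa [Step.bar_bar]) b2 (by rwa [Step.bar_bar]))
    (x' + G k ε₀ (y + vec b) a * z1)
  rw [hx''] at hm'
  obtain ⟨q', hq', s', ⟨z2, rfl⟩, he⟩ := Submodule.mem_sup.1 hm'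
  obtain ⟨c', rfl⟩ := (Submodule.mem_span_range_iff_exists_fun k).1 hq'
  rw [LinearMap.mulLeft_apply] at he
  have hx0 : x' = ∑ i, c' i • word k ε₀ (y + vec b) (listPairSnd b.bar a d.bar i) +
      G k ε₀ (y + vec b) a * (G k ε₀ (y + vec b + vec a) d.bar * z2) -
      G k ε₀ (y + vec b) a * z1 := by
    rw [← mul_assoc, he, add_sub_cancel_right]
  have hcube :
      G k ε₀ y b * (G k ε₀ (y + vec b) a * (G k ε₀ (y + vec b + vec a) d.bar * z2)) = 0 := by
    rw [← mul_assoc, ← mul_assoc, mul_assoc (G k ε₀ y b),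
      cube_eq_zero hy.good hy.good₁ hab.1.symm hbd.1 (u := d.bar) had.1, zero_mul]
  have hsum : ∑ i, c i • word k ε₀ y (a :: listPairFst a.bar d i) +
      ∑ i, c' i • word k ε₀ y (b :: listPairSnd b.bar a d.bar i) = 0 := by
    rw [hx0, mul_add, mul_sub, mul_add, hcube, ← mul_assoc, ← mul_assoc, hcomm, add_zero] at h
    simp only [Finset.mul_sum, mul_smul_comm, ← word_cons] at h
    rw [← h]
    abel
  have hsum' : ∑ i, (![c 0, c 1, c 2, c 3, c' 0, c' 1, c' 2, c' 3, c' 4, c' 5, c' 6, c' 7] :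
      Fin 12 → k) i • word k ε₀ y (listPair a b d i) = 0 := by
    rw [Fin.sum_univ_four, Fin.sum_univ_eight] at hsum
    rw [← hsum]
    simp only [Fin.sum_univ_succ, Fin.sum_univ_zero]
    simp [listPair, listPairFst, listPairSnd, add_assoc]
  set C : Fin 12 → k := ![c 0, c 1, c 2, c 3, c' 0, c' 1, c' 2, c' 3, c' 4, c' 5, c' 6, c' 7]
  have ho : ∀ a b d : Step, a.1 ≠ b.1 ∧ a.1 ≠ d.1 ∧ b.1 ≠ d.1 → ∀ j i, i ≠ j →
      (i = 1 ∧ j = 7 ∨ i = 7 ∧ j = 1) ∨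
      (listPair a b d i).length + (dualPair a b d j).length ≠ 4 ∨
      ((listPair a b d i).map pv).sum ≠ ((listPair a b d j).map pv).sum := by
    decide +kernel
  have t : ∀ {s t : Step}, Cot y s t → _ := fun {s t} h => trace_rhombus (ε₀ := ε₀) h hy.good
    (hy.good₁ s h.2.1) (hy.good₁ t h.2.2.1) (hy.good₂ s t h)
  have t1 := t had
  have t2 := t hbd
  have t3 := t hab.symm
  rw [Step.bar_bar] at t2
  have hC : ∀ j, C j = 0 := fun j => by
    refine coeff_eq_zero hε hy.good hsum' j (dualPair a b d j) ?_ fun i hij => ?_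
    · fin_cases j
      exacts [t1.1, t1.1, t1.2.1, t1.1, t2.1, t3.2.1, t2.2.1, t2.1, t2.1, t3.2.2, t3.2.1, t3.1]
    · obtain (⟨rfl, rfl⟩ | ⟨rfl, rfl⟩) | h := ho a b d ⟨hab.1, had.1, hbd.1⟩ j i hij
      · right; right; left
        change trWord ε₀ y [a, a.bar, d.bar, d] = 0
        rw [trWord_four, if_pos rfl, if_pos (Step.bar_bar d).symm]
        exact form_of_not ε₀ (t := d.bar) had.1 fun hc => a3 hc.2.2.2
      · right; right; left
        change trWord ε₀ y [b, b.bar, d, d.bar] = 0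
        rw [trWord_four, if_pos rfl, if_pos rfl]
        exact form_of_not ε₀ hbd.1 fun hc => b3 hc.2.2.2
      · exact h.imp_right .inl
  have hc : ∀ i, c i = 0 := fun i => by
    fin_cases i
    exacts [hC 0, hC 1, hC 2, hC 3]
  have hc' : ∀ i, c' i = 0 := fun i => by
    fin_cases i
    exacts [hC 4, hC 5, hC 6, hC 7, hC 8, hC 9, hC 10, hC 11]
  simp only [hc', zero_smul, Finset.sum_const_zero, zero_add] at hx0
  refine ⟨z1 - G k ε₀ (y + vec b + vec a) d.bar * z2, ?_, ?_⟩
  · have : G k ε₀ (y + vec a) b * (G k ε₀ (y + vec b + vec a) d.bar * z2) = 0 := by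
      rw [← mul_assoc, add_right_comm, G_mul_G_eq_zero hya.good.inX (fun hc => a3 hc.2.2.1)
        (ne_bar_of_ne (t := d.bar) hbd.1), zero_mul]
    simp only [hc, zero_smul, Finset.sum_const_zero, zero_add]
    rw [mul_sub, this, sub_zero]
  · rw [hx0, mul_sub, neg_sub]

/-! ### Exactness at the ends -/

section End

variable {y : Fin 3 → ℤ} {l u b : Step}

theorem word_mul_idem (e : InfAlgebra k ε₀) {z : Fin 3 → ℤ} {w : List Step}
    (h : E k ε₀ (wend z w) * e = 0) : word k ε₀ z w * e = 0 := by
  rw [← word_mul_E, mul_assoc, h, mul_zero]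

/-- Representatives of the words that start with the arrow `b` at an end, modulo the right ideal
generated by the loop `b b̄`. -/
def listEnd (b u : Step) : Fin 4 → List Step := ![[b], [b, u], [b, u.bar], [b, u, u.bar]]

theorem span_listEnd (hy : Deep y) (h : l.1 ≠ u.1) (h1 : l.1 ≠ b.1) (h2 : u.1 ≠ b.1)
    (hl : ¬ InX (y + vec l.bar)) (hlb : ¬ Cot y l b) (w : List Step) :
    word k ε₀ y (b :: w) ∈
      Submodule.span k (Set.range fun i => word k ε₀ y (listEnd b u i)) ⊔ pathIdeal y b b.bar := by
  set W := Submodule.span k (Set.range fun i => word k ε₀ y (listEnd b u i)) ⊔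
      pathIdeal y b b.bar with hW
  have hF : ∀ i, word k ε₀ y (listEnd b u i) ∈ W := fun i =>
    Submodule.mem_sup_left (Submodule.subset_span ⟨i, rfl⟩)
  have a : ∀ Q, word k ε₀ y (b :: b.bar :: Q) ∈ W := fun Q =>
    Submodule.mem_sup_right (word_mem_pathIdeal _ _ _ _)
  clear_value W
  have f0 := hF 0
  have f1 := hF 1
  have f2 := hF 2
  have f3 := hF 3
  simp only [listEnd, Matrix.cons_val] at f0 f1 f2 f3
  have z : ∀ {x : InfAlgebra k ε₀}, x = 0 → x ∈ W := fun h => h ▸ W.zero_mem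
  have z1 : ∀ Q, word k ε₀ y (b :: l :: Q) ∈ W := fun Q => z (by
    rw [word_pair_eq_zero hy.good.inX (fun hc => hlb hc.symm) (ne_bar_of_ne h1.symm)])
  have z2 : ∀ Q, word k ε₀ y (b :: l.bar :: Q) ∈ W := fun Q => z (by
    rw [hy.swap₀ (t := l.bar) h1.symm, word_cons_eq_zero hy.good.inX hl])
  have f3' : word k ε₀ y [b, u.bar, u] ∈ W := by
    have := hy.star (k := k) (ε₀ := ε₀) (P := [b]) (by simp) (s := u.bar) (u := l) (Q := [])
      (S := W) h.symm
    rw [Step.bar_bar] at this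
    exact this f3 (z1 _) (z2 _)
  have key : ∀ t : Step, u.1 = t.1 → word k ε₀ y [b, t, t.bar] ∈ W → ∀ s Q,
      word k ε₀ y (b :: t :: s :: Q) ∈ W := by
    intro t ht hb s Q
    have h' : l.1 ≠ t.1 := ht ▸ h
    have h2' : t.1 ≠ b.1 := ht ▸ h2
    rcases step_six h' h1 h2' s with rfl | rfl | rfl | rfl | rfl | rfl
    · exact z (hy.cube h2'.symm h1.symm h'.symm _)
    · exact z (hy.cube (u := l.bar) h2'.symm h1.symm h'.symm _)
    · exact z (hy.sq [b] _ _)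
    · match Q with
      | [] => exact hb
      | r :: Q =>
        by_cases hr : r = b.bar
        · rw [hr, hy.loops_comm h2'.symm]
          exact a _
        · exact z (hy.word_four_eq_zero h2'.symm hr _)
    · rw [hy.swap₁ s h2']
      exact z (hy.sq [] _ _)
    · rw [hy.swap₁ b (t := b.bar) h2']
      exact a _
  match w with
  | [] => exact f0
  | t :: Q =>
    rcases step_six h h1 h2 t with ht | ht | ht | ht | ht | ht <;> rw [ht]
    · exact z1 _
    · exact z2 _
    · match Q with
      | [] => exact f1
      | s :: Q => exact key u rfl f3 s Q
    · match Q with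
      | [] => exact f2
      | s :: Q => exact key u.bar rfl (by rwa [Step.bar_bar]) s Q
    · exact z (hy.sq [] _ _)
    · exact a _

/-- Exactness before the turn at an end: the endpoint of the arrow `b` and its neighbours do not
belong to the idempotent `e`, so the right ideal of `b` is that of the loop `b b̄`. -/
theorem exact_end_before (hε : ∏ d, ε₀ d = 1) (hy : Deep y) (hu : Cot y l u) (hu' : Cot y l u.bar)
    (h1 : l.1 ≠ b.1) (h2 : u.1 ≠ b.1) (hl : ¬ InX (y + vec l.bar)) (hb : ¬ InX (y + vec b.bar))
    {e : InfAlgebra k ε₀} (e0 : E k ε₀ (y + vec b) * e = 0)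
    (e1 : E k ε₀ (y + vec b + vec u) * e = 0) (e2 : E k ε₀ (y + vec b + vec u.bar) * e = 0)
    {x : InfAlgebra k ε₀} (hx : E k ε₀ y * x = x) (hxe : x * e = x)
    (h : G k ε₀ (y + vec l) l.bar * x = 0) :
    ∃ z, x = G k ε₀ y b * G k ε₀ (y + vec b) b.bar * z := by
  have hm := exact_arrow hε hy hu hu' h1 h2 hx h
  obtain ⟨s1, ⟨z1, rfl⟩, s', hs', rfl⟩ := Submodule.mem_sup.1 hm
  obtain ⟨s2, ⟨z2, rfl⟩, s3, ⟨z3, rfl⟩, rfl⟩ := Submodule.mem_sup.1 hs'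
  simp only [LinearMap.mulLeft_apply, G_eq_zero hy.good.inX hl, G_eq_zero hy.good.inX hb, zero_mul,
    zero_add, add_zero] at *
  have hw := fun w => span_listEnd (k := k) (ε₀ := ε₀) hy hu.1 h1 h2 hl
    (not_cot_of_cot hu hu' h1 h2) w
  have := E_mul_mem (z := y + vec b) (W := Submodule.comap
    (LinearMap.mulLeft k (G k ε₀ y b)) (Submodule.span k (Set.range fun i =>
      word k ε₀ y (listEnd b u i)) ⊔ pathIdeal y b b.bar)) hw z2
  rw [Submodule.mem_comap, LinearMap.mulLeft_apply, ← mul_assoc, G_mul_E] at this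
  obtain ⟨q, hq, s, ⟨z, rfl⟩, he⟩ := Submodule.mem_sup.1 this
  obtain ⟨c, rfl⟩ := (Submodule.mem_span_range_iff_exists_fun k).1 hq
  refine ⟨z * e, ?_⟩
  rw [← mul_assoc, ← hxe, ← he, add_mul, LinearMap.mulLeft_apply, Finset.sum_mul,
    Finset.sum_eq_zero, zero_add]
  intro i _
  rw [smul_mul_assoc, word_mul_idem, smul_zero]
  fin_cases i
  · exact e0
  · exact e1
  · exact e2
  · change E k ε₀ (y + vec b + vec u + vec u.bar) * e = 0
    rw [add_vec_bar]
    exact e0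

/-- Exactness after the turn at an end: on the elements fixed by `e`, the kernel of the loop
`b b̄` is the right ideal of the arrow `l` along the chord. -/
theorem exact_end_after (hε : ∏ d, ε₀ d = 1) (hy : Deep y) (hu : Cot y b u) (hu' : Cot y b u.bar)
    (h1 : b.1 ≠ l.1) (h2 : u.1 ≠ l.1) (hl : ¬ InX (y + vec l.bar)) (hb : ¬ InX (y + vec b.bar))
    {e : InfAlgebra k ε₀} (hE : ∀ z, E k ε₀ z * e = E k ε₀ z ∨ E k ε₀ z * e = 0)
    (e0 : E k ε₀ (y + vec b) * e = 0)
    (e1 : E k ε₀ (y + vec b + vec u) * e = 0) (e2 : E k ε₀ (y + vec b + vec u.bar) * e = 0)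
    {x : InfAlgebra k ε₀} (hx : E k ε₀ y * x = x) (hxe : x * e = x)
    (h : G k ε₀ y b * G k ε₀ (y + vec b) b.bar * x = 0) :
    ∃ z, x = G k ε₀ y l * z := by
  have hm := E_mul_mem (span_listArrow (k := k) (ε₀ := ε₀) hy hu.1 h1 h2) x
  rw [hx] at hm
  obtain ⟨q, hq, s, hs, rfl⟩ := Submodule.mem_sup.1 hm
  obtain ⟨c, rfl⟩ := (Submodule.mem_span_range_iff_exists_fun k).1 hq
  obtain ⟨s1, ⟨z1, rfl⟩, s', hs', rfl⟩ := Submodule.mem_sup.1 hs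
  obtain ⟨s2, ⟨z, rfl⟩, s3, ⟨z3, rfl⟩, rfl⟩ := Submodule.mem_sup.1 hs'
  simp only [LinearMap.mulLeft_apply, G_eq_zero hy.good.inX hl, G_eq_zero hy.good.inX hb, zero_mul,
    zero_add, add_zero] at *
  -- multiplication by `e` kills the words that end outside and fixes the others
  have hd : ∀ i, ∃ δ : k, word k ε₀ y (listArrow b u i) * e = δ • word k ε₀ y (listArrow b u i) ∧
      (i ∈ ({1, 4, 5, 7} : Finset (Fin 8)) → δ = 0) := by
    intro i
    by_cases hi : i ∈ ({1, 4, 5, 7} : Finset (Fin 8))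
    · refine ⟨0, ?_, fun _ => rfl⟩
      rw [zero_smul, word_mul_idem]
      fin_cases hi
      · exact e0
      · exact e1
      · exact e2
      · change E k ε₀ (y + vec b + vec u + vec u.bar) * e = 0
        rw [add_vec_bar]
        exact e0
    · obtain h' | h' := hE (wend y (listArrow b u i))
      · exact ⟨1, by rw [← word_mul_E, mul_assoc, h', one_smul], fun h => absurd h hi⟩
      · exact ⟨0, by rw [word_mul_idem e h', zero_smul], fun _ => rfl⟩
  choose δ hδ hδ0 using hd
  have hbl : G k ε₀ y b * G k ε₀ (y + vec b) b.bar * (G k ε₀ y l * (z * e)) = 0 := by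
    have : word k ε₀ y [b, b.bar, l] = 0 := by
      rw [hy.swap₁ b (s := b.bar) h1,
        word_pair_eq_zero hy.good.inX (not_cot_of_cot hu hu' h1 h2) (ne_bar_of_ne h1)]
    rw [word_cons, word_cons, add_vec_bar, word_singleton] at this
    rw [← mul_assoc, mul_assoc (G k ε₀ y b), this, zero_mul]
  have hxe' : ∑ i, c i • word k ε₀ y (listArrow b u i) + G k ε₀ y l * z =
      ∑ i, (c i * δ i) • word k ε₀ y (listArrow b u i) + G k ε₀ y l * (z * e) := by
    rw [← hxe, add_mul, Finset.sum_mul, mul_assoc]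
    simp only [smul_mul_assoc, hδ, smul_smul]
  rw [hxe', mul_add, hbl, add_zero, Finset.mul_sum] at h
  have hcons : ∀ p, G k ε₀ y b * G k ε₀ (y + vec b) b.bar * word k ε₀ y p =
      word k ε₀ y (b :: b.bar :: p) := fun p => by
    rw [word_cons, word_cons, add_vec_bar, mul_assoc]
  simp only [mul_smul_comm, hcons] at h
  have t : ∀ {s t : Step}, Cot y s t → _ := fun {s t} h => trace_rhombus (ε₀ := ε₀) h hy.good
    (hy.good₁ s h.2.1) (hy.good₁ t h.2.2.1) (hy.good₂ s t h)
  have t1 := (t hu).1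
  have t2 := (t hu').1
  rw [Step.bar_bar] at t2
  have ho : ∀ b u : Step, b.1 ≠ u.1 → ∀ j i, i ∉ ({1, 4, 5, 7} : Finset (Fin 8)) → i ≠ j →
      (b :: b.bar :: listArrow b u i).length + ((![[u, u.bar], [], [u.bar], [u], [], [], [], []] :
        Fin 8 → List Step) j).length ≠ 4 ∨
      ((b :: b.bar :: listArrow b u i).map pv).sum ≠
        ((b :: b.bar :: listArrow b u j).map pv).sum := by
    decide +kernel
  have hc : ∀ j, c j * δ j = 0 := fun j => by
    by_cases hj : j ∈ ({1, 4, 5, 7} : Finset (Fin 8))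
    · rw [hδ0 j hj, mul_zero]
    refine coeff_eq_zero hε hy.good h j
      ((![[u, u.bar], [], [u.bar], [u], [], [], [], []] : Fin 8 → List Step) j) ?_ fun i hij => ?_
    · revert hj
      fin_cases j <;> intro hj
      exacts [t1, absurd (by decide) hj, t1, t2, absurd (by decide) hj, absurd (by decide) hj, t1,
        absurd (by decide) hj]
    · by_cases hi : i ∈ ({1, 4, 5, 7} : Finset (Fin 8))
      · right; right; right
        rw [hδ0 i hi, mul_zero, zero_smul]
      · exact (ho b u hu.1 j i hi hij).imp_right .inl
  refine ⟨z * e, ?_⟩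
  rw [hxe']
  simp only [hc, zero_smul, Finset.sum_const_zero, zero_add]

end End

end Rauzy

/-! ### Periodic modules from cyclic complexes -/

section Cyclic

variable {A : Type u} [NonUnitalRing A] {e : A} (he : IsIdempotentElem e)

/-- The projective right module `f₀Ae ⊕ f₁Ae` over `eAe`. -/
def Column (_ : IsIdempotentElem e) (f : Fin 2 → A) : AddSubgroup (Fin 2 → A) where
  carrier := {x | ∀ i, f i * x i = x i ∧ x i * e = x i}
  zero_mem' := fun i => ⟨mul_zero _, zero_mul _⟩
  add_mem' := fun {x y} hx hy i => by
    simp only [Pi.add_apply, mul_add, add_mul, (hx i).1, (hx i).2, (hy i).1, (hy i).2, and_self]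
  neg_mem' := fun {x} hx i => by
    simp only [Pi.neg_apply, mul_neg, neg_mul, (hx i).1, (hx i).2, and_self]

namespace Column

variable {he} {f : Fin 2 → A}

instance : Module (he.Corner)ᵐᵒᵖ (Column he f) where
  smul r x := ⟨fun i => x.1 i * r.unop.1, fun i => by
    have hr := (Subsemigroup.mem_corner_iff he).1 r.unop.2
    exact ⟨by rw [← mul_assoc, (x.2 i).1], by rw [mul_assoc, hr.2]⟩⟩
  one_smul x := Subtype.ext (funext fun i => (x.2 i).2)
  mul_smul r s x := Subtype.ext (funext fun i => (mul_assoc _ _ _).symm)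
  smul_zero r := Subtype.ext (funext fun i => zero_mul _)
  smul_add r x y := Subtype.ext (funext fun i => add_mul _ _ _)
  add_smul r s x := Subtype.ext (funext fun i => mul_add _ _ _)
  zero_smul x := Subtype.ext (funext fun i => mul_zero _)

theorem ext {x y : Column he f} (h : ∀ i, x.1 i = y.1 i) : x = y := Subtype.ext (funext h)

/-- The entries of a column belong to `eAe`. -/
def entry (hef : ∀ i, e * f i = f i) (x : Column he f) (i : Fin 2) : he.Corner :=
  ⟨x.1 i, (Subsemigroup.mem_corner_iff he).2
    ⟨by rw [← (x.2 i).1, ← mul_assoc, hef], (x.2 i).2⟩⟩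

/-- The inclusion of a column into the free module. -/
def toFree (hef : ∀ i, e * f i = f i) :
    Column he f →ₗ[(he.Corner)ᵐᵒᵖ] (Fin 2 → (he.Corner)ᵐᵒᵖ) where
  toFun x i := MulOpposite.op (entry hef x i)
  map_add' _ _ := rfl
  map_smul' _ _ := rfl

/-- The projection of the free module onto a column. -/
def ofFree (hf : ∀ i, f i * f i = f i) :
    (Fin 2 → (he.Corner)ᵐᵒᵖ) →ₗ[(he.Corner)ᵐᵒᵖ] Column he f where
  toFun x := ⟨fun i => f i * (x i).unop.1, fun i =>
    ⟨by rw [← mul_assoc, hf], by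
      rw [mul_assoc, ((Subsemigroup.mem_corner_iff he).1 (x i).unop.2).2]⟩⟩
  map_add' _ _ := ext fun i => mul_add _ _ _
  map_smul' _ _ := ext fun i => (mul_assoc _ _ _).symm

theorem ofFree_toFree (hf : ∀ i, f i * f i = f i) (hef : ∀ i, e * f i = f i)
    (x : Column he f) : ofFree hf (toFree hef x) = x :=
  ext fun i => by
    change f i * x.1 i = x.1 i
    exact (x.2 i).1

theorem projective (hf : ∀ i, f i * f i = f i) (hef : ∀ i, e * f i = f i) :
    Module.Projective (he.Corner)ᵐᵒᵖ (Column he f) :=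
  .of_split (toFree hef) (ofFree hf) (LinearMap.ext fun x => ofFree_toFree hf hef x)

theorem finite (hf : ∀ i, f i * f i = f i) (hef : ∀ i, e * f i = f i) :
    Module.Finite (he.Corner)ᵐᵒᵖ (Column he f) :=
  .of_surjective (ofFree hf) fun x => ⟨_, ofFree_toFree hf hef x⟩

/-- The generators of a column. -/
def gen (hf : ∀ i, f i * f i = f i) (hfe : ∀ i, f i * e = f i) (i : Fin 2) : Column he f :=
  ⟨Pi.single i (f i), fun i' => by
    by_cases h : i' = i
    · subst h; simp [hf, hfe]
    · simp [h]⟩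

theorem eq_sum_gen (hf : ∀ i, f i * f i = f i) (hef : ∀ i, e * f i = f i)
    (hfe : ∀ i, f i * e = f i) (x : Column he f) :
    x = ∑ i, MulOpposite.op (entry hef x i) • gen hf hfe i := by
  refine ext fun i => ?_
  rw [Fin.sum_univ_two]
  change x.1 i = (gen (he := he) hf hfe 0).1 i * x.1 0 + (gen (he := he) hf hfe 1).1 i * x.1 1
  fin_cases i <;> simp [gen, (x.2 _).1]

end Column

/-- A complex of columns over `eAe`, indexed by a type with a self-map `next`, that is exact
everywhere and minimal with respect to a filtration `F` of `A`. The entries of the matrix `d j`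
give the differential from the column at `next j` to the column at `j`. The filtration takes the
place of the powers of the radical: the differentials lie in its first step, and it vanishes on
each column after `bound` steps. -/
structure MinimalComplex (e : A) (ι : Type) where
  next : ι → ι
  f : ι → Fin 2 → A
  d : ι → Fin 2 → Fin 2 → A
  idem : ∀ j i, f j i * f j i = f j i
  left : ∀ j i, e * f j i = f j i
  right : ∀ j i, f j i * e = f j i
  f_mul_d : ∀ j i i', f j i * d j i i' = d j i i'
  d_mul_f : ∀ j i i', d j i i' * f (next j) i' = d j i i'
  d_mul_d : ∀ j i i'', d j i 0 * d (next j) 0 i'' + d j i 1 * d (next j) 1 i'' = 0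
  exact : ∀ j (x : Fin 2 → A), (∀ i, f (next j) i * x i = x i ∧ x i * e = x i) →
    (∀ i, d j i 0 * x 0 + d j i 1 * x 1 = 0) →
      ∃ w : Fin 2 → A, ∀ i, x i = d (next j) i 0 * w 0 + d (next j) i 1 * w 1
  F : ℕ → AddSubgroup A
  F_zero : ∀ x, x ∈ F 0
  mul_mem : ∀ m n x y, x ∈ F m → y ∈ F n → x * y ∈ F (m + n)
  d_mem : ∀ j i i', d j i i' ∈ F 1
  bound : ℕ
  eq_zero : ∀ j i x, f j i * x = x → x ∈ F bound → x = 0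

namespace MinimalComplex

variable {ι : Type} (C : MinimalComplex e ι)

/-- The differential with target the column at `j`. -/
def diff (j : ι) : Column he (C.f (C.next j)) →ₗ[(he.Corner)ᵐᵒᵖ] Column he (C.f j) where
  toFun x := ⟨fun i => C.d j i 0 * x.1 0 + C.d j i 1 * x.1 1, fun i => by
    simp only [mul_add, add_mul, ← mul_assoc, C.f_mul_d, true_and]
    simp only [mul_assoc, (x.2 _).2]⟩
  map_add' x y := Column.ext fun i => by
    change C.d j i 0 * (x.1 0 + y.1 0) + C.d j i 1 * (x.1 1 + y.1 1) =
      (C.d j i 0 * x.1 0 + C.d j i 1 * x.1 1) + (C.d j i 0 * y.1 0 + C.d j i 1 * y.1 1)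
    rw [mul_add, mul_add]; abel
  map_smul' r x := Column.ext fun i => by
    change C.d j i 0 * (x.1 0 * r.unop.1) + C.d j i 1 * (x.1 1 * r.unop.1) =
      (C.d j i 0 * x.1 0 + C.d j i 1 * x.1 1) * r.unop.1
    rw [add_mul, mul_assoc, mul_assoc]

theorem diff_val (j : ι) (x : Column he (C.f (C.next j))) (i : Fin 2) :
    (C.diff he j x).1 i = C.d j i 0 * x.1 0 + C.d j i 1 * x.1 1 := rfl

/-- Exactness carries over to the columns over `eAe`: multiply a preimage by idempotents on
both sides. -/
theorem ker_diff (j : ι) :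
    LinearMap.ker (C.diff he j) = LinearMap.range (C.diff he (C.next j)) := by
  apply le_antisymm
  · intro x hx
    obtain ⟨w, hw⟩ := C.exact j x.1 x.2 fun i =>
      congrArg (fun y : Column he (C.f j) => y.1 i) (LinearMap.mem_ker.1 hx)
    refine ⟨⟨fun i => C.f (C.next (C.next j)) i * w i * e, fun i => ?_⟩, Column.ext fun i => ?_⟩
    · rw [← mul_assoc, ← mul_assoc, C.idem, mul_assoc _ e e, he.eq]
      exact ⟨rfl, rfl⟩
    · rw [diff_val, ← (x.2 i).2, hw i, add_mul]
      simp only [← mul_assoc, C.d_mul_f]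
  · rintro _ ⟨x, rfl⟩
    refine LinearMap.mem_ker.2 (Column.ext fun i => ?_)
    change _ = (0 : A)
    have h0 := C.d_mul_d j i 0
    have h1 := C.d_mul_d j i 1
    simp only [diff_val, mul_add, ← mul_assoc]
    calc _ = (C.d j i 0 * C.d (C.next j) 0 0 + C.d j i 1 * C.d (C.next j) 1 0) * x.1 0 +
          (C.d j i 0 * C.d (C.next j) 0 1 + C.d j i 1 * C.d (C.next j) 1 1) * x.1 1 := by
            simp only [add_mul]; abel
      _ = 0 := by rw [h0, h1, zero_mul, zero_mul, add_zero]

/-- The image of a differential. -/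
def image (j : ι) : ModuleCat.{u} (he.Corner)ᵐᵒᵖ :=
  .of _ (LinearMap.range (C.diff he j))

/-- The kernel of a differential lies in the first step of the filtration, and the filtration is
finite on the columns; so Nakayama's argument shows that the kernel is superfluous. -/
theorem eq_top_of_sup_ker (j : ι) (N : Submodule (he.Corner)ᵐᵒᵖ (Column he (C.f (C.next j))))
    (hN : N ⊔ LinearMap.ker (C.diff he j) = ⊤) : N = ⊤ := by
  have key : ∀ (m : ℕ) (x : Column he (C.f (C.next j))),
      ∃ n ∈ N, ∀ i, (x - n).1 i ∈ C.F m := by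
    intro m
    induction m with
    | zero => exact fun x => ⟨0, N.zero_mem, fun i => C.F_zero _⟩
    | succ m ih =>
      intro x
      obtain ⟨n, hn, hq⟩ := ih x
      have hg : ∀ i, ∃ n' ∈ N, ∀ i', (Column.gen (he := he) (C.idem _) (C.right _) i - n').1 i' ∈
          C.F 1 := by
        intro i
        obtain ⟨n', hn', κ, hκ, h⟩ := Submodule.mem_sup.1
          (hN ▸ Submodule.mem_top : Column.gen (he := he) (C.idem _) (C.right _) i ∈
            N ⊔ LinearMap.ker (C.diff he j))
        refine ⟨n', hn', fun i' => ?_⟩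
        rw [← h, add_sub_cancel_left]
        rw [ker_diff] at hκ
        obtain ⟨w, rfl⟩ := hκ
        exact add_mem (C.mul_mem 1 0 _ _ (C.d_mem _ _ _) (C.F_zero _))
          (C.mul_mem 1 0 _ _ (C.d_mem _ _ _) (C.F_zero _))
      choose g hgN hg using hg
      set q := x - n with hqdef
      refine ⟨n + ∑ i, MulOpposite.op (Column.entry (C.left _) q i) • g i,
        N.add_mem hn (N.sum_mem fun i _ => N.smul_mem _ (hgN i)), fun i => ?_⟩
      have e1 : x - (n + ∑ i, MulOpposite.op (Column.entry (C.left _) q i) • g i) =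
          ∑ i, MulOpposite.op (Column.entry (C.left _) q i) •
            (Column.gen (he := he) (C.idem _) (C.right _) i - g i) := by
        rw [← sub_sub, ← hqdef]
        conv_lhs => lhs; rw [Column.eq_sum_gen (C.idem _) (C.left _) (C.right _) q]
        simp only [smul_sub, Finset.sum_sub_distrib]
      rw [e1, Fin.sum_univ_two, add_comm m 1]
      exact add_mem (C.mul_mem _ _ _ _ (hg 0 i) (hq 0)) (C.mul_mem _ _ _ _ (hg 1 i) (hq 1))
  refine (Submodule.eq_top_iff').2 fun x => ?_
  obtain ⟨n, hn, h⟩ := key C.bound x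
  have : x - n = 0 := Column.ext fun i => C.eq_zero _ i _ ((x - n).2 i).1 (h i)
  rwa [sub_eq_zero.1 this]

/-- The differential is a projective cover of its image, and its kernel is the image of the next
one. -/
theorem isOmega_image (j : ι) : IsOmega (C.image he j) (C.image he (C.next j)) := by
  have h := LinearMap.ker_rangeRestrict (C.diff he j)
  exact ⟨.of _ (Column he (C.f (C.next j))), (C.diff he j).rangeRestrict,
    ⟨Column.projective (C.idem _) (C.left _), LinearMap.surjective_rangeRestrict _,
      fun N hN => C.eq_top_of_sup_ker he j N ((congrArg (N ⊔ ·) h).symm.trans hN)⟩,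
    ⟨LinearEquiv.ofEq _ _ ((C.ker_diff he j).symm.trans h.symm)⟩⟩

/-- Iterated syzygies are obtained by moving along the complex. -/
theorem isOmegaPow_image (n : ℕ) (j : ι) :
    IsOmegaPow n (C.image he j) (C.image he (C.next^[n] j)) := by
  induction n generalizing j with
  | zero => exact ⟨LinearEquiv.refl _ _⟩
  | succ n ih => exact ⟨_, C.isOmega_image he j, ih _⟩

/-- If the complex is cyclic, the images of its nonzero differentials are periodic. -/
theorem isPeriodicModule_image {j : ι} {n : ℕ} (hn : 1 ≤ n) (hj : C.next^[n] j = j)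
    {i i' : Fin 2} (hd : C.d j i i' ≠ 0) : IsPeriodicModule (C.image he j) := by
  refine ⟨?_, ?_, n, hn, ?_⟩
  · have := Column.finite (he := he) (C.idem (C.next j)) (C.left _)
    exact inferInstanceAs (Module.Finite _ (LinearMap.range (C.diff he j)))
  · refine ⟨⟨_, Column.gen (C.idem _) (C.right _) i', rfl⟩, 0, fun h => hd ?_⟩
    have h1 : (C.diff he j (Column.gen (C.idem _) (C.right _) i')).1 i = 0 :=
      congrArg (fun y : LinearMap.range (C.diff he j) => y.1.1 i) h
    rw [← C.d_mul_f, ← h1, diff_val]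
    fin_cases i' <;> simp [Column.gen]
  · have := C.isOmegaPow_image he n j
    rwa [hj] at this

end MinimalComplex

end Cyclic

namespace Rauzy

/-! ### Integer certificates for heights -/

/-- Triples of integers, for computations with lifted points. -/
abbrev Triple : Type := ℤ × ℤ × ℤ

/-- The point of `ℤ³` given by a triple. -/
def pt (q : Triple) : Fin 3 → ℤ := ![q.1, q.2.1, q.2.2]

/-- The vector of a step as a triple. -/
def svec (s : Step) : Triple :=
  (if s.1 = 0 then s.2 else 0, if s.1 = 1 then s.2 else 0, if s.1 = 2 then s.2 else 0)

theorem pt_add (p q : Triple) : pt (p + q) = pt p + pt q := by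
  ext j; fin_cases j <;> rfl

theorem pt_sub (p q : Triple) : pt (p - q) = pt p - pt q := by
  ext j; fin_cases j <;> rfl

theorem pt_svec (s : Step) : pt (svec s) = vec s := by
  obtain ⟨a, e⟩ := s
  ext j
  fin_cases a <;> fin_cases j <;> simp [pt, svec, vec]

theorem add_pt_add_vec (τ : Fin 3 → ℤ) (p : Triple) (s : Step) :
    τ + pt p + vec s = τ + pt (p + svec s) := by
  rw [pt_add, pt_svec, add_assoc]

theorem ht_pt (q : Triple) :
    ht (pt q) = q.1 + (q.2.1 + q.2.2) * lam + q.2.1 * lam ^ 2 := by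
  simp [ht, pt, hgt]; ring

theorem lam_bounds : 0.5436 < lam ∧ lam < 0.5437 ∧ 0.2955 < lam ^ 2 ∧ lam ^ 2 < 0.2957 := by
  have h := lam_eq
  have h0 := lam_pos
  have h1 : 0.5436 < lam := by
    by_contra hc
    push Not at hc
    have h2 : lam ^ 2 ≤ 0.5436 ^ 2 := by gcongr
    have h3 : lam ^ 3 ≤ 0.5436 ^ 3 := by gcongr
    norm_num at h2 h3 hc
    linarith
  have h1' : lam < 0.5437 := by
    by_contra hc
    push Not at hc
    have h2 : 0.5437 ^ 2 ≤ lam ^ 2 := by gcongr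
    have h3 : 0.5437 ^ 3 ≤ lam ^ 3 := by gcongr
    norm_num at h2 h3 hc
    linarith
  refine ⟨h1, h1', ?_, ?_⟩ <;> nlinarith

/-- A sufficient condition, in terms of decimal bounds for `λ` and `λ²`, for a triple to have
nonnegative height. -/
def Nonneg (q : Triple) : Prop :=
  0 ≤ 10000 * q.1 + min (5436 * (q.2.1 + q.2.2)) (5437 * (q.2.1 + q.2.2)) +
    min (2955 * q.2.1) (2957 * q.2.1)

instance (q : Triple) : Decidable (Nonneg q) := by unfold Nonneg; infer_instance

theorem Nonneg.ht_nonneg {q : Triple} (h : Nonneg q) : 0 ≤ ht (pt q) := by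
  obtain ⟨a, b, c⟩ := q
  rw [ht_pt]
  simp only [Nonneg] at h ⊢
  obtain ⟨h1, h2, h3, h4⟩ := lam_bounds
  have key : ∀ (n : ℤ) (x : ℝ) (l u : ℤ), (l : ℝ) ≤ 10000 * x → 10000 * x ≤ u →
      ((min (l * n) (u * n) : ℤ) : ℝ) ≤ 10000 * (n * x) := by
    intro n x l u hl hu
    rcases le_total 0 n with hn | hn
    · have hn' : (0 : ℝ) ≤ n := by exact_mod_cast hn
      have : ((min (l * n) (u * n) : ℤ) : ℝ) ≤ ((l * n : ℤ) : ℝ) := by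
        exact_mod_cast min_le_left _ _
      push_cast at this ⊢
      nlinarith
    · have hn' : (n : ℝ) ≤ 0 := by exact_mod_cast hn
      have : ((min (l * n) (u * n) : ℤ) : ℝ) ≤ ((u * n : ℤ) : ℝ) := by
        exact_mod_cast min_le_right _ _
      push_cast at this ⊢
      nlinarith
  have k1 := key (b + c) lam 5436 5437 (by norm_num; linarith) (by norm_num; linarith)
  have k2 := key b (lam ^ 2) 2955 2957 (by norm_num; linarith) (by norm_num; linarith)
  have h' : (0 : ℝ) ≤ 10000 * a + ((min (5436 * (b + c)) (5437 * (b + c)) : ℤ) : ℝ) +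
      ((min (2955 * b) (2957 * b) : ℤ) : ℝ) := by exact_mod_cast h
  push_cast at k1 k2 h' ⊢
  linarith

/-! ### Chords -/

/-- The lower end of the interval for the height of the start of a chord, as the height of a triple.
The interval is narrow enough to determine which points near the chord lie between the two bounding
planes. -/
def chordLower : Triple := (0, 0, 1)

/-- The upper end of the interval for the height of the start of a chord, as the height of a
triple. -/
def chordUpper : Triple := (4, -4, 0)

/-- The point lies between the two bounding planes, for every height of the start in the given
interval. -/
def Inside (p : Triple) : Prop := Nonneg (chordLower + p) ∧ Nonneg ((1, 1, 1) - chordUpper - p)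

/-- The point does not lie between the two bounding planes, for every height of the start in the
given interval. -/
def Outside (p : Triple) : Prop := Nonneg (chordLower + p - (1, 1, 1)) ∨ Nonneg (-chordUpper - p)

instance (p : Triple) : Decidable (Inside p) := by unfold Inside; infer_instance

instance (p : Triple) : Decidable (Outside p) := by unfold Outside; infer_instance

/-- The vertices on a chord, relative to its start. -/
def chordPts : List Triple :=
  [(0, 0, 0), (0, 1, 0), (0, 2, 0), (-1, 1, 0), (-1, 2, 0), (-1, 3, 0), (-2, 2, 0), (-2, 3, 0),
    (-2, 4, 0), (-3, 3, 0), (-3, 4, 0), (-3, 5, 0), (-4, 5, 0), (-4, 6, 0), (-5, 6, 0)]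

/-- The vertices beyond the two ends of a chord. -/
def chordEnds : List Triple :=
  [(1, 0, -1), (1, 0, 0), (1, 0, 1), (-5, 7, -1), (-5, 7, 0), (-5, 7, 1)]

/-- The vertices of the rhombi at the vertices of a chord. -/
def chordHull : List Triple :=
  chordPts ++ chordEnds ++
  [(-5, 6, -1), (-5, 6, 1), (-4, 5, -1), (-4, 5, 1), (-4, 6, -1), (-4, 6, 1), (-3, 3, 1),
    (-3, 4, -1), (-3, 4, 1), (-3, 5, -1), (-3, 5, 1), (-2, 2, 1), (-2, 3, -1), (-2, 3, 1),
    (-2, 4, -1), (-1, 1, 1), (-1, 2, -1), (-1, 2, 1), (-1, 3, -1), (0, 0, -1), (0, 0, 1),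
    (0, 1, -1), (0, 1, 1), (0, 2, -1)]

/-- A horizontal strip of vertices of `P_i` that joins two boundary vertices of `P_i`, with lifts
that start at `τ`. The tiling is known around the vertices of the strip and of the rhombi at it. -/
structure Chord (i : ℕ) (τ : Fin 3 → ℤ) : Prop where
  lower : ht (pt chordLower) ≤ ht τ
  upper : ht τ < ht (pt chordUpper)
  good : ∀ p ∈ chordHull, Good (τ + pt p)
  mem : ∀ p ∈ chordPts, proj (τ + pt p) ∈ patchPts i
  not_mem : ∀ p ∈ chordEnds, proj (τ + pt p) ∉ patchPts i

namespace Chord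

variable {i : ℕ} {τ : Fin 3 → ℤ}

theorem inX (hc : Chord i τ) {p : Triple} (h : Inside p) : InX (τ + pt p) := by
  obtain ⟨h1, h2⟩ := h
  have h1 := h1.ht_nonneg
  have h2 := h2.ht_nonneg
  have h3 := hc.lower
  have h4 := hc.upper
  have h5 : ht (pt (1, 1, 1)) = hgt 0 + hgt 1 + hgt 2 := by simp [ht, pt]
  rw [pt_add, ht_add] at h1
  rw [pt_sub, pt_sub, ht_sub, ht_sub] at h2
  rw [InX, ht_add]
  constructor <;> linarith

theorem not_inX (hc : Chord i τ) {p : Triple} (h : Outside p) : ¬ InX (τ + pt p) := by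
  intro hX
  have h3 := hc.lower
  have h4 := hc.upper
  have h5 : ht (pt (1, 1, 1)) = hgt 0 + hgt 1 + hgt 2 := by simp [ht, pt]
  rw [InX, ht_add] at hX
  obtain h | h := h
  · have h1 := h.ht_nonneg
    rw [pt_sub, pt_add, ht_sub, ht_add] at h1
    linarith
  · have h1 := h.ht_nonneg
    have e : -chordUpper - p = 0 - chordUpper - p := by rw [zero_sub]
    have e0 : ht (pt 0) = 0 := by simp [ht, pt]
    rw [e, pt_sub, pt_sub, ht_sub, ht_sub, e0] at h1
    linarith

end Chord

/-- The condition `Cot` at a point relative to the start of a chord. -/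
def CotAt (p : Triple) (s t : Step) : Prop :=
  s.1 ≠ t.1 ∧ Inside (p + svec s) ∧ Inside (p + svec t) ∧ Inside (p + svec s + svec t)

/-- The negation of `Cot` at a point relative to the start of a chord. -/
def NotCotAt (p : Triple) (s t : Step) : Prop :=
  s.1 = t.1 ∨ Outside (p + svec s) ∨ Outside (p + svec t) ∨ Outside (p + svec s + svec t)

instance (p : Triple) (s t : Step) : Decidable (CotAt p s t) := by unfold CotAt; infer_instance

instance (p : Triple) (s t : Step) : Decidable (NotCotAt p s t) := by
  unfold NotCotAt; infer_instance

namespace Chord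

variable {i : ℕ} {τ : Fin 3 → ℤ}

theorem cot (hc : Chord i τ) {p : Triple} {s t : Step} (h : CotAt p s t) : Cot (τ + pt p) s t :=
  ⟨h.1, by rw [add_pt_add_vec]; exact hc.inX h.2.1, by rw [add_pt_add_vec]; exact hc.inX h.2.2.1,
    by rw [add_pt_add_vec, add_pt_add_vec]; exact hc.inX h.2.2.2⟩

theorem not_cot (hc : Chord i τ) {p : Triple} {s t : Step} (h : NotCotAt p s t) :
    ¬ Cot (τ + pt p) s t := by
  rintro ⟨h0, h1, h2, h3⟩
  rw [add_pt_add_vec] at h1 h2 h3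
  rw [add_pt_add_vec] at h3
  rcases h with h | h | h | h
  exacts [h0 h, hc.not_inX h h1, hc.not_inX h h2, hc.not_inX h h3]

theorem not_inX_step (hc : Chord i τ) {p : Triple} {s : Step} (h : Outside (p + svec s)) :
    ¬ InX (τ + pt p + vec s) := by
  rw [add_pt_add_vec]
  exact hc.not_inX h

set_option synthInstance.maxSize 1000 in
set_option synthInstance.maxHeartbeats 200000 in
theorem chordHull_step : ∀ p ∈ chordPts, p ∈ chordHull ∧
    (∀ s : Step, p + svec s ∈ chordHull ∨ Outside (p + svec s)) ∧
    ∀ s t : Step, p + svec s + svec t ∈ chordHull ∨ NotCotAt p s t := by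
  decide +kernel

theorem deep (hc : Chord i τ) {p : Triple} (hp : p ∈ chordPts) : Deep (τ + pt p) := by
  obtain ⟨h0, h1, h2⟩ := chordHull_step p hp
  refine ⟨hc.good p h0, fun s hs => ?_, fun s t hst => ?_⟩
  · rcases h1 s with h | h
    · rw [add_pt_add_vec]
      exact hc.good _ h
    · exact absurd hs (hc.not_inX_step h)
  · rcases h2 s t with h | h
    · rw [add_pt_add_vec, add_pt_add_vec]
      exact hc.good _ h
    · exact absurd hst (hc.not_cot h)

end Chord

/-! ### The idempotent of a patch -/

section Idem

variable {k : Type u} [Field k] {ε₀ : Fin 3 → ℤˣ}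

theorem patchIdem_eq_sum (i : ℕ) : patchIdem k ε₀ i = mk k ε₀ (∑ x ∈ patchPts i, idemAt k x) := by
  rw [patchIdem, patchVertices, Finset.sum_map, ← Finset.sum_attach (patchPts i)]
  refine congrArg (mk k ε₀) (Finset.sum_congr rfl fun x _ => ?_)
  rw [idemAt, dif_pos (isVertex_of_mem_patchPts x.2)]
  rfl

theorem E_mul_patchIdem_of_mem {i : ℕ} {z : Fin 3 → ℤ} (h : proj z ∈ patchPts i) :
    E k ε₀ z * patchIdem k ε₀ i = E k ε₀ z := by
  rw [patchIdem_eq_sum, E, ← mk_mul, Finset.mul_sum, Finset.sum_eq_single (proj z), idemAt_mul_self]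
  · exact fun x _ hx => idemAt_mul_idemAt k hx.symm
  · exact fun h' => absurd h h'

theorem patchIdem_mul_E_of_mem {i : ℕ} {z : Fin 3 → ℤ} (h : proj z ∈ patchPts i) :
    patchIdem k ε₀ i * E k ε₀ z = E k ε₀ z := by
  rw [patchIdem_eq_sum, E, ← mk_mul, Finset.sum_mul, Finset.sum_eq_single (proj z), idemAt_mul_self]
  · exact fun x _ hx => idemAt_mul_idemAt k hx
  · exact fun h' => absurd h h'

theorem E_mul_patchIdem_of_not_mem {i : ℕ} {z : Fin 3 → ℤ} (h : proj z ∉ patchPts i) :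
    E k ε₀ z * patchIdem k ε₀ i = 0 := by
  rw [patchIdem_eq_sum, E, ← mk_mul, Finset.mul_sum, Finset.sum_eq_zero, map_zero]
  exact fun x hx => idemAt_mul_idemAt k fun e => h (e ▸ hx)

end Idem

/-! ### The radical filtration -/

section Filtration

open PathAlgebra

variable (k : Type u) [Field k] (ε₀ : Fin 3 → ℤˣ)

/-- The span of the paths of length at least `m`. -/
def radPow (m : ℕ) : Submodule k (InfAlgebra k ε₀) :=
  Submodule.span k {x | ∃ p : QPath Vertex, m ≤ p.2.2.length ∧ mk k ε₀ (ofPath k p) = x}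

variable {k ε₀}

theorem radPow_zero (x : InfAlgebra k ε₀) : x ∈ radPow k ε₀ 0 := by
  have h : x ∈ Submodule.span k (Set.range fun p : QPath Vertex => mk k ε₀ (ofPath k p)) := by
    rw [span_range_mk_ofPath]; trivial
  refine Submodule.span_mono ?_ h
  rintro _ ⟨p, rfl⟩
  exact ⟨p, Nat.zero_le _, rfl⟩

theorem mul_mem_radPow {m n : ℕ} {x y : InfAlgebra k ε₀} (hx : x ∈ radPow k ε₀ m)
    (hy : y ∈ radPow k ε₀ n) : x * y ∈ radPow k ε₀ (m + n) := by
  induction hx using Submodule.span_induction with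
  | zero => rw [zero_mul]; exact zero_mem _
  | add x x' _ _ h h' => rw [add_mul]; exact add_mem h h'
  | smul c x _ h => rw [smul_mul_assoc]; exact Submodule.smul_mem _ c h
  | mem x hx =>
    obtain ⟨⟨a, b, p⟩, hp, rfl⟩ := hx
    induction hy using Submodule.span_induction with
    | zero => rw [mul_zero]; exact zero_mem _
    | add x x' _ _ h h' => rw [mul_add]; exact add_mem h h'
    | smul c x _ h => rw [mul_smul_comm]; exact Submodule.smul_mem _ c h
    | mem y hy =>
      obtain ⟨⟨b', c, q⟩, hq, rfl⟩ := hy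
      rw [← mk_mul]
      by_cases h : b = b'
      · subst h
        rw [ofPath_mul_ofPath_of_comp]
        exact Submodule.subset_span ⟨_, by simpa using add_le_add hp hq, rfl⟩
      · rw [ofPath_mul_ofPath_of_ne h, map_zero]
        exact zero_mem _

theorem G_mem_radPow (z : Fin 3 → ℤ) (s : Step) : G k ε₀ z s ∈ radPow k ε₀ 1 := by
  by_cases h : Adj (proj z) (proj z + pv s)
  · obtain ⟨x, hx⟩ := (h.isVertex_left).exists_eq
    obtain ⟨y, hy⟩ := (h.isVertex_right).exists_eq
    rw [G]
    rw [← hy, ← hx] at h ⊢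
    rw [arrow_of_adj k h]
    exact Submodule.subset_span ⟨_, le_rfl, rfl⟩
  · rw [G, arrow_of_not_adj k h, map_zero]
    exact zero_mem _

theorem word_cons_mem_radPow (z : Fin 3 → ℤ) (s : Step) (w : List Step) :
    word k ε₀ z (s :: w) ∈ radPow k ε₀ 1 :=
  mul_mem_radPow (m := 1) (n := 0) (G_mem_radPow z s) (radPow_zero _)

theorem length_stepsOf {x y : Vertex} (p : Path x y) : (stepsOf p).length = p.length := by
  induction p with
  | nil => rfl
  | cons p a ih => rw [stepsOf, List.length_append, ih]; rfl

/-- The right ideal of a deep vertex has Loewy length at most five. -/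
theorem eq_zero_of_mem_radPow {y : Fin 3 → ℤ} (hy : Deep y) {x : InfAlgebra k ε₀}
    (hx : E k ε₀ y * x = x) (h : x ∈ radPow k ε₀ 5) : x = 0 := by
  rw [← hx]
  clear hx
  induction h using Submodule.span_induction with
  | zero => rw [mul_zero]
  | add x x' _ _ h h' => rw [mul_add, h, h', add_zero]
  | smul c x _ h => rw [mul_smul_comm, h, smul_zero]
  | mem x hx =>
    obtain ⟨⟨a, b, p⟩, hp, rfl⟩ := hx
    obtain ⟨v, hv⟩ := hy.good.isVertex.exists_eq
    by_cases hz : proj y = a.1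
    · rw [← word_stepsOf p hz, E_mul_word]
      simp only [← length_stepsOf] at hp
      match stepsOf p, hp with
      | s :: t :: u :: v :: w :: Q, _ => exact hy.word_five_eq_zero s t u v w Q
    · rw [E, ← hv, idemAt_of_vertex, ← mk_mul, ofPath_mul_ofPath_of_ne, map_zero]
      exact fun e => hz (by rw [← hv]; exact congrArg Subtype.val e)

end Filtration

end Rauzy

namespace Rauzy

/-! ### The complex along a chord -/

/-- The points of the columns of the complex, relative to the start of the chord. There are twelve
columns along the chord, listed once in each direction. Each point carries the coefficient `1`; the
coefficient `0` stands for a missing second point. -/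
def colPt : Fin 24 → Fin 2 → ℤ × Triple :=
  let c : Fin 12 → Fin 2 → ℤ × Triple :=
    ![![(1, 0, 0, 0), (0, 0, 0, 0)], ![(1, 0, 1, 0), (0, 0, 0, 0)],
      ![(1, 0, 2, 0), (1, -1, 1, 0)], ![(1, -1, 2, 0), (0, 0, 0, 0)],
      ![(1, -1, 3, 0), (1, -2, 2, 0)], ![(1, -2, 3, 0), (0, 0, 0, 0)],
      ![(1, -2, 4, 0), (1, -3, 3, 0)], ![(1, -3, 4, 0), (0, 0, 0, 0)],
      ![(1, -3, 5, 0), (0, 0, 0, 0)], ![(1, -4, 5, 0), (0, 0, 0, 0)],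
      ![(1, -4, 6, 0), (0, 0, 0, 0)], ![(1, -5, 6, 0), (0, 0, 0, 0)]]
  ![c 0, c 1, c 2, c 3, c 4, c 5, c 6, c 7, c 8, c 9, c 10, c 11,
    c 11, c 10, c 9, c 8, c 7, c 6, c 5, c 4, c 3, c 2, c 1, c 0]

/-- A differential between columns with one point each. Here and below, an entry of a
differential is a coefficient in `{0, 1, -1}` with a word. -/
def pathMap (w : List Step) : Fin 2 → Fin 2 → ℤ × List Step :=
  ![![(1, w), (0, [])], ![(0, []), (0, [])]]

/-- The differential from a column with two points to a column with one point. -/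
def fork (a b : Step) : Fin 2 → Fin 2 → ℤ × List Step :=
  ![![(1, [a]), (1, [b])], ![(0, []), (0, [])]]

/-- The differential from a column with one point to a column with two points. -/
def join (a b : Step) : Fin 2 → Fin 2 → ℤ × List Step :=
  ![![(1, [b]), (0, [])], ![(-1, [a]), (0, [])]]

/-- The differentials of the complex: along the chord, around the loop at its end, back, and around
the loop at its start. -/
def colMap : Fin 24 → Fin 2 → Fin 2 → ℤ × List Step :=
  let p : Step := (1, 1)
  let q : Step := (0, -1)
  let p' : Step := (1, -1)
  let q' : Step := (0, 1)
  ![pathMap [p], fork p q, join p q, fork p q, join p q, fork p q, join p q, pathMap [p],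
    pathMap [q], pathMap [p], pathMap [q], pathMap [p, p'], pathMap [q'], pathMap [p'],
    pathMap [q'], pathMap [p'], fork q' p', join q' p', fork q' p', join q' p', fork q' p',
    join q' p', pathMap [p'], pathMap [q', q]]

/-- The end of a sequence of steps. -/
def pend (p : Triple) : List Step → Triple
  | [] => p
  | s :: w => pend (p + svec s) w

theorem wend_pt (τ : Fin 3 → ℤ) (p : Triple) (w : List Step) :
    wend (τ + pt p) w = τ + pt (pend p w) := by
  induction w generalizing p with
  | nil => rfl
  | cons s w ih => rw [wend, add_pt_add_vec, ih, pend]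

/-- Two consecutive steps of the word neither turn back nor run along a rhombus. -/
def Dead (p : Triple) : List Step → Prop
  | s :: t :: w => (Inside p ∧ t ≠ s.bar ∧ NotCotAt p s t) ∨ Dead (p + svec s) (t :: w)
  | _ => False

instance Dead.decidable : ∀ (p : Triple) (w : List Step), Decidable (Dead p w)
  | _, [] => .isFalse id
  | _, [_] => .isFalse id
  | p, s :: t :: w =>
    have := Dead.decidable (p + svec s) (t :: w)
    inferInstanceAs (Decidable ((Inside p ∧ t ≠ s.bar ∧ NotCotAt p s t) ∨
      Dead (p + svec s) (t :: w)))

variable {k : Type u} [Field k] {ε₀ : Fin 3 → ℤˣ} {i : ℕ} {τ : Fin 3 → ℤ}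

theorem word_pair (y : Fin 3 → ℤ) (s t : Step) :
    word k ε₀ y [s, t] = G k ε₀ y s * G k ε₀ (y + vec s) t := by
  rw [word_cons, word_singleton]

theorem Dead.word_eq_zero (hc : Chord i τ) {p : Triple} {w : List Step} (h : Dead p w) :
    word k ε₀ (τ + pt p) w = 0 := by
  induction w generalizing p with
  | nil => exact h.elim
  | cons s w ih =>
    cases w with
    | nil => exact h.elim
    | cons t w =>
      rcases h with ⟨h1, h2, h3⟩ | h
      · exact word_pair_eq_zero (k := k) (ε₀ := ε₀) (hc.inX h1) (hc.not_cot h3) h2 w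
      · rw [word_cons, add_pt_add_vec, ih h, mul_zero]

variable (k ε₀ τ) in
/-- The idempotent at a point of a column. -/
def colIdem (j : Fin 24) (a : Fin 2) : InfAlgebra k ε₀ :=
  (colPt j a).1 • E k ε₀ (τ + pt (colPt j a).2)

variable (k ε₀ τ) in
/-- The entries of the differentials. -/
def colDiff (j : Fin 24) (a b : Fin 2) : InfAlgebra k ε₀ :=
  (colMap j a b).1 • word k ε₀ (τ + pt (colPt j a).2) (colMap j a b).2

theorem colPt_cases : ∀ j a, (colPt j a).1 = 0 ∨ (colPt j a).1 = 1 ∧ (colPt j a).2 ∈ chordPts := by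
  decide +kernel

theorem colMap_cases : ∀ j a b, (colMap j a b).1 = 0 ∨ (colMap j a b).2 ≠ [] ∧
    (colPt j a).1 = 1 ∧ (colPt (j + 1) b).1 = 1 ∧
      pend (colPt j a).2 (colMap j a b).2 = (colPt (j + 1) b).2 := by
  decide +kernel

set_option synthInstance.maxSize 1000 in
set_option synthInstance.maxHeartbeats 200000 in
/-- In the products of consecutive differentials either all words are dead, or the two paths
around a rhombus cancel. -/
theorem colMap_comp : ∀ j a b,
    (∀ c, (colMap j a c).1 * (colMap (j + 1) c b).1 = 0 ∨
      Dead (colPt j a).2 ((colMap j a c).2 ++ (colMap (j + 1) c b).2)) ∨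
    (colPt j a).2 ∈ chordHull ∧ ∃ s t : Step, s.1 ≠ t.1 ∧
      colMap j a 0 = (1, [s]) ∧ colMap (j + 1) 0 b = (1, [t]) ∧
      colMap j a 1 = (1, [t]) ∧ colMap (j + 1) 1 b = (-1, [s]) := by
  decide +kernel

theorem colDiff_mul_colDiff (j : Fin 24) (a c b : Fin 2) :
    colDiff k ε₀ τ j a c * colDiff k ε₀ τ (j + 1) c b =
      ((colMap j a c).1 * (colMap (j + 1) c b).1) • word k ε₀ (τ + pt (colPt j a).2)
        ((colMap j a c).2 ++ (colMap (j + 1) c b).2) := by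
  rcases colMap_cases j a c with h | ⟨-, -, -, h⟩
  · rw [colDiff, h, zero_smul, zero_mul, zero_mul, zero_smul]
  · rw [colDiff, colDiff, smul_mul_smul_comm, ← h, ← wend_pt, word_mul_word]

theorem colDiff_comp (hc : Chord i τ) (j : Fin 24) (a b : Fin 2) :
    colDiff k ε₀ τ j a 0 * colDiff k ε₀ τ (j + 1) 0 b +
      colDiff k ε₀ τ j a 1 * colDiff k ε₀ τ (j + 1) 1 b = 0 := by
  rw [colDiff_mul_colDiff, colDiff_mul_colDiff]
  rcases colMap_comp j a b with h | ⟨hp, s, t, hst, h1, h2, h3, h4⟩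
  · have key : ∀ c, ((colMap j a c).1 * (colMap (j + 1) c b).1) •
        word k ε₀ (τ + pt (colPt j a).2) ((colMap j a c).2 ++ (colMap (j + 1) c b).2) = 0 := by
      intro c
      rcases h c with h | h
      · rw [h, zero_smul]
      · rw [h.word_eq_zero hc, smul_zero]
    rw [key, key, add_zero]
  · simp only [h1, h2, h3, h4, List.cons_append, List.nil_append, one_mul, one_smul, neg_smul]
    rw [word_pair, word_pair, G_mul_G_comm (hc.good _ hp) hst, add_neg_cancel]

/-! ### Exactness along a chord -/

variable (k ε₀ i τ) in
/-- The kernel of the differential with index `j` is contained in the image of the next one. -/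
def ExactAt (j : Fin 24) : Prop :=
  ∀ x : Fin 2 → InfAlgebra k ε₀,
    (∀ a, colIdem k ε₀ τ (j + 1) a * x a = x a ∧ x a * patchIdem k ε₀ i = x a) →
    (∀ a, colDiff k ε₀ τ j a 0 * x 0 + colDiff k ε₀ τ j a 1 * x 1 = 0) →
    ∃ w : Fin 2 → InfAlgebra k ε₀, ∀ a,
      x a = colDiff k ε₀ τ (j + 1) a 0 * w 0 + colDiff k ε₀ τ (j + 1) a 1 * w 1

theorem colDiff_eq_G {j : Fin 24} {a b : Fin 2} {s : Step} {p : Triple}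
    (h : colMap j a b = (1, [s])) (hp : (colPt j a).2 = p) :
    colDiff k ε₀ τ j a b = G k ε₀ (τ + pt p) s := by
  rw [colDiff, h, hp, word_singleton, one_smul]

theorem colDiff_eq_zero {j : Fin 24} {a b : Fin 2} (h : (colMap j a b).1 = 0) :
    colDiff k ε₀ τ j a b = 0 := by
  rw [colDiff, h, zero_smul]

/-- The column with index `j + 1` consists of the point `p`. -/
def IsSingle (j : Fin 24) (p : Triple) : Prop :=
  colPt (j + 1) 0 = (1, p) ∧ (colPt (j + 1) 1).1 = 0 ∧ p ∈ chordPts ∧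
    (colMap (j + 1) 1 0).1 = 0 ∧ (colMap (j + 1) 1 1).1 = 0

instance (j : Fin 24) (p : Triple) : Decidable (IsSingle j p) := by
  unfold IsSingle; infer_instance

theorem exactAt_of_single {j : Fin 24} {p : Triple} (hp : IsSingle j p)
    (h : ∀ x, E k ε₀ (τ + pt p) * x = x → x * patchIdem k ε₀ i = x →
      colDiff k ε₀ τ j 0 0 * x = 0 → colDiff k ε₀ τ j 1 0 * x = 0 →
      ∃ z z', x = colDiff k ε₀ τ (j + 1) 0 0 * z + colDiff k ε₀ τ (j + 1) 0 1 * z') :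
    ExactAt k ε₀ i τ j := by
  obtain ⟨h0, h1, -, h2, h3⟩ := hp
  intro x hx hd
  have e1 : x 1 = 0 := by rw [← (hx 1).1, colIdem, h1, zero_smul, zero_mul]
  have e0 := (hx 0).1
  rw [colIdem, h0, one_smul] at e0
  simp only [e1, mul_zero, add_zero] at hd
  obtain ⟨z, z', hz⟩ := h (x 0) e0 (hx 0).2 (hd 0) (hd 1)
  refine ⟨![z, z'], fun a => ?_⟩
  fin_cases a
  · exact hz
  · simp [e1, colDiff_eq_zero h2, colDiff_eq_zero h3]

/-- The step `s` from `p` leaves the two bounding planes or is an entry of the differential. -/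
def Covers (j : Fin 24) (p : Triple) (s : Step) : Prop :=
  Outside (p + svec s) ∨ colMap (j + 1) 0 0 = (1, [s]) ∨ colMap (j + 1) 0 1 = (1, [s])

instance (j : Fin 24) (p : Triple) (s : Step) : Decidable (Covers j p s) := by
  unfold Covers; infer_instance

theorem arrowIdeal_le (hc : Chord i τ) {j : Fin 24} {p : Triple} (hp : IsSingle j p) {s : Step}
    (h : Covers j p s) : (arrowIdeal (τ + pt p) s : Submodule k (InfAlgebra k ε₀)) ≤
      LinearMap.range (LinearMap.mulLeft k (colDiff k ε₀ τ (j + 1) 0 0)) ⊔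
        LinearMap.range (LinearMap.mulLeft k (colDiff k ε₀ τ (j + 1) 0 1)) := by
  have hp0 : (colPt (j + 1) 0).2 = p := by rw [hp.1]
  rcases h with h | h | h
  · rintro _ ⟨z, rfl⟩
    rw [LinearMap.mulLeft_apply, G_eq_zero (hc.deep hp.2.2.1).good.inX (hc.not_inX_step h),
      zero_mul]
    exact zero_mem _
  · rw [colDiff_eq_G h hp0]
    exact le_sup_left
  · rw [colDiff_eq_G h hp0]
    exact le_sup_right

theorem exists_of_mem_sup {a b x : InfAlgebra k ε₀}
    (h : x ∈ LinearMap.range (LinearMap.mulLeft k a) ⊔ LinearMap.range (LinearMap.mulLeft k b)) :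
    ∃ z z', x = a * z + b * z' := by
  obtain ⟨_, ⟨z, rfl⟩, _, ⟨z', rfl⟩, rfl⟩ := Submodule.mem_sup.1 h
  exact ⟨z, z', rfl⟩

/-- Exactness at a column with one point after a column with one point. -/
theorem exactAt_one (hε : ∏ d, ε₀ d = 1) (hc : Chord i τ) (j : Fin 24) (p : Triple) (l u w : Step)
    (hp : IsSingle j p) (h0 : (colPt j 0).2 = p + svec l) (h1 : colMap j 0 0 = (1, [l.bar]))
    (hlu : CotAt p l u) (hlu' : CotAt p l u.bar) (hlw : l.1 ≠ w.1) (huw : u.1 ≠ w.1)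
    (hl : Covers j p l.bar) (hw : Covers j p w) (hw' : Covers j p w.bar) : ExactAt k ε₀ i τ j := by
  refine exactAt_of_single hp fun x hx _ h _ => exists_of_mem_sup ?_
  rw [colDiff_eq_G h1 h0, ← add_pt_add_vec] at h
  have hle := sup_le (α := Submodule k (InfAlgebra k ε₀)) (arrowIdeal_le hc hp hl)
    (sup_le (arrowIdeal_le hc hp hw) (arrowIdeal_le hc hp hw'))
  exact hle (exact_arrow hε (hc.deep hp.2.2.1) (hc.cot hlu) (hc.cot hlu') hlw huw hx h)

/-- Exactness at a column with one point after a column with two points. -/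
theorem exactAt_two (hε : ∏ d, ε₀ d = 1) (hc : Chord i τ) (j : Fin 24) (p : Triple) (l l' u : Step)
    (hp : IsSingle j p) (h0 : (colPt j 0).2 = p + svec l) (h1 : colMap j 0 0 = (1, [l.bar]))
    (h0' : (colPt j 1).2 = p + svec l') (h1' : colMap j 1 0 = (-1, [l'.bar]))
    (hlu : CotAt p l u) (hlu' : CotAt p l' u.bar) (hll : CotAt p l l')
    (hl : Covers j p l.bar) (hl' : Covers j p l'.bar) : ExactAt k ε₀ i τ j := by
  refine exactAt_of_single hp fun x hx _ h h' => exists_of_mem_sup ?_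
  rw [colDiff_eq_G h1 h0, ← add_pt_add_vec] at h
  rw [colDiff, h1', h0', ← add_pt_add_vec, word_singleton, neg_smul, one_smul, neg_mul,
    neg_eq_zero] at h'
  have hle := sup_le (α := Submodule k (InfAlgebra k ε₀)) (arrowIdeal_le hc hp hl)
    (arrowIdeal_le hc hp hl')
  exact hle (exact_arrows hε (hc.deep hp.2.2.1) (hc.cot hlu) (hc.cot hlu') (hc.cot hll) hx h h')

/-- Exactness at a column with two points. -/
theorem exactAt_pair (hε : ∏ d, ε₀ d = 1) (hc : Chord i τ) (j : Fin 24) (p : Triple) (a b d : Step)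
    (hp : p ∈ chordPts) (hpa : p + svec a ∈ chordPts) (hpb : p + svec b ∈ chordPts)
    (ha : colPt (j + 1) 0 = (1, p + svec a)) (hb : colPt (j + 1) 1 = (1, p + svec b))
    (h0 : (colPt j 0).2 = p) (hd : ∀ c c', colMap j c c' = fork a b c c')
    (hd' : ∀ c c', colMap (j + 1) c c' = join a b c c')
    (hab : CotAt p a b) (had : CotAt p a d) (hbd : CotAt p b d.bar)
    (ho : ∀ q ∈ [p + svec a + svec a, p + svec a + svec b.bar, p + svec a + svec d.bar,
      p + svec b + svec b, p + svec b + svec a.bar, p + svec b + svec d], Outside q) :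
    ExactAt k ε₀ i τ j := by
  intro x hx h
  have hx0 := (hx 0).1
  have hx1 := (hx 1).1
  rw [colIdem, ha, one_smul, ← add_pt_add_vec] at hx0
  rw [colIdem, hb, one_smul, ← add_pt_add_vec] at hx1
  have h := h 0
  rw [colDiff_eq_G (hd 0 0) h0, colDiff_eq_G (hd 0 1) h0] at h
  have hn : ∀ s t, p + svec s + svec t ∈ [p + svec a + svec a, p + svec a + svec b.bar,
      p + svec a + svec d.bar, p + svec b + svec b, p + svec b + svec a.bar,
      p + svec b + svec d] → ¬ InX (τ + pt p + vec s + vec t) := fun s t hq => by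
    rw [add_pt_add_vec]
    exact hc.not_inX_step (ho _ hq)
  have hda := hc.deep hpa
  have hdb := hc.deep hpb
  rw [← add_pt_add_vec] at hda hdb
  obtain ⟨z, h1, h2⟩ := exact_pair hε (hc.deep hp) hda hdb (hc.cot hab) (hc.cot had)
    (hc.cot hbd) (hn _ _ (by simp)) (hn _ _ (by simp)) (hn _ _ (by simp)) (hn _ _ (by simp))
    (hn _ _ (by simp)) (hn _ _ (by simp)) hx0 hx1 h
  refine ⟨![z, 0], fun c => ?_⟩
  fin_cases c
  · refine h1.trans ?_
    simp only [Fin.zero_eta, Matrix.cons_val_zero, Matrix.cons_val_one, mul_zero, add_zero]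
    rw [colDiff_eq_G (hd' 0 0) (congrArg Prod.snd ha), add_pt_add_vec]
  · refine h2.trans ?_
    simp only [Fin.mk_one, Matrix.cons_val_zero, Matrix.cons_val_one, mul_zero, add_zero]
    rw [colDiff, hd', hb, add_pt_add_vec]
    change _ = (-1 : ℤ) • word k ε₀ (τ + pt (p + svec b)) [a] * z
    rw [word_singleton, neg_smul, one_smul, neg_mul]

/-- The conditions on the geometry at an end `p` of a chord: the arrow `l` runs along the chord, and
the arrow `b` leaves it. -/
def IsEnd (p : Triple) (l b : Step) : Prop :=
  l.1 ≠ 2 ∧ b.1 ≠ 2 ∧ l.1 ≠ b.1 ∧ CotAt p l (2, 1) ∧ CotAt p l (2, -1) ∧ CotAt p b (2, 1) ∧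
    CotAt p b (2, -1) ∧ Outside (p + svec l.bar) ∧ Outside (p + svec b.bar) ∧
    p + svec b ∈ chordEnds ∧ p + svec b + svec (2, 1) ∈ chordEnds ∧
    p + svec b + svec (2, -1) ∈ chordEnds

instance (p : Triple) (l b : Step) : Decidable (IsEnd p l b) := by
  unfold IsEnd; infer_instance

theorem E_mul_patchIdem_end (hc : Chord i τ) {p : Triple} (hp : p ∈ chordEnds) :
    E k ε₀ (τ + pt p) * patchIdem k ε₀ i = 0 :=
  E_mul_patchIdem_of_not_mem (hc.not_mem p hp)

/-- Exactness at an end of the chord before the loop. -/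
theorem exactAt_before (hε : ∏ d, ε₀ d = 1) (hc : Chord i τ) (j : Fin 24) (p : Triple) (l b : Step)
    (hp : IsSingle j p) (h0 : (colPt j 0).2 = p + svec l) (h1 : colMap j 0 0 = (1, [l.bar]))
    (h2 : colMap (j + 1) 0 0 = (1, [b, b.bar])) (he : IsEnd p l b) : ExactAt k ε₀ i τ j := by
  obtain ⟨hl, hb, hlb, c1, c2, -, -, ol, ob, e0, e1, e2⟩ := he
  refine exactAt_of_single hp fun x hx hxe h _ => ?_
  rw [colDiff_eq_G h1 h0, ← add_pt_add_vec] at h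
  obtain ⟨z, hz⟩ := exact_end_before (u := (2, 1)) hε (hc.deep hp.2.2.1) (hc.cot c1) (hc.cot c2)
    hlb hb.symm (hc.not_inX_step ol) (hc.not_inX_step ob)
    (by rw [add_pt_add_vec]; exact E_mul_patchIdem_end hc e0)
    (by rw [add_pt_add_vec, add_pt_add_vec]; exact E_mul_patchIdem_end hc e1)
    (by rw [add_pt_add_vec, add_pt_add_vec]; exact E_mul_patchIdem_end hc e2) hx hxe h
  refine ⟨z, 0, ?_⟩
  rw [colDiff, h2, hp.1, one_smul, word_pair, mul_zero, add_zero]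
  exact hz

/-- Exactness at an end of the chord after the loop. -/
theorem exactAt_after (hε : ∏ d, ε₀ d = 1) (hc : Chord i τ) (j : Fin 24) (p : Triple) (l b : Step)
    (hp : IsSingle j p) (h0 : (colPt j 0).2 = p) (h1 : colMap j 0 0 = (1, [b, b.bar]))
    (h2 : colMap (j + 1) 0 0 = (1, [l])) (he : IsEnd p l b) : ExactAt k ε₀ i τ j := by
  obtain ⟨hl, hb, hlb, -, -, c1, c2, ol, ob, e0, e1, e2⟩ := he
  refine exactAt_of_single hp fun x hx hxe h _ => ?_
  rw [colDiff, h1, h0, one_smul, word_pair] at h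
  obtain ⟨z, hz⟩ := exact_end_after (u := (2, 1)) (l := l) hε (hc.deep hp.2.2.1) (hc.cot c1)
    (hc.cot c2) hlb.symm hl.symm (hc.not_inX_step ol) (hc.not_inX_step ob)
    (fun z => (em (proj z ∈ patchPts i)).imp E_mul_patchIdem_of_mem E_mul_patchIdem_of_not_mem)
    (by rw [add_pt_add_vec]; exact E_mul_patchIdem_end hc e0)
    (by rw [add_pt_add_vec, add_pt_add_vec]; exact E_mul_patchIdem_end hc e1)
    (by rw [add_pt_add_vec, add_pt_add_vec]; exact E_mul_patchIdem_end hc e2) hx hxe h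
  refine ⟨z, 0, ?_⟩
  rw [colDiff_eq_G h2 (by rw [hp.1]), mul_zero, add_zero]
  exact hz

/-- Exactness at each of the 24 columns. The arguments are the point at which the criterion is
applied and the steps to the neighbouring columns. -/
theorem exactAt (hε : ∏ d, ε₀ d = 1) (hc : Chord i τ) : ∀ j, ExactAt k ε₀ i τ j
  | 0 => by
    apply exactAt_one hε hc 0 (0, 1, 0) (1, -1) (2, 1) (0, 1) <;> decide +kernel
  | 1 => by
    apply exactAt_pair hε hc 1 (0, 1, 0) (1, 1) (0, -1) (2, -1) <;> decide +kernel
  | 2 => by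
    apply exactAt_two hε hc 2 (-1, 2, 0) (0, 1) (1, -1) (2, -1) <;> decide +kernel
  | 3 => by
    apply exactAt_pair hε hc 3 (-1, 2, 0) (1, 1) (0, -1) (2, -1) <;> decide +kernel
  | 4 => by
    apply exactAt_two hε hc 4 (-2, 3, 0) (0, 1) (1, -1) (2, -1) <;> decide +kernel
  | 5 => by
    apply exactAt_pair hε hc 5 (-2, 3, 0) (1, 1) (0, -1) (2, -1) <;> decide +kernel
  | 6 => by
    apply exactAt_two hε hc 6 (-3, 4, 0) (0, 1) (1, -1) (2, -1) <;> decide +kernel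
  | 7 => by
    apply exactAt_one hε hc 7 (-3, 5, 0) (1, -1) (2, 1) (0, 1) <;> decide +kernel
  | 8 => by
    apply exactAt_one hε hc 8 (-4, 5, 0) (0, 1) (2, 1) (1, 1) <;> decide +kernel
  | 9 => by
    apply exactAt_one hε hc 9 (-4, 6, 0) (1, -1) (2, 1) (0, 1) <;> decide +kernel
  | 10 => by
    apply exactAt_before hε hc 10 (-5, 6, 0) (0, 1) (1, 1) <;> decide +kernel
  | 11 => by
    apply exactAt_after hε hc 11 (-5, 6, 0) (0, 1) (1, 1) <;> decide +kernel
  | 12 => by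
    apply exactAt_one hε hc 12 (-4, 6, 0) (0, -1) (2, 1) (1, 1) <;> decide +kernel
  | 13 => by
    apply exactAt_one hε hc 13 (-4, 5, 0) (1, 1) (2, 1) (0, 1) <;> decide +kernel
  | 14 => by
    apply exactAt_one hε hc 14 (-3, 5, 0) (0, -1) (2, 1) (1, 1) <;> decide +kernel
  | 15 => by
    apply exactAt_one hε hc 15 (-3, 4, 0) (1, 1) (2, 1) (0, 1) <;> decide +kernel
  | 16 => by
    apply exactAt_pair hε hc 16 (-3, 4, 0) (0, 1) (1, -1) (2, -1) <;> decide +kernel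
  | 17 => by
    apply exactAt_two hε hc 17 (-2, 3, 0) (1, 1) (0, -1) (2, -1) <;> decide +kernel
  | 18 => by
    apply exactAt_pair hε hc 18 (-2, 3, 0) (0, 1) (1, -1) (2, -1) <;> decide +kernel
  | 19 => by
    apply exactAt_two hε hc 19 (-1, 2, 0) (1, 1) (0, -1) (2, -1) <;> decide +kernel
  | 20 => by
    apply exactAt_pair hε hc 20 (-1, 2, 0) (0, 1) (1, -1) (2, -1) <;> decide +kernel
  | 21 => by
    apply exactAt_two hε hc 21 (0, 1, 0) (1, 1) (0, -1) (2, -1) <;> decide +kernel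
  | 22 => by
    apply exactAt_before hε hc 22 (0, 0, 0) (1, 1) (0, 1) <;> decide +kernel
  | 23 => by
    apply exactAt_after hε hc 23 (0, 0, 0) (1, 1) (0, 1) <;> decide +kernel
  | ⟨n + 24, h⟩ => absurd h (by omega)

variable (k ε₀) in
/-- The cyclic complex along a chord. -/
def chordComplex (hε : ∏ d, ε₀ d = 1) (hc : Chord i τ) :
    MinimalComplex (patchIdem k ε₀ i) (Fin 24) where
  next j := j + 1
  f := colIdem k ε₀ τ
  d := colDiff k ε₀ τ
  idem j a := by
    rcases colPt_cases j a with h | ⟨h, -⟩ <;> rw [colIdem, h]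
    · rw [zero_smul, zero_mul]
    · rw [one_smul, E_mul_self]
  left j a := by
    rcases colPt_cases j a with h | ⟨h, hp⟩ <;> rw [colIdem, h]
    · rw [zero_smul, mul_zero]
    · rw [one_smul, patchIdem_mul_E_of_mem (hc.mem _ hp)]
  right j a := by
    rcases colPt_cases j a with h | ⟨h, hp⟩ <;> rw [colIdem, h]
    · rw [zero_smul, zero_mul]
    · rw [one_smul, E_mul_patchIdem_of_mem (hc.mem _ hp)]
  f_mul_d j a b := by
    rcases colMap_cases j a b with h | ⟨-, h, -, -⟩
    · rw [colDiff_eq_zero h, mul_zero]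
    · rw [colIdem, h, one_smul, colDiff, mul_smul_comm, E_mul_word]
  d_mul_f j a b := by
    rcases colMap_cases j a b with h | ⟨-, -, h, h'⟩
    · rw [colDiff_eq_zero h, zero_mul]
    · rw [colIdem, h, one_smul, colDiff, ← h', ← wend_pt, smul_mul_assoc, word_mul_E]
  d_mul_d := colDiff_comp hc
  exact := exactAt hε hc
  F m := (radPow k ε₀ m).toAddSubgroup
  F_zero := radPow_zero
  mul_mem _ _ _ _ := mul_mem_radPow
  d_mem j a b := by
    rcases colMap_cases j a b with h | ⟨h, -⟩
    · rw [colDiff_eq_zero h]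
      exact zero_mem (radPow k ε₀ 1)
    · obtain ⟨s, w, hw⟩ := List.exists_cons_of_ne_nil h
      rw [colDiff, hw]
      exact zsmul_mem (word_cons_mem_radPow (k := k) (ε₀ := ε₀) _ s w) _
  bound := 5
  eq_zero j a x hx h := by
    rcases colPt_cases j a with h' | ⟨h', hp⟩ <;> rw [colIdem, h'] at hx
    · rw [← hx, zero_smul, zero_mul]
    · rw [one_smul] at hx
      exact eq_zero_of_mem_radPow (hc.deep hp) hx h

/-- The first arrow of a chord is not zero in the algebra. -/
theorem colDiff_zero_ne_zero (hε : ∏ d, ε₀ d = 1) (hc : Chord i τ) :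
    colDiff k ε₀ τ 0 0 0 ≠ 0 := by
  rw [colDiff_eq_G (p := (0, 0, 0)) (s := (1, 1)) rfl rfl]
  intro h
  have hd := hc.deep (p := (0, 0, 0)) (by decide)
  have hcot : Cot (τ + pt (0, 0, 0)) (1, 1) (2, 1) := hc.cot (by decide +kernel)
  obtain ⟨⟨hp, ht⟩, -⟩ := trace_rhombus (ε₀ := ε₀) hcot hd.good (hd.good₁ _ hcot.2.1)
    (hd.good₁ _ hcot.2.2.1) (hd.good₂ _ _ hcot)
  have h1 := tr_word (k := k) hε hd.good hp
  rw [word_cons, h, zero_mul, map_zero] at h1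
  rcases ht with ht | ht <;> rw [ht] at h1 <;> simp at h1

/-- If `P_i` has a chord, then `A_i` has a periodic module. -/
theorem Chord.exists_isPeriodicModule (hε : ∏ d, ε₀ d = 1) (hc : Chord i τ) :
    ∃ M : ModuleCat.{u} (FinAlgebra k ε₀ i)ᵐᵒᵖ, IsPeriodicModule M :=
  ⟨_, (chordComplex k ε₀ hε hc).isPeriodicModule_image (isIdempotentElem_patchIdem k ε₀ i)
    (j := 0) (n := 24) (by decide) (show (fun j : Fin 24 => j + 1)^[24] 0 = 0 by decide)
    (colDiff_zero_ne_zero hε hc)⟩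

end Rauzy

namespace Rauzy

/-! ### Patterns of rhombi -/

/-- A face of the stepped surface, for computations. -/
abbrev TripleFace : Type := Triple × Fin 3

/-- The face with the given position relative to `w`. -/
def toFace (w : Fin 3 → ℤ) (f : TripleFace) : Face := (w + pt f.1, f.2)

theorem pt_injective : Function.Injective pt := by
  rintro ⟨a, b, c⟩ ⟨a', b', c'⟩ h
  have h0 := congrFun h 0
  have h1 := congrFun h 1
  have h2 := congrFun h 2
  simp only [pt, Matrix.cons_val_zero, Matrix.cons_val_one, Matrix.cons_val] at h0 h1 h2
  rw [h0, h1, h2]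

theorem toFace_injective (w : Fin 3 → ℤ) : Function.Injective (toFace w) := by
  rintro ⟨q, a⟩ ⟨q', a'⟩ h
  simp only [toFace, Prod.mk.injEq, add_right_inj] at h
  rw [pt_injective h.1, h.2]

/-- The substitution, for computations. -/
def growFace : TripleFace → List TripleFace
  | ((a, b, c), 0) => [((b, c, a - b - c), 2), ((b + 1, c, a - b - c - 1), 0),
      ((b, c + 1, a - b - c - 1), 1)]
  | ((a, b, c), 1) => [((b, c, a - b - c), 0)]
  | ((a, b, c), 2) => [((b, c, a - b - c), 1)]

/-- The substitution on lists of faces. -/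
def grow (L : List TripleFace) : List TripleFace := L.flatMap growFace

/-- The substitution on relative positions: the origin of the coordinates moves by `M`. -/
theorem mem_inflate_toFace {w : Fin 3 → ℤ} {f : TripleFace} {g : Face} :
    g ∈ inflate (toFace w f) ↔ ∃ h ∈ growFace f, g = toFace (substMatrix.mulVec w) h := by
  obtain ⟨⟨a, b, c⟩, j⟩ := f
  have e : substMatrix.mulVec (w + pt (a, b, c)) =
      substMatrix.mulVec w + pt (b, c, a - b - c) := by
    rw [Matrix.mulVec_add]
    congr 1
    rw [substMatrix_mulVec]
    rfl
  have e1 : pt (b + 1, c, a - b - c - 1) = pt (b, c, a - b - c) + ![1, 0, -1] := by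
    ext l; fin_cases l <;> simp [pt]; ring
  have e2 : pt (b, c + 1, a - b - c - 1) = pt (b, c, a - b - c) + ![0, 1, -1] := by
    ext l; fin_cases l <;> simp [pt]; ring
  rw [mem_inflate]
  simp only [toFace, e]
  fin_cases j <;> simp [growFace, e1, e2, add_assoc]

/-- The patches, for computations. -/
def triplePatch (i : ℕ) : List TripleFace := grow^[i] [(0, 0), (0, 1), (0, 2)]

theorem mem_patch_iff {i : ℕ} {g : Face} : g ∈ patch i ↔ ∃ f ∈ triplePatch i, g = toFace 0 f := by
  induction i generalizing g with
  | zero =>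
    have e : pt 0 = 0 := by ext j; fin_cases j <;> rfl
    simp [patch, triplePatch, toFace, e]
  | succ i ih =>
    rw [patch, Finset.mem_biUnion, triplePatch, Function.iterate_succ_apply', ← triplePatch]
    simp only [grow, List.mem_flatMap]
    constructor
    · rintro ⟨f', hf', h⟩
      obtain ⟨f, hf, rfl⟩ := ih.1 hf'
      obtain ⟨h', hh, rfl⟩ := mem_inflate_toFace.1 h
      exact ⟨h', ⟨f, hf, hh⟩, by rw [Matrix.mulVec_zero]⟩
    · rintro ⟨h', ⟨f, hf, hh⟩, rfl⟩
      refine ⟨toFace 0 f, ih.2 ⟨f, hf, rfl⟩, mem_inflate_toFace.2 ⟨h', hh, ?_⟩⟩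
      rw [Matrix.mulVec_zero]

theorem toFace_mem_patch_iff {i : ℕ} {f : TripleFace} :
    toFace 0 f ∈ patch i ↔ f ∈ triplePatch i := by
  rw [mem_patch_iff]
  constructor
  · rintro ⟨f', hf', h⟩
    rwa [toFace_injective 0 h]
  · exact fun h => ⟨f, h, rfl⟩

/-- The faces of the first list, translated by `w`, belong to `P_i`, and those of the second list
belong to the tiling, but not to `P_i`. -/
structure Pattern (i : ℕ) (w : Fin 3 → ℤ) (In Out : List TripleFace) : Prop where
  mem : ∀ f ∈ In, toFace w f ∈ patch i
  not_mem : ∀ f ∈ Out, (∃ j, toFace w f ∈ patch j) ∧ toFace w f ∉ patch i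

namespace Pattern

variable {i : ℕ} {w : Fin 3 → ℤ} {In Out : List TripleFace}

theorem base (j : ℕ) (t : Triple) (hI : ∀ f ∈ In, (t + f.1, f.2) ∈ triplePatch i)
    (hO : ∀ f ∈ Out, (t + f.1, f.2) ∈ triplePatch j ∧ (t + f.1, f.2) ∉ triplePatch i) :
    Pattern i (pt t) In Out := by
  have e : ∀ f, toFace (pt t) f = toFace 0 (t + f.1, f.2) := fun f => by
    rw [toFace, toFace, pt_add, zero_add]
  refine ⟨fun f hf => ?_, fun f hf => ⟨⟨j, ?_⟩, ?_⟩⟩ <;> rw [e, toFace_mem_patch_iff]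
  exacts [hI f hf, (hO f hf).1, (hO f hf).2]

theorem translate (h : Pattern i w In Out) (t : Triple) {In' Out' : List TripleFace}
    (hI : ∀ f ∈ In', (t + f.1, f.2) ∈ In) (hO : ∀ f ∈ Out', (t + f.1, f.2) ∈ Out) :
    Pattern i (w + pt t) In' Out' := by
  have e : ∀ f, toFace (w + pt t) f = toFace w (t + f.1, f.2) := fun f => by
    rw [toFace, toFace, pt_add, add_assoc]
  constructor <;> intro f hf <;> rw [e]
  exacts [h.mem _ (hI f hf), h.not_mem _ (hO f hf)]

/-- The substitution of a pattern. Faces outside `P_i` have their descendants outside `P_{i+1}`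
since every face has only one parent. -/
theorem step (h : Pattern i w In Out) :
    Pattern (i + 1) (substMatrix.mulVec w) (grow In) (grow Out) := by
  constructor
  · intro g hg
    obtain ⟨f, hf, hg⟩ := List.mem_flatMap.1 hg
    exact Finset.mem_biUnion.2 ⟨_, h.mem f hf, mem_inflate_toFace.2 ⟨g, hg, rfl⟩⟩
  · intro g hg
    obtain ⟨f, hf, hg⟩ := List.mem_flatMap.1 hg
    obtain ⟨⟨j, hj⟩, hi⟩ := h.not_mem f hf
    have hgf : toFace (substMatrix.mulVec w) g ∈ inflate (toFace w f) :=
      mem_inflate_toFace.2 ⟨g, hg, rfl⟩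
    refine ⟨⟨j + 1, Finset.mem_biUnion.2 ⟨_, hj, hgf⟩⟩, fun hm => hi ?_⟩
    obtain ⟨f', hf', hg'⟩ := Finset.mem_biUnion.1 hm
    rwa [inflate_inj (inPlane_of_mem_patch hj) (inPlane_of_mem_patch hf') hgf hg']

theorem steps (h : Pattern i w In Out) (n : ℕ) :
    Pattern (i + n) (substMatrix.mulVec^[n] w) (grow^[n] In) (grow^[n] Out) := by
  induction n with
  | zero => exact h
  | succ n ih =>
    simp only [Function.iterate_succ_apply']
    exact ih.step

end Pattern

/-- For each of the six sectors at `p`, the list contains a face that covers this sector. -/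
def SurroundsList (L : List TripleFace) (p : Triple) : Prop :=
  ∀ a b c : Fin 3, a ≠ b → c ≠ a → c ≠ b →
    (p - svec (b, 1), c) ∈ L ∨ (p, b) ∈ L ∨ (p - svec (b, 1) - svec (c, 1), a) ∈ L

set_option synthInstance.maxSize 1000 in
instance (L : List TripleFace) (p : Triple) : Decidable (SurroundsList L p) := by
  unfold SurroundsList; infer_instance

theorem SurroundsList.surrounds {L : List TripleFace} {p : Triple} (h : SurroundsList L p)
    {w : Fin 3 → ℤ} {S : Face → Prop} (hS : ∀ f ∈ L, S (toFace w f)) : Surrounds S (w + pt p) := by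
  intro a b c hab hca hcb
  have e : ∀ b : Fin 3, Pi.single b (1 : ℤ) = pt (svec (b, 1)) := fun b => (pt_svec (b, 1)).symm
  rw [e, e, ← add_sub, ← pt_sub, ← add_sub, ← pt_sub]
  exact (h a b c hab hca hcb).imp (hS _) (Or.imp (hS _) (hS _))

/-- The list contains a face with the corner `p`. -/
def CornerOf (L : List TripleFace) (p : Triple) : Prop :=
  ∃ f ∈ L, p = f.1 ∨ p = f.1 + svec (f.2 + 1, 1) ∨
    p = f.1 + svec (f.2 + 1, 1) + svec (f.2 + 2, 1) ∨ p = f.1 + svec (f.2 + 2, 1)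

instance (L : List TripleFace) (p : Triple) : Decidable (CornerOf L p) := by
  unfold CornerOf; infer_instance

theorem CornerOf.mem_patchPts {L : List TripleFace} {p : Triple} (h : CornerOf L p)
    {w : Fin 3 → ℤ} {i : ℕ} (hL : ∀ f ∈ L, toFace w f ∈ patch i) :
    proj (w + pt p) ∈ patchPts i := by
  obtain ⟨f, hf, h⟩ := h
  simp only [patchPts, patchTiles, Finset.mem_biUnion, Finset.mem_image, Finset.mem_univ, true_and]
  refine ⟨_, ⟨_, hL f hf, rfl⟩, ?_⟩
  have e : ∀ (q : Triple) (b : Fin 3), proj (w + pt (q + svec (b, 1))) =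
      proj (w + pt q) + dir b := fun q b => by
    rw [← add_pt_add_vec, proj_add_vec, pv_pos]
  rcases h with rfl | rfl | rfl | rfl
  · exact ⟨0, rfl⟩
  · exact ⟨1, (e _ _).symm⟩
  · exact ⟨2, by rw [e, e]; rfl⟩
  · exact ⟨3, (e _ _).symm⟩

/-- The faces of the lists determine the tiling around a chord that starts at the origin. -/
def ShowsChord (In Out : List TripleFace) : Prop :=
  ((0, 0, -1), 1) ∈ In ++ Out ∧ ((-3, 4, 0), 0) ∈ In ++ Out ∧
    (∀ p ∈ chordHull, SurroundsList (In ++ Out) p) ∧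
    (∀ p ∈ chordPts, CornerOf In p) ∧ ∀ p ∈ chordEnds, SurroundsList Out p

instance (In Out : List TripleFace) : Decidable (ShowsChord In Out) := by
  unfold ShowsChord; infer_instance

/-- The lower bound for the height of the start comes from the face at `(0, 0, -1)`, the upper bound
from the face at `(-3, 4, 0)`. -/
theorem Pattern.chord {i : ℕ} {w : Fin 3 → ℤ} {In Out : List TripleFace} (h : Pattern i w In Out)
    (hs : ShowsChord In Out) : Chord i w := by
  obtain ⟨h1, h2, h3, h4, h5⟩ := hs
  have hS : ∀ f ∈ In ++ Out, ∃ j, toFace w f ∈ patch j := by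
    intro f hf
    rcases List.mem_append.1 hf with hf | hf
    exacts [⟨i, h.mem f hf⟩, (h.not_mem f hf).1]
  refine ⟨?_, ?_, fun p hp => good_of_surrounds ((h3 p hp).surrounds hS),
    fun p hp => (h4 p hp).mem_patchPts h.mem,
    fun p hp => proj_not_mem_patchPts ((h5 p hp).surrounds h.not_mem)⟩
  · obtain ⟨j, hj⟩ := hS _ h1
    have := (inPlane_of_mem_patch hj).1
    have e : pt (0, 0, -1) = 0 - pt chordLower := by
      ext l; fin_cases l <;> simp [pt, chordLower]
    have e0 : ht 0 = 0 := by simp [ht]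
    rw [toFace, ht_add, e, ht_sub, e0] at this
    linarith
  · obtain ⟨j, hj⟩ := hS _ h2
    have := (inPlane_of_mem_patch hj).2
    have e : pt chordUpper = Pi.single 0 1 - pt (-3, 4, 0) := by
      ext l; fin_cases l <;> simp [pt, chordUpper]
    rw [toFace, ht_add] at this
    rw [e, ht_sub, ht_single, Int.cast_one, one_mul]
    simp only at this
    linarith

/-! ### Every patch from `P₆` on has a chord -/

/-- Rhombi of the patch near a chord. -/
def chordIn : List TripleFace :=
  [((-5, 5, 1), 1), ((-5, 5, 1), 2), ((-5, 6, -1), 1), ((-5, 6, 0), 1), ((-4, 4, 1), 0),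
    ((-4, 4, 1), 1), ((-4, 4, 1), 2), ((-4, 5, -1), 0), ((-4, 5, -1), 1), ((-4, 5, -1), 2),
    ((-4, 5, 0), 0), ((-4, 5, 0), 1), ((-4, 6, -2), 1), ((-3, 3, 0), 0), ((-3, 3, 0), 1),
    ((-3, 3, 0), 2), ((-3, 3, 1), 0), ((-3, 3, 1), 1), ((-3, 4, -1), 0), ((-3, 4, -1), 1),
    ((-3, 4, -1), 2), ((-3, 4, 0), 0), ((-3, 5, -2), 0), ((-3, 5, -2), 1), ((-2, 2, 0), 0),
    ((-2, 2, 0), 1), ((-2, 2, 0), 2), ((-2, 2, 1), 0), ((-2, 3, -2), 0), ((-2, 3, -2), 1),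
    ((-2, 3, -1), 0), ((-2, 3, -1), 1), ((-2, 4, -2), 0), ((-1, 0, 1), 0), ((-1, 0, 1), 1),
    ((-1, 0, 1), 2), ((-1, 1, 0), 0), ((-1, 1, 0), 1), ((-1, 1, 0), 2), ((-1, 2, -2), 0),
    ((-1, 2, -2), 1), ((-1, 2, -1), 0), ((-1, 2, -1), 1), ((0, -1, 1), 0), ((0, 0, -1), 0),
    ((0, 0, 0), 0), ((0, 1, -2), 0), ((0, 1, -1), 0)]

/-- Rhombi outside the patch near a chord. -/
def chordOut : List TripleFace :=
  [((-6, 6, 1), 2), ((-6, 7, 0), 1), ((-6, 7, 0), 2), ((-5, 6, -1), 0), ((-5, 6, -1), 2),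
    ((-5, 6, 0), 0), ((-5, 7, -2), 0), ((-5, 7, -2), 1), ((-5, 7, -1), 0), ((-4, 6, -2), 0),
    ((0, -1, 1), 2), ((0, 0, -1), 1), ((0, 0, -1), 2), ((0, 0, 0), 1), ((0, 1, -2), 1),
    ((1, -1, -1), 0), ((1, -1, -1), 2), ((1, -1, 0), 0), ((1, 0, -2), 0), ((1, 0, -2), 1)]

/-- The rhombi of `P₆` near a chord. -/
def chordIn₆ : List TripleFace :=
  [((-2, 1, 1), 0), ((-2, 1, 1), 1), ((-2, 1, 1), 2)] ++ chordIn

/-- The rhombi outside `P₆` near a chord. -/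
def chordOut₆ : List TripleFace := [((-5, 5, 1), 0), ((-6, 6, 1), 1)] ++ chordOut

/-- The rhombi of `P_i` near a chord, for `i ≥ 7`. -/
def chordIn₇ : List TripleFace :=
  [((-2, 2, 1), 1), ((-1, 1, 1), 0), ((-5, 5, 1), 0), ((-6, 6, 1), 1)] ++ chordIn

theorem showsChord_six : ShowsChord chordIn₆ chordOut₆ := by decide +kernel

theorem showsChord_seven : ShowsChord chordIn₇ chordOut := by decide +kernel

/-- The rhombi of `P₃` whose descendants lie near the chord of `P₆`. -/
def midIn₃ : List TripleFace :=
  [((-1, 1, 1), 2), ((-1, 2, -1), 1), ((-1, 2, 0), 1), ((0, 0, 0), 0), ((0, 0, 0), 1),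
    ((0, 0, 0), 2), ((0, 1, -1), 0), ((0, 1, -1), 1), ((0, 1, 0), 0), ((1, -1, 0), 0),
    ((1, 0, -1), 0)]

/-- The rhombi outside `P₃` whose descendants lie near the chord of `P₆`. -/
def midOut₃ : List TripleFace :=
  [((-1, 1, 1), 0), ((-1, 2, -1), 0), ((-1, 2, 0), 0), ((1, 0, -1), 1), ((1, 0, -1), 2),
    ((2, 0, -2), 0)]

/-- The rhombi of `P_i` whose descendants lie near a chord of `P_{i+3}`, for `i ≥ 4`. -/
def midIn₄ : List TripleFace :=
  [((0, 1, -1), 0), ((0, 1, -1), 2), ((0, 2, -3), 1), ((0, 2, -2), 1), ((1, 1, -3), 0),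
    ((1, 1, -3), 1), ((1, 1, -2), 0), ((1, 1, -2), 1), ((2, -1, -2), 0), ((2, 0, -3), 0),
    ((2, 0, -2), 0)]

/-- The rhombi outside `P_i` whose descendants lie near a chord of `P_{i+3}`, for `i ≥ 4`. -/
def midOut₄ : List TripleFace :=
  [((0, 2, -3), 0), ((0, 2, -2), 0), ((2, 0, -3), 1), ((2, 0, -3), 2), ((3, 0, -4), 0)]

/-- The ancestors in `P_i` of the rhombi near a chord of `P_{i+6}`, for `i ≥ 3`. -/
def earlyIn₃ : List TripleFace := [((-1, 2, -1), 1), ((-1, 2, 0), 1), ((0, 1, -1), 0)]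

/-- The ancestors outside `P_i` of the rhombi near a chord of `P_{i+6}`, for `i ≥ 3`. -/
def earlyOut₃ : List TripleFace := [((-1, 2, -1), 0), ((0, 1, -1), 2), ((0, 2, -2), 1)]

/-- The ancestors in `P_i` of the rhombi near a chord of `P_{i+6}`, for `i = 1, 2`. -/
def earlyIn₁ : List TripleFace := [((0, 0, 0), 0), ((0, 1, -1), 1), ((1, 0, -1), 0)]

/-- The ancestors outside `P_i` of the rhombi near a chord of `P_{i+6}`, for `i = 1, 2`. -/
def earlyOut₁ : List TripleFace := [((0, 1, -1), 0), ((1, 0, -1), 2), ((1, 1, -2), 1)]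

/-- A rhombus `w + R₂` of `P_i` such that `w + R₁` and `w + R₃` belong to the tiling, but not to
`P_i`. -/
def CornerPattern₁ (i : ℕ) (w : Fin 3 → ℤ) : Prop := Pattern i w [(0, 1)] [(0, 0), (0, 2)]

/-- A rhombus `w + R₂` of `P_i` such that `w + R₁` and its translate by `e₁ - e₃` belong to the
tiling, but not to `P_i`. -/
def CornerPattern₂ (i : ℕ) (w : Fin 3 → ℤ) : Prop := Pattern i w [(0, 1)] [(0, 0), ((1, 0, -1), 0)]

/-- Three substitutions reproduce the first pattern and also give the second one. -/
theorem CornerPattern₁.step {i : ℕ} {w : Fin 3 → ℤ} (h : CornerPattern₁ i w) :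
    ∃ w', CornerPattern₁ (i + 3) w' ∧ CornerPattern₂ (i + 3) w' :=
  ⟨_, (h.steps 3).translate 0 (by decide) (by decide),
    (h.steps 3).translate 0 (by decide) (by decide)⟩

/-- Both patterns occur in `P_1`, `P_2` and `P_3`, and three substitutions of the first one give
both of them again. -/
theorem exists_cornerPattern (i : ℕ) :
    ∃ w, CornerPattern₁ (i + 1) w ∧ CornerPattern₂ (i + 1) w := by
  induction i using Nat.strong_induction_on with
  | h i ih =>
    match i, ih with
    | 0, _ | 1, _ =>
      exact ⟨_, .base 4 (0, 1, -1) (by decide +kernel) (by decide +kernel),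
        .base 4 (0, 1, -1) (by decide +kernel) (by decide +kernel)⟩
    | 2, _ =>
      exact ⟨_, .base 6 (-1, 2, -1) (by decide +kernel) (by decide +kernel),
        .base 6 (-1, 2, -1) (by decide +kernel) (by decide +kernel)⟩
    | i + 3, ih =>
      obtain ⟨w, h, -⟩ := ih i (by omega)
      exact h.step

/-- The chord starts at `(5, -2, -5)`, relative to the image of the origin of the pattern. -/
theorem exists_chord_of_mid {i : ℕ} {w : Fin 3 → ℤ} (h : Pattern i w midIn₄ midOut₄) :
    ∃ τ, Chord (i + 3) τ :=
  ⟨_, ((h.steps 3).translate (5, -2, -5) (by decide +kernel) (by decide +kernel)).chord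
    showsChord_seven⟩

theorem exists_chord_of_early₁ {i : ℕ} {w : Fin 3 → ℤ} (h : Pattern i w earlyIn₁ earlyOut₁) :
    ∃ τ, Chord (i + 6) τ :=
  exists_chord_of_mid (i := i + 3)
    ((h.steps 3).translate 0 (by decide +kernel) (by decide +kernel))

theorem exists_chord_of_early₃ {i : ℕ} {w : Fin 3 → ℤ} (h : Pattern i w earlyIn₃ earlyOut₃) :
    ∃ τ, Chord (i + 6) τ :=
  exists_chord_of_mid (i := i + 3)
    ((h.steps 3).translate (-2, 3, -1) (by decide +kernel) (by decide +kernel))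

theorem CornerPattern₂.exists_chord {i : ℕ} {w : Fin 3 → ℤ} (h : CornerPattern₂ i w) :
    ∃ τ, Chord (i + 9) τ :=
  exists_chord_of_early₃ (i := i + 3)
    ((h.steps 3).translate (1, -2, 1) (by decide +kernel) (by decide +kernel))

/-- The patches `P_6`, …, `P_9` are reached from explicit configurations of `P_0`, …, `P_3`; from
`P_10` on a chord grows out of a corner pattern nine substitutions earlier. -/
theorem exists_chord {i : ℕ} (hi : 6 ≤ i) : ∃ τ, Chord i τ := by
  obtain ⟨i, rfl⟩ := Nat.exists_eq_add_of_le' hi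
  match i with
  | 0 =>
    have h : Pattern 0 (pt 0) [((0, 0, 0), 0), ((0, 0, 0), 1), ((0, 0, 0), 2)]
      [((0, 0, 1), 0), ((0, 1, 0), 0), ((1, 0, -1), 0)] :=
      .base 3 0 (by decide +kernel) (by decide +kernel)
    have h' : Pattern 3 _ midIn₃ midOut₃ :=
      (h.steps 3).translate 0 (by decide +kernel) (by decide +kernel)
    exact ⟨_, ((h'.steps 3).translate (2, -1, -1) (by decide +kernel) (by decide +kernel)).chord
      showsChord_six⟩
  | 1 =>
    exact exists_chord_of_early₁ (i := 1) (w := pt 0)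
      (.base 4 0 (by decide +kernel) (by decide +kernel))
  | 2 =>
    exact exists_chord_of_early₁ (i := 2) (w := pt 0)
      (.base 4 0 (by decide +kernel) (by decide +kernel))
  | 3 =>
    exact exists_chord_of_early₃ (i := 3) (w := pt 0)
      (.base 6 0 (by decide +kernel) (by decide +kernel))
  | i + 4 =>
    obtain ⟨w, -, h⟩ := exists_cornerPattern i
    exact h.exists_chord

end Rauzy

end

theorem mainTheorem2 (k : Type u) [Field k] (ε₀ : Fin 3 → ℤˣ) (hε₀ : ∏ d, ε₀ d = 1)
    (i : ℕ) (hi : 6 ≤ i) :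
    ∃ M : ModuleCat.{u} (Rauzy.FinAlgebra k ε₀ i)ᵐᵒᵖ, IsPeriodicModule M := by
  obtain ⟨τ, hτ⟩ := Rauzy.exists_chord hi
  exact hτ.exists_isPeriodicModule hε₀
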